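/- **Setting.** For a surface $\Sigma\subset\mathbb R^3$ let $F(\Sigma)=\int_\Sigma \frac1{4\pi}e^{-|x|^2/4}\,d\mathcal H^2$ be its Gaussian area. Surfaces are smooth, properly embedded, without boundary, possibly non-compact or empty. Let $I^n=[0,1]^n$, $\mathring I^n=(0,1)^n$, $\partial I^n=I^n\setminus\mathring I^n$. A *continuous (genus $g$) family* is a family $\{\Sigma_\nu\}_{\nu\in I^n}$ of surfaces in $\mathbb R^3$ that varies continuously in the topology of smooth convergence on compact subsets of $\mathbb R^3$ (in particular, any smoothly varying family qualifies), such that $\Sigma_\nu$ has genus $g$ for $\nu\in\mathring I^n$, $\sup_\nu F(\Sigma_\nu)<\infty$, $\nu\mapsto F(\Sigma_\nu)$ is continuous, and $\Sigma_\nu$ is an affine plane or empty for each $\nu\in\partial I^n$. The genus of a surface is the largest number of disjoint simple closed curves on it that can be removed without disconnecting any of its components. Let $\mathrm{Diff}_0$ be the identity component of the diffeomorphism group of $\mathbb R^3$, i.e. the diffeomorphisms that are smoothly isotopic to the identity. The *saturated set* $\Lambda$ of $\{\Sigma_\nu\}$ consists of all continuous (genus $g$) families of the form $\Sigma'_\nu=\psi(\nu,\Sigma_\nu)$,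 where $\psi\in C^\infty(I^n\times\mathbb R^3,\mathbb R^3)$, $\psi(\nu,\cdot)\in\mathrm{Diff}_0$ for every $\nu$, and $\psi(\nu,\cdot)=\mathrm{id}$ for all $\nu$ outside some compact subset of $\mathring I^n$. Put $$W(\Lambda)=\inf_{\{\Sigma'_\nu\}\in\Lambda}\ \max_{\nu\in I^n}F(\Sigma'_\nu).$$ A *minimizing sequence* is a sequence $\{\Sigma^k_\nu\}_\nu\in\Lambda$ with $\max_\nu F(\Sigma^k_\nu)\to W(\Lambda)$; a *min-max sequence* from it is a sequence $\{\Sigma^k_{\nu_k}\}_k$ with $\nu_k\in I^n$ and $F(\Sigma^k_{\nu_k})\to W(\Lambda)$. Identify $\mathbb R^3$ with $S^3\setminus\{\infty\}$ by stereographic projection from the north pole $\infty$ of the unit sphere $S^3\subset\mathbb R^4$. Let $G_2(S^3)$ be the Grassmann bundle of unoriented tangent 2-planes, a plane being identified with the orthogonal projection onto it and distances being taken in $\mathbb R^4\times\mathrm{End}(\mathbb R^4)$. A 2-varifold $V$ on $S^3$ is a finite Borel measure on $G_2(S^3)$, and $\|V\|$ is its image on $S^3$. Let $$\mathbf F_{S^3}(V,V')=\sup\Big\{\int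 f\,dV-\int f\,dV' : |f|\le1,\ \mathrm{Lip}(f)\le1\Big\}.$$ For a surface $\Sigma$ with $F(\Sigma)<\infty$, let $\Sigma^G$ be the varifold of $\Sigma$ weighted by $\frac1{4\pi}e^{-|x|^2/4}$, viewed on $S^3$ with no mass at $\infty$. A varifold $V$ on $S^3$ is *$F$-stationary* if $\int_{G_2(\mathbb R^3)}\big(\mathrm{div}_SX-\tfrac12\langle X,x\rangle\big)\,dV(x,S)=0$ for every smooth compactly supported vector field $X$ on $\mathbb R^3$. **Proposition.** Let $\Lambda$ be the saturated set of a continuous (genus $g$) family $\{\Sigma_\nu\}_{\nu\in I^n}$. If $W(\Lambda)>\max_{\nu\in\partial I^n}F(\Sigma_\nu)$ (the maximum being $0$ if $n=0$), then there is a minimizing sequence $\{\Sigma^k_\nu\}_\nu$ in $\Lambda$ such that for every min-max sequence $\{\Sigma^k_{\nu_k}\}_k$ from it, every subsequence of $\{\Sigma^k_{\nu_k}\}_k$ has a further subsequence along which $(\Sigma^k_{\nu_k})^G$ converges in the metric $\mathbf F_{S^3}$ to an $F$-stationary varifold $V$ with $\|V\|(\mathbb R^3)=W(\Lambda)$ and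 $\|V\|(\{\infty\})=0$. -/

import Mathlib

open MeasureTheory Set Filter Topology
open scoped ENNReal ContDiff InnerProductSpace

noncomputable section

/-! ### Euclidean three-space, the three-sphere and their Grassmann bundles -/

/-- `ℝ³` with its Euclidean structure. -/
abbrev E3 := EuclideanSpace ℝ (Fin 3)

/-- `ℝ⁴ = ℝ³ × ℝ` with its Euclidean structure; `S³` is its unit sphere. -/
abbrev E4 := WithLp 2 (E3 × ℝ)

instance : ContinuousSMul ℝ E3 := IsBoundedSMul.continuousSMul
instance : ContinuousSMul ℝ E4 := IsBoundedSMul.continuousSMul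

/-- `P` is the orthogonal projection onto a two-dimensional subspace. Unoriented 2-planes are
represented by their orthogonal projections; the plane itself is the range of `P`. -/
def IsPlaneProj {E : Type*} [NormedAddCommGroup E] [InnerProductSpace ℝ E] [CompleteSpace E]
    (P : E →L[ℝ] E) : Prop :=
  IsStarProjection P ∧ Module.finrank ℝ P.range = 2

/-- `G₂(ℝ³)`: pairs of a point of `ℝ³` and an unoriented 2-plane. -/
abbrev GrR3 := {q : E3 × (E3 →L[ℝ] E3) // IsPlaneProj q.2}

/-- `G₂(S³)`: pairs of a point `y` of the round sphere `S³ ⊆ ℝ⁴` and an unoriented 2-plane in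
`T_y S³ = y^⊥`, with the distance inherited from `ℝ⁴ × End(ℝ⁴)`. -/
abbrev GrS3 := {q : E4 × (E4 →L[ℝ] E4) // ‖q.1‖ = 1 ∧ IsPlaneProj q.2 ∧ q.2 q.1 = 0}

/-- The north pole of `S³`, playing the role of the point `∞` in `S³ = ℝ³ ∪ {∞}`. -/
def northPole : E4 := WithLp.toLp 2 (0, 1)

/-- The conformal factor of inverse stereographic projection: `ds₀² = (stereoFactor x)² dx²`. -/
def stereoFactor (x : E3) : ℝ := 2 / (1 + ‖x‖ ^ 2)

/-- Inverse stereographic projection `x ↦ (2x, |x|² - 1) / (|x|² + 1)`, which identifies `ℝ³`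
with `S³` minus the north pole. -/
def stereo (x : E3) : E4 :=
  WithLp.toLp 2 ((2 / (1 + ‖x‖ ^ 2)) • x, (‖x‖ ^ 2 - 1) / (‖x‖ ^ 2 + 1))

/-- The differential of `stereo` at `x`, divided by the conformal factor: a linear isometry of
`ℝ³` onto the tangent space of `S³` at `stereo x`. -/
def stereoFrame (x : E3) : E3 →L[ℝ] E4 :=
  (WithLp.prodContinuousLinearEquiv 2 ℝ E3 ℝ).symm.toContinuousLinearMap ∘L
    ((ContinuousLinearMap.id ℝ E3 - stereoFactor x • (innerSL ℝ x).smulRight x).prod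
      (stereoFactor x • innerSL ℝ x))

theorem stereoFrame_apply (x v : E3) : stereoFrame x v =
    WithLp.toLp 2 (v - (stereoFactor x * ⟪x, v⟫_ℝ) • x, stereoFactor x * ⟪x, v⟫_ℝ) := by
  simp [stereoFrame, smul_smul]

theorem one_add_normSq_pos (x : E3) : 0 < 1 + ‖x‖ ^ 2 := by positivity

theorem stereoFactor_mul (x : E3) : stereoFactor x * (1 + ‖x‖ ^ 2) = 2 := by
  have := one_add_normSq_pos x
  unfold stereoFactor
  field_simp

theorem stereoFactor_pos (x : E3) : 0 < stereoFactor x := by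
  have := one_add_normSq_pos x
  unfold stereoFactor
  positivity

theorem stereo_eq (x : E3) :
    stereo x = WithLp.toLp 2 (stereoFactor x • x, 1 - stereoFactor x) := by
  have := one_add_normSq_pos x
  have h : (‖x‖ ^ 2 - 1) / (‖x‖ ^ 2 + 1) = 1 - 2 / (1 + ‖x‖ ^ 2) := by
    have h2 : ‖x‖ ^ 2 + 1 ≠ 0 := by positivity
    field_simp
    ring
  simp [stereo, stereoFactor, h]

theorem norm_stereo (x : E3) : ‖stereo x‖ = 1 := by
  have h1 := stereoFactor_mul x
  have h : ‖stereo x‖ ^ 2 = 1 := by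
    rw [stereo_eq, WithLp.prod_norm_sq_eq_of_L2]
    change ‖stereoFactor x • x‖ ^ 2 + ‖1 - stereoFactor x‖ ^ 2 = 1
    rw [norm_smul, Real.norm_eq_abs, Real.norm_eq_abs, mul_pow, sq_abs, sq_abs]
    linear_combination stereoFactor x * h1
  nlinarith [norm_nonneg (stereo x)]

theorem hasFDerivAt_stereo (x : E3) :
    HasFDerivAt stereo (stereoFactor x • stereoFrame x) x := by
  have h0 : (1 + ‖x‖ ^ 2) ≠ 0 := (one_add_normSq_pos x).ne'
  have hs : HasFDerivAt (fun y : E3 => 1 + ‖y‖ ^ 2) (2 • innerSL ℝ x) x :=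
    (hasStrictFDerivAt_norm_sq x).hasFDerivAt.const_add 1
  have hf : HasFDerivAt stereoFactor (-(stereoFactor x ^ 2) • innerSL ℝ x) x := by
    have h1 := (((hasDerivAt_inv h0).comp_hasFDerivAt x hs).const_mul 2)
    refine (h1.congr_fderiv ?_).congr_of_eventuallyEq (Eventually.of_forall fun y => ?_)
    · ext v
      simp [stereoFactor]
      field_simp
    · simp [stereoFactor, div_eq_mul_inv]
  have h2 : HasFDerivAt (fun y : E3 => (stereoFactor y • y, 1 - stereoFactor y)) _ x :=
    (hf.smul (hasFDerivAt_id x)).prodMk (hf.const_sub 1)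
  have h3 := (WithLp.prodContinuousLinearEquiv 2 ℝ E3 ℝ).symm.toContinuousLinearMap.hasFDerivAt.comp
    x h2
  refine (h3.congr_fderiv ?_).congr_of_eventuallyEq (Eventually.of_forall fun y => ?_)
  · ext1 v
    simp only [smul_apply, stereoFrame_apply]
    apply (WithLp.prodContinuousLinearEquiv 2 ℝ E3 ℝ).injective
    ext1
    · simp [smul_smul, sub_eq_add_neg]
      ring_nf
    · simp
      ring
  · simp [stereo_eq]

theorem fderiv_stereo_apply (x v : E3) :
    fderiv ℝ stereo x v = stereoFactor x • stereoFrame x v := by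
  have h := (hasFDerivAt_stereo x).differentiableAt.hasFDerivAt.unique (hasFDerivAt_stereo x)
  exact congrArg (fun L : E3 →L[ℝ] E4 => L v) h

theorem inner_stereoFrame (x v w : E3) :
    ⟪stereoFrame x v, stereoFrame x w⟫_ℝ = ⟪v, w⟫_ℝ := by
  have h1 := stereoFactor_mul x
  rw [stereoFrame_apply, stereoFrame_apply, WithLp.prod_inner_apply]
  simp only [inner_sub_left, inner_sub_right, real_inner_smul_left, real_inner_smul_right,
    real_inner_self_eq_norm_sq, real_inner_comm x v, RCLike.inner_apply, conj_trivial]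
  linear_combination (stereoFactor x * ⟪x, v⟫_ℝ * ⟪x, w⟫_ℝ) * h1

theorem inner_stereoFrame_stereo (x v : E3) : ⟪stereoFrame x v, stereo x⟫_ℝ = 0 := by
  have h1 := stereoFactor_mul x
  rw [stereoFrame_apply, stereo_eq, WithLp.prod_inner_apply]
  simp only [inner_sub_left, real_inner_smul_left, real_inner_smul_right,
    real_inner_self_eq_norm_sq, real_inner_comm x v, RCLike.inner_apply, conj_trivial]
  linear_combination (-stereoFactor x * ⟪x, v⟫_ℝ) * h1

theorem adjoint_stereoFrame_comp (x : E3) :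
    (stereoFrame x).adjoint ∘L stereoFrame x = ContinuousLinearMap.id ℝ E3 := by
  ext1 v
  refine ext_inner_right ℝ fun w => ?_
  rw [ContinuousLinearMap.comp_apply, ContinuousLinearMap.adjoint_inner_left, inner_stereoFrame]
  rfl

theorem adjoint_stereoFrame_apply (x v : E3) : (stereoFrame x).adjoint (stereoFrame x v) = v :=
  congrArg (fun L : E3 →L[ℝ] E3 => L v) (adjoint_stereoFrame_comp x)

theorem stereoFrame_injective (x : E3) : Function.Injective (stereoFrame x) :=
  Function.LeftInverse.injective (adjoint_stereoFrame_apply x)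

/-- The plane `d(stereo)_x (S)` in `T S³`, for `S` the range of `P`. -/
def liftProj (x : E3) (P : E3 →L[ℝ] E3) : E4 →L[ℝ] E4 :=
  stereoFrame x ∘L P ∘L (stereoFrame x).adjoint

theorem range_liftProj (x : E3) (P : E3 →L[ℝ] E3) :
    (liftProj x P).range = P.range.map (fderiv ℝ stereo x).toLinearMap := by
  have h0 := (stereoFactor_pos x).ne'
  ext y
  simp only [LinearMap.mem_range, Submodule.mem_map, ContinuousLinearMap.coe_coe]
  constructor
  · rintro ⟨z, rfl⟩
    refine ⟨P ((stereoFactor x)⁻¹ • (stereoFrame x).adjoint z), ⟨_, rfl⟩, ?_⟩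
    rw [fderiv_stereo_apply]
    simp [liftProj, smul_smul, h0]
  · rintro ⟨_, ⟨w, rfl⟩, rfl⟩
    refine ⟨stereoFactor x • stereoFrame x w, ?_⟩
    rw [fderiv_stereo_apply]
    simp [liftProj, adjoint_stereoFrame_apply]

theorem isPlaneProj_liftProj (x : E3) {P : E3 →L[ℝ] E3} (hP : IsPlaneProj P) :
    IsPlaneProj (liftProj x P) := by
  refine ⟨⟨?_, ?_⟩, ?_⟩
  · have h := hP.1.isIdempotentElem
    ext1 v
    have h2 := congrArg (fun L : E3 →L[ℝ] E3 => L ((stereoFrame x).adjoint v)) h.eq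
    simp only [mul_apply_eq_comp] at h2
    simp [liftProj, adjoint_stereoFrame_apply, h2]
  · have h := hP.1.isSelfAdjoint
    rw [ContinuousLinearMap.isSelfAdjoint_iff'] at h ⊢
    simp [liftProj, ContinuousLinearMap.adjoint_comp, h, ContinuousLinearMap.comp_assoc]
  · have h0 := (stereoFactor_pos x).ne'
    rw [range_liftProj, ← hP.2]
    refine (Submodule.equivMapOfInjective _ (fun v w h => ?_) _).finrank_eq.symm
    rw [ContinuousLinearMap.coe_coe, fderiv_stereo_apply, fderiv_stereo_apply] at h
    exact stereoFrame_injective x (smul_right_injective _ h0 h)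

theorem liftProj_stereo (x : E3) (P : E3 →L[ℝ] E3) : liftProj x P (stereo x) = 0 := by
  have h : (stereoFrame x).adjoint (stereo x) = 0 :=
    ext_inner_left ℝ fun v => by
      rw [ContinuousLinearMap.adjoint_inner_right, inner_stereoFrame_stereo, inner_zero_right]
  simp [liftProj, h]

/-- The inclusion `G₂(ℝ³) ⊆ G₂(S³)`, `(x, S) ↦ (stereo x, d(stereo)_x (S))`. -/
def grLift (q : GrR3) : GrS3 :=
  ⟨(stereo q.1.1, liftProj q.1.1 q.1.2),
    norm_stereo q.1.1, isPlaneProj_liftProj q.1.1 q.2, liftProj_stereo q.1.1 q.1.2⟩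

theorem isClosed_isPlaneProj : IsClosed {P : E3 →L[ℝ] E3 | IsPlaneProj P} := by
  have h : {P : E3 →L[ℝ] E3 | IsPlaneProj P} = {P | P * P = P} ∩ {P | star P = P} ∩
      {P | LinearMap.trace ℝ E3 (ContinuousLinearMap.coeLM ℝ P) = 2} := by
    ext P
    have key (hP : P * P = P) : LinearMap.trace ℝ E3 (ContinuousLinearMap.coeLM ℝ P) =
        Module.finrank ℝ P.range := by
      refine LinearMap.IsProj.trace (p := P.range) ⟨fun v => ⟨v, rfl⟩, ?_⟩
      rintro _ ⟨v, rfl⟩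
      exact congrArg (fun L : E3 →L[ℝ] E3 => L v) hP
    constructor
    · rintro ⟨⟨h1, h2⟩, h3⟩
      refine ⟨⟨h1, h2⟩, ?_⟩
      change LinearMap.trace ℝ E3 (ContinuousLinearMap.coeLM ℝ P) = 2
      rw [key h1, h3]
      norm_num
    · rintro ⟨⟨h1, h2⟩, h3⟩
      refine ⟨⟨h1, h2⟩, ?_⟩
      change LinearMap.trace ℝ E3 (ContinuousLinearMap.coeLM ℝ P) = 2 at h3
      rw [key h1] at h3
      exact_mod_cast h3
  rw [h]
  refine ((isClosed_eq (by fun_prop) continuous_id).inter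
    (isClosed_eq (ContinuousLinearMap.adjoint (𝕜 := ℝ) (E := E3) (F := E3)).continuous continuous_id)).inter (isClosed_eq ?_ continuous_const)
  exact LinearMap.continuous_of_finiteDimensional
    ((LinearMap.trace ℝ E3).comp (ContinuousLinearMap.coeLM ℝ))

theorem continuous_grLift : Continuous grLift := by
  have h1 : Continuous stereoFactor := by
    unfold stereoFactor
    exact continuous_const.div (by fun_prop) fun x => (one_add_normSq_pos x).ne'
  have h2 : Continuous stereo := continuous_iff_continuousAt.2 fun x =>
    (hasFDerivAt_stereo x).continuousAt
  have h3 : Continuous stereoFrame := by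
    refine continuous_clm_apply.2 fun v => ?_
    simp only [stereoFrame_apply]
    fun_prop
  refine Continuous.subtype_mk (Continuous.prodMk (by fun_prop) ?_) _
  have h4 : Continuous fun q : GrR3 => stereoFrame q.1.1 := by fun_prop
  have h5 : Continuous fun q : GrR3 => (stereoFrame q.1.1).adjoint :=
    ContinuousLinearMap.adjoint.continuous.comp h4
  exact h4.clm_comp ((continuous_snd.comp continuous_subtype_val).clm_comp h5)

theorem injective_grLift : Function.Injective grLift := by
  rintro ⟨⟨x, P⟩, hP⟩ ⟨⟨y, Q⟩, hQ⟩ h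
  have h0 := congrArg Subtype.val h
  have h1 : stereo x = stereo y := congrArg Prod.fst h0
  have h2 : liftProj x P = liftProj y Q := congrArg Prod.snd h0
  rw [stereo_eq, stereo_eq] at h1
  have h3 : (stereoFactor x • x, 1 - stereoFactor x) = (stereoFactor y • y, 1 - stereoFactor y) :=
    congrArg WithLp.ofLp h1
  have h4 : stereoFactor x = stereoFactor y := by linarith [congrArg Prod.snd h3]
  have h5 : stereoFactor x • x = stereoFactor y • y := congrArg Prod.fst h3
  rw [← h4] at h5
  obtain rfl : x = y := smul_right_injective _ (stereoFactor_pos x).ne' h5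
  have h6 : P = Q := by
    ext1 v
    have h7 := congrArg (fun L : E4 →L[ℝ] E4 => (stereoFrame x).adjoint (L (stereoFrame x v))) h2
    simpa only [liftProj, ContinuousLinearMap.comp_apply, adjoint_stereoFrame_apply] using h7
  subst h6
  rfl

/-- Pulling measures back along `grLift` is the restriction of varifolds to `ℝ³`. -/
theorem measurableEmbedding_grLift : MeasurableEmbedding grLift := by
  have hc : IsClosed {q : E3 × (E3 →L[ℝ] E3) | IsPlaneProj q.2} :=
    isClosed_isPlaneProj.preimage continuous_snd
  have : PolishSpace GrR3 := hc.polishSpace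
  exact continuous_grLift.measurableEmbedding injective_grLift

/-! ### Varifolds -/

/-- The mass measure `‖V‖` of a 2-varifold `V` on `S³` evaluated on `A ⊆ S³`. A 2-varifold on the
compact manifold `S³` is a finite Borel measure on `G₂(S³)`. -/
def mass (V : Measure GrS3) (A : Set E4) : ℝ≥0∞ := V {q | q.1.1 ∈ A}

/-- The metric `𝐅` on 2-varifolds on `S³`. -/
def Fdist (V W : Measure GrS3) : ℝ :=
  sSup {r | ∃ f : GrS3 → ℝ, (∀ q, |f q| ≤ 1) ∧ LipschitzWith 1 f ∧
    r = ∫ q, f q ∂V - ∫ q, f q ∂W}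

/-- The integrand `div_S X - ⟨X, x⟩ / 2` of the first variation with respect to the Gaussian
metric. If `P` is the orthogonal projection onto `S`, then `div_S X = tr (P ∘ DX)`. -/
def gaussDiv (X : E3 → E3) (q : GrR3) : ℝ :=
  LinearMap.trace ℝ E3 (q.1.2 ∘L fderiv ℝ X q.1.1).toLinearMap - ⟪X q.1.1, q.1.1⟫_ℝ / 2

/-- The first variation `δ_G V (X)` of (the restriction to `ℝ³` of) a varifold `V` on `S³`; the
restriction of `V` to `G₂(ℝ³)` is its pullback under the inclusion. -/
def firstVariation (V : Measure GrS3) (X : E3 → E3) : ℝ :=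
  ∫ q, gaussDiv X q ∂(V.comap grLift)

/-- `V` is `F`-stationary: its first variation vanishes on all smooth compactly supported vector
fields on `ℝ³`. -/
def IsFStationary (V : Measure GrS3) : Prop :=
  ∀ X : E3 → E3, ContDiff ℝ ∞ X → HasCompactSupport X → firstVariation V X = 0

/-! ### Surfaces and their Gaussian area -/

/-- The Gaussian weight `(4π)⁻¹ exp (-|x|²/4)`. -/
def gaussWeight (x : E3) : ℝ := 1 / (4 * Real.pi) * Real.exp (-‖x‖ ^ 2 / 4)

/-- The Gaussian area `F(S) = ∫_S (4π)⁻¹ exp (-|x|²/4) dℋ²`. -/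
def gaussArea (S : Set E3) : ℝ≥0∞ := ∫⁻ x in S, ENNReal.ofReal (gaussWeight x) ∂μHE[2]

/-- The tangent plane `T_x S` of a surface. -/
def tangentPlane (S : Set E3) (x : E3) : Submodule ℝ E3 :=
  Submodule.span ℝ (tangentConeAt ℝ S x)

/-- The (multiplicity one) 2-varifold on `ℝ³` defined by a surface: the image of `ℋ²` restricted
to `S` under `x ↦ (x, T_x S)`. -/
def surfaceVarifold (S : Set E3) : Measure GrR3 :=
  ((μHE[2].restrict S).map
    fun x : E3 => (x, (tangentPlane S x).starProjection)).comap Subtype.val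

/-- The Gaussian varifold `S^G = (4π)⁻¹ exp (-|x|²/4) S`, viewed as a varifold on `S³` which does
not charge the point at infinity. -/
def gaussVarifold (S : Set E3) : Measure GrS3 :=
  ((surfaceVarifold S).withDensity fun q => ENNReal.ofReal (gaussWeight q.1.1)).map grLift

/-- `S` has genus `g`: the largest number of disjoint Jordan curves on `S` whose complement in
every connected component of `S` is still connected is `g`. -/
def HasGenus (S : Set E3) (g : ℕ) : Prop :=
  IsGreatest {k : ℕ | ∃ γ : Fin k → Circle → E3,
    (∀ i, Continuous (γ i) ∧ Function.Injective (γ i) ∧ range (γ i) ⊆ S) ∧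
    Pairwise (fun i j => Disjoint (range (γ i)) (range (γ j))) ∧
    ∀ x ∈ S, IsPreconnected (connectedComponentIn S x \ ⋃ i, range (γ i))} g

def IsAffinePlane (S : Set E3) : Prop :=
  ∃ A : AffineSubspace ℝ E3, Module.finrank ℝ A.direction = 2 ∧ (A : Set E3) = S

/-! ### Continuous families and their saturations -/

/-- The closed cube `Iⁿ = [0,1]ⁿ`. -/
abbrev Cube (n : ℕ) := Icc (0 : Fin n → ℝ) 1

/-- The open cube `(0,1)ⁿ`, as a subset of `Iⁿ`. -/
def openCube (n : ℕ) : Set (Cube n) := {ν | ∀ i, ν.1 i ∈ Ioo (0 : ℝ) 1}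

/-- The boundary `∂Iⁿ = Iⁿ \ (0,1)ⁿ`. -/
def cubeBoundary (n : ℕ) : Set (Cube n) := (openCube n)ᶜ

/-- `S` is a family of smooth, properly embedded surfaces without boundary in `ℝ³` (possibly
empty) which varies continuously in the topology of smooth convergence on compact sets: near
each parameter and each point of `ℝ³`, `S ν` is the regular zero set of a smooth function that
depends continuously on `ν` together with all its space derivatives. -/
def IsLocallySmoothFamily {n : ℕ} (S : Cube n → Set E3) : Prop :=
  ∀ (ν₀ : Cube n) (p : E3), ∃ U ∈ 𝓝 ν₀, ∃ B ∈ 𝓝 p, ∃ f : Cube n → E3 → ℝ,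
    (∀ ν, ContDiff ℝ ∞ (f ν)) ∧
    (∀ m : ℕ, Continuous fun q : Cube n × E3 => iteratedFDeriv ℝ m (f q.1) q.2) ∧
    ∀ ν ∈ U, ∀ x ∈ B, (x ∈ S ν ↔ f ν x = 0) ∧ (f ν x = 0 → fderiv ℝ (f ν) x ≠ 0)

/-- A continuous (genus `g`) family of surfaces parametrized by `Iⁿ`. -/
structure IsContinuousFamily {n : ℕ} (g : ℕ) (S : Cube n → Set E3) : Prop where
  smooth : IsLocallySmoothFamily S
  genus : ∀ ν ∈ openCube n, HasGenus (S ν) g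
  bounded : (⨆ ν, gaussArea (S ν)) < ⊤
  continuous_area : Continuous fun ν => gaussArea (S ν)
  boundary : ∀ ν ∈ cubeBoundary n, IsAffinePlane (S ν) ∨ S ν = ∅

/-- `φ` is a smooth diffeomorphism of `ℝ³`. -/
def IsDiffeo (φ : E3 → E3) : Prop :=
  ContDiff ℝ ∞ φ ∧ ∃ χ : E3 → E3, ContDiff ℝ ∞ χ ∧
    Function.LeftInverse χ φ ∧ Function.RightInverse χ φ

/-- `φ ∈ Diff₀`, the identity component of the diffeomorphism group of `ℝ³`: `φ` can be joined to
the identity by a smooth isotopy. -/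
def IsDiffZero (φ : E3 → E3) : Prop :=
  ∃ H : ℝ × E3 → E3, ContDiffOn ℝ ∞ H (Icc 0 1 ×ˢ univ) ∧
    (∀ t ∈ Icc (0 : ℝ) 1, IsDiffeo fun x => H (t, x)) ∧
    (∀ x, H (0, x) = x) ∧ ∀ x, H (1, x) = φ x

/-- The family `S'` is gotten from `S` by a smooth family `ψ` of elements of `Diff₀` that is the
identity for parameters outside a compact subset of the open cube. -/
def IsHomotopicTo {n : ℕ} (S' S : Cube n → Set E3) : Prop :=
  ∃ ψ : (Fin n → ℝ) × E3 → E3,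
    ContDiffOn ℝ ∞ ψ (Icc 0 1 ×ˢ univ) ∧
    (∀ ν : Cube n, IsDiffZero fun x => ψ (ν, x)) ∧
    (∃ K : Set (Cube n), IsCompact K ∧ K ⊆ openCube n ∧ ∀ ν ∉ K, ∀ x, ψ (ν, x) = x) ∧
    ∀ ν : Cube n, S' ν = (fun x => ψ (ν, x)) '' S ν

/-- The saturated set (homotopy class) of a continuous family. -/
def saturation {n : ℕ} (g : ℕ) (S : Cube n → Set E3) : Set (Cube n → Set E3) :=
  {S' | IsContinuousFamily g S' ∧ IsHomotopicTo S' S}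

/-- The maximal Gaussian area of the slices of a family. -/
def maxArea {n : ℕ} (S : Cube n → Set E3) : ℝ≥0∞ := ⨆ ν, gaussArea (S ν)

/-- The min-max value `W(Λ)`. -/
def minMaxValue {n : ℕ} (Λ : Set (Cube n → Set E3)) : ℝ≥0∞ := ⨅ S ∈ Λ, maxArea S

/-- `Φ` is a minimizing sequence in `Λ`. -/
def IsMinimizingSeq {n : ℕ} (Λ : Set (Cube n → Set E3)) (Φ : ℕ → Cube n → Set E3) : Prop :=
  (∀ k, Φ k ∈ Λ) ∧ Tendsto (fun k => maxArea (Φ k)) atTop (𝓝 (minMaxValue Λ))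

/-- The parameters `ν k` pick out a min-max sequence `Φ k (ν k)` from `Φ`. -/
def IsMinMaxSeq {n : ℕ} (Λ : Set (Cube n → Set E3)) (Φ : ℕ → Cube n → Set E3)
    (ν : ℕ → Cube n) : Prop :=
  Tendsto (fun k => gaussArea (Φ k (ν k))) atTop (𝓝 (minMaxValue Λ))

end

/-!
The minimizing sequence is obtained by pulling tight: an arbitrary minimizing sequence of families
is improved by one explicit step of descent, so that no flow of vector fields is needed.

**Perturbations.** A smooth family of fields `X ν` with `|X|`, `|DX|` and `|⟨X, x⟩|` at most `1/2`
(`IsControlled`, `IsControlledFamily`) gives diffeomorphisms `x ↦ x + X ν x` isotopic to the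
identity, and moving a family of the saturated set by them stays in the saturated set
(`IsControlledFamily.image_mem_saturation`). The area formula for surfaces
(`HasTangentPlanes.area_formula`) expresses the new Gaussian area as the integral of `areaRatio`,
which is at most `1 + (div X - ⟨X, x⟩ / 2) + 4 N²` when the three bounds hold with `N`
(`IsControlled.areaRatio_le`).

**Continuity.** In a continuous family the Gaussian measures, together with the tangent planes,
vary continuously when tested against bounded continuous functions
(`IsLocallySmoothFamily.continuous_integral`): locally the surfaces are graphs that converge with
their differentials, and since the total area is continuous, no mass escapes to infinity. In
particular the area stays continuous after a perturbation, and the first variation along a fixed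
field is a continuous function of the parameter.

**Descent.** The space `G₂(S³)` is compact, so the functions on it that extend Gaussian divergences
of controlled fields have a countable dense subset (`exists_testFields`). A family is moved along
minus the sum of the first `k` of these fields, with coefficients that are smooth approximations of
the first variations, cut off where the area is below a level between the boundary maximum and the
min-max value (`IsContinuousFamily.exists_descent`). The area drops by a fixed multiple of the
weighted sum of squares of the first variations, up to an error tending to zero, and the size of the
move is controlled by the same sum.

**Limits.** Along a min-max sequence of the improved families, the areas before and after the move
have the same limit, so the first variations before the move tend to zero, and so does the size of
the move. Hence the surfaces before and after it have the same weak limits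
(`IsControlled.abs_integral_gaussVarifold_image_sub_le`), which exist by compactness and are
stationary. The fields `x / (3 (R + |x|²))`, whose Gaussian divergence tends to zero pointwise as
`R → ∞` while its value at infinity stays away from zero, are among the test fields, so the limit
has no mass at infinity (`isFStationary_of_testFunctions`). Weak convergence implies convergence in
the metric `𝐅` by the theorem of Arzelà and Ascoli (`tendsto_Fdist`).
-/

/-! ### Planes and the Jacobian of a linear map along a plane -/

/-- The Jacobian of `L` along the plane onto which `P` projects: the factor by which `L` scales
areas in that plane. It is the square root of the second elementary symmetric function of
`P L* L P`, written through traces so that it is visibly continuous in `(L, P)`. -/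
@[irreducible] noncomputable def jac (L P : E3 →L[ℝ] E3) : ℝ :=
  √((LinearMap.trace ℝ E3 (P ∘L L.adjoint ∘L L ∘L P).toLinearMap ^ 2 -
    LinearMap.trace ℝ E3 ((P ∘L L.adjoint ∘L L ∘L P) ∘L
      (P ∘L L.adjoint ∘L L ∘L P)).toLinearMap) / 2)

theorem continuous_trace : Continuous fun L : E3 →L[ℝ] E3 => LinearMap.trace ℝ E3 L.toLinearMap :=
  LinearMap.continuous_of_finiteDimensional
    ((LinearMap.trace ℝ E3).comp (ContinuousLinearMap.coeLM ℝ))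

theorem Continuous.jac {X : Type*} [TopologicalSpace X] {f g : X → E3 →L[ℝ] E3}
    (hf : Continuous f) (hg : Continuous g) : Continuous fun x => _root_.jac (f x) (g x) := by
  have h1 : Continuous fun x => (f x).adjoint := ContinuousLinearMap.adjoint.continuous.comp hf
  have h2 : Continuous fun x => g x ∘L (f x).adjoint ∘L f x ∘L g x :=
    hg.clm_comp (h1.clm_comp (hf.clm_comp hg))
  unfold _root_.jac
  exact ((((continuous_trace.comp h2).pow 2).sub
    (continuous_trace.comp (h2.clm_comp h2))).div_const 2).sqrt

theorem ContinuousOn.jac {X : Type*} [TopologicalSpace X] {f g : X → E3 →L[ℝ] E3} {s : Set X}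
    (hf : ContinuousOn f s) (hg : ContinuousOn g s) :
    ContinuousOn (fun x => _root_.jac (f x) (g x)) s := by
  rw [continuousOn_iff_continuous_domRestrict] at *
  exact hf.jac hg

theorem jac_nonneg (L P : E3 →L[ℝ] E3) : 0 ≤ jac L P := by
  unfold jac
  exact Real.sqrt_nonneg _

namespace IsPlaneProj

variable {P : E3 →L[ℝ] E3}

theorem eq_starProjection (hP : IsPlaneProj P) : P = P.range.starProjection :=
  (isStarProjection_iff_eq_starProjection_range.1 hP.1).2

theorem idem (hP : IsPlaneProj P) (v : E3) : P (P v) = P v :=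
  congrArg (fun L : E3 →L[ℝ] E3 => L v) hP.1.isIdempotentElem.eq

theorem inner_left (hP : IsPlaneProj P) (v w : E3) : ⟪P v, w⟫_ℝ = ⟪v, P w⟫_ℝ := by
  have h := hP.1.isSelfAdjoint
  rw [ContinuousLinearMap.isSelfAdjoint_iff'] at h
  rw [← ContinuousLinearMap.adjoint_inner_left, h]

theorem apply_of_mem (hP : IsPlaneProj P) {v : E3} (hv : v ∈ P.range) : P v = v := by
  obtain ⟨w, rfl⟩ := hv
  exact hP.idem w

theorem exists_basis (hP : IsPlaneProj P) : ∃ b : OrthonormalBasis (Fin 2) ℝ P.range,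
    ∀ v, P v = ∑ i, ⟪(b i : E3), v⟫_ℝ • (b i : E3) := by
  refine ⟨(stdOrthonormalBasis ℝ P.range).reindex (finCongr hP.2), fun v => ?_⟩
  set b := (stdOrthonormalBasis ℝ P.range).reindex (finCongr hP.2)
  have h := b.sum_repr' (P.range.orthogonalProjectionOnto v)
  conv_lhs => rw [hP.eq_starProjection]
  rw [Submodule.starProjection_apply, ← h]
  push_cast
  refine Finset.sum_congr rfl fun i _ => ?_
  congr 1
  rw [Submodule.coe_inner, ← Submodule.starProjection_apply]
  rw [← hP.eq_starProjection, ← hP.inner_left, hP.apply_of_mem (b i).2]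

theorem trace_comp {b : OrthonormalBasis (Fin 2) ℝ P.range}
    (hb : ∀ v, P v = ∑ i, ⟪(b i : E3), v⟫_ℝ • (b i : E3)) (E : E3 →L[ℝ] E3) :
    LinearMap.trace ℝ E3 (P ∘L E).toLinearMap = ∑ i, ⟪(b i : E3), E (b i)⟫_ℝ := by
  have h : (P ∘L E).toLinearMap =
      ∑ i, ((innerSL ℝ (b i : E3)) ∘L E).toLinearMap.smulRight (b i : E3) := by
    ext1 v
    simp [hb]
  rw [h, map_sum]
  refine Finset.sum_congr rfl fun i _ => ?_
  rw [LinearMap.trace_smulRight]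
  simp

theorem norm_basis (b : OrthonormalBasis (Fin 2) ℝ P.range) (i : Fin 2) : ‖(b i : E3)‖ = 1 :=
  b.orthonormal.1 i

theorem norm_apply_le (hP : IsPlaneProj P) (v : E3) : ‖P v‖ ≤ ‖v‖ := by
  rw [hP.eq_starProjection]
  exact Submodule.norm_starProjection_apply_le _ v

theorem abs_trace_comp_le (hP : IsPlaneProj P) (E : E3 →L[ℝ] E3) :
    |LinearMap.trace ℝ E3 (P ∘L E).toLinearMap| ≤ 2 * ‖E‖ := by
  obtain ⟨b, hb⟩ := hP.exists_basis
  rw [trace_comp hb]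
  have (i : Fin 2) : |⟪(b i : E3), E (b i)⟫_ℝ| ≤ ‖E‖ := by
    refine (abs_real_inner_le_norm _ _).trans ?_
    have := E.le_opNorm (b i : E3)
    rw [norm_basis] at *
    linarith
  rw [Fin.sum_univ_two]
  exact (abs_add_le _ _).trans (by linarith [this 0, this 1])

theorem trace_gram {b : OrthonormalBasis (Fin 2) ℝ P.range}
    (hb : ∀ v, P v = ∑ i, ⟪(b i : E3), v⟫_ℝ • (b i : E3)) (hP : IsPlaneProj P)
    (L : E3 →L[ℝ] E3) :
    LinearMap.trace ℝ E3 (P ∘L L.adjoint ∘L L ∘L P).toLinearMap = ∑ i, ‖L (b i)‖ ^ 2 := by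
  rw [trace_comp hb]
  refine Finset.sum_congr rfl fun i _ => ?_
  simp [ContinuousLinearMap.adjoint_inner_right, hP.apply_of_mem (b i).2]

/-- The definition of `jac` by traces amounts to the square root of the Gram determinant. -/
theorem jac_eq {b : OrthonormalBasis (Fin 2) ℝ P.range}
    (hb : ∀ v, P v = ∑ i, ⟪(b i : E3), v⟫_ℝ • (b i : E3)) (hP : IsPlaneProj P)
    (L : E3 →L[ℝ] E3) :
    jac L P = √(‖L (b 0)‖ ^ 2 * ‖L (b 1)‖ ^ 2 - ⟪L (b 0), L (b 1)⟫_ℝ ^ 2) := by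
  unfold jac
  congr 1
  have hp (i : Fin 2) : P (b i) = b i := hP.apply_of_mem (b i).2
  have h1 : LinearMap.trace ℝ E3 ((P ∘L L.adjoint ∘L L ∘L P) ∘L
      (P ∘L L.adjoint ∘L L ∘L P)).toLinearMap =
      ∑ i, ∑ j, ⟪L (b j), L (b i)⟫_ℝ ^ 2 := by
    rw [ContinuousLinearMap.comp_assoc, trace_comp hb]
    refine Finset.sum_congr rfl fun i _ => ?_
    simp only [ContinuousLinearMap.comp_apply, hp, hP.idem,
      ContinuousLinearMap.adjoint_inner_right]
    rw [hb (L.adjoint (L (b i)))]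
    simp only [map_sum, map_smul, inner_sum, real_inner_smul_right,
      ContinuousLinearMap.adjoint_inner_right]
    refine Finset.sum_congr rfl fun j _ => ?_
    rw [real_inner_comm (L (b j)) (L (b i)), sq]
  rw [trace_gram hb hP, h1]
  simp only [Fin.sum_univ_two, real_inner_self_eq_norm_sq]
  rw [real_inner_comm (L (b 0)) (L (b 1))]
  ring

/-- The arithmetic-geometric mean inequality `√(det G) ≤ tr G / 2` for the Gram matrix of `L`. -/
theorem jac_le_half_trace (hP : IsPlaneProj P) (L : E3 →L[ℝ] E3) :
    jac L P ≤ LinearMap.trace ℝ E3 (P ∘L L.adjoint ∘L L ∘L P).toLinearMap / 2 := by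
  obtain ⟨b, hb⟩ := hP.exists_basis
  rw [jac_eq hb hP, trace_gram hb hP, Fin.sum_univ_two]
  refine Real.sqrt_le_iff.2 ⟨by positivity, ?_⟩
  nlinarith [sq_nonneg (‖L (b 0)‖ ^ 2 - ‖L (b 1)‖ ^ 2), sq_nonneg ⟪L (b 0), L (b 1)⟫_ℝ]

/-- The second order expansion of the Jacobian at the identity, as an upper bound. -/
theorem jac_id_add_le (hP : IsPlaneProj P) (E : E3 →L[ℝ] E3) :
    jac (ContinuousLinearMap.id ℝ E3 + E) P ≤
      1 + LinearMap.trace ℝ E3 (P ∘L E).toLinearMap + ‖E‖ ^ 2 := by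
  refine (hP.jac_le_half_trace _).trans ?_
  obtain ⟨b, hb⟩ := hP.exists_basis
  rw [trace_gram hb hP, trace_comp hb]
  have (i : Fin 2) : ‖(ContinuousLinearMap.id ℝ E3 + E) (b i)‖ ^ 2 ≤
      1 + 2 * ⟪(b i : E3), E (b i)⟫_ℝ + ‖E‖ ^ 2 := by
    have h1 := E.le_opNorm (b i : E3)
    rw [norm_basis, mul_one] at h1
    have : (ContinuousLinearMap.id ℝ E3 + E) (b i) = (b i : E3) + E (b i) := rfl
    rw [this, norm_add_sq_real, norm_basis]
    nlinarith [norm_nonneg (E (b i))]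
  simp only [Fin.sum_univ_two]
  linarith [this 0, this 1]

theorem jac_self (hP : IsPlaneProj P) : jac P P = 1 := by
  obtain ⟨b, hb⟩ := hP.exists_basis
  have h01 : ⟪(b 0 : E3), b 1⟫_ℝ = 0 := b.orthonormal.2 (by decide)
  rw [jac_eq hb hP, hP.apply_of_mem (b 0).2, hP.apply_of_mem (b 1).2, h01, norm_basis, norm_basis]
  norm_num

theorem normDet_domRestrict (hP : IsPlaneProj P) (L : E3 →L[ℝ] E3) :
    (L.toLinearMap.domRestrict P.range).normDet = jac L P := by
  obtain ⟨b, hb⟩ := hP.exists_basis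
  have h := (L.toLinearMap.domRestrict P.range).normDet_sq_eq_det_gram b
  rw [jac_eq hb hP, ← Real.sqrt_sq (LinearMap.normDet_nonneg _)]
  congr 1
  simp only [Matrix.det_fin_two, Matrix.gram_apply, LinearMap.domRestrict_apply,
    ContinuousLinearMap.coe_coe, real_inner_self_eq_norm_sq] at h
  rw [real_inner_comm (L (b 0)) (L (b 1))] at h
  simpa [sq] using h

/-- `jac L P` is the area scaling factor of `L` on the plane of `P`. -/
theorem area_image (hP : IsPlaneProj P) (L : E3 →L[ℝ] E3) {A : Set E3} (hA : A ⊆ P.range) :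
    μHE[2] (L '' A) = ENNReal.ofReal (jac L P) * μHE[2] A := by
  have h := (L.toLinearMap.domRestrict P.range).euclideanHausdorffMeasure_image
    (Subtype.val ⁻¹' A)
  rw [hP.2, hP.normDet_domRestrict] at h
  have e1 : L.toLinearMap.domRestrict P.range '' (Subtype.val ⁻¹' A) = L '' A := by
    ext y
    constructor
    · rintro ⟨x, hx, rfl⟩
      exact ⟨x, hx, rfl⟩
    · rintro ⟨x, hx, rfl⟩
      exact ⟨⟨x, hA hx⟩, hx, rfl⟩
  have e2 : Subtype.val '' (Subtype.val ⁻¹' A : Set P.range) = A :=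
    Subtype.image_preimage_val .. |>.trans (inter_eq_right.2 hA)
  rw [e1] at h
  rw [h]
  conv_rhs => rw [← e2]
  rw [isometry_subtype_coe.euclideanHausdorffMeasure_image]

theorem jac_pos (hP : IsPlaneProj P) (L : E3 →L[ℝ] E3) (hL : ∀ v, P v = v → L v = 0 → v = 0) :
    0 < jac L P := by
  refine lt_of_le_of_ne (jac_nonneg L P) fun h => ?_
  rw [← hP.normDet_domRestrict, eq_comm, LinearMap.normDet_eq_zero_iff_ker_ne_bot] at h
  refine h ((Submodule.eq_bot_iff _).2 fun v hv => Subtype.ext ?_)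
  exact hL v (hP.apply_of_mem v.2) hv

end IsPlaneProj

/-! ### The area formula on sets with tangent planes -/

/-- Comparing distances compares two-dimensional Hausdorff measures. -/
theorem area_image_le_of_dist_le {A : Set E3} {u v : E3 → E3} {K : ℝ} (hK : 0 ≤ K)
    (h : ∀ y ∈ A, ∀ z ∈ A, dist (u y) (u z) ≤ K * dist (v y) (v z)) :
    μHE[2] (u '' A) ≤ ENNReal.ofReal K ^ 2 * μHE[2] (v '' A) := by
  set γ : E3 → E3 := fun w => u (Function.invFunOn v A w)
  have hγ : ∀ y ∈ A, γ (v y) = u y := fun y hy => by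
    have h1 : ∃ a ∈ A, v a = v y := ⟨y, hy, rfl⟩
    have h2 := h _ (Function.invFunOn_mem h1) _ hy
    rw [Function.invFunOn_eq h1, dist_self, mul_zero] at h2
    exact dist_le_zero.1 h2
  have h1 : u '' A = γ '' (v '' A) := by
    rw [image_image]
    exact image_congr fun y hy => (hγ y hy).symm
  have h2 : LipschitzOnWith K.toNNReal γ (v '' A) := by
    refine LipschitzOnWith.of_dist_le_mul ?_
    rintro _ ⟨y, hy, rfl⟩ _ ⟨z, hz, rfl⟩
    rw [hγ y hy, hγ z hz, Real.coe_toNNReal _ hK]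
    exact h y hy z hz
  have h3 := h2.hausdorffMeasure_image_le (d := ((2 : ℕ) : ℝ)) (by positivity)
  rw [h1, Measure.euclideanHausdorffMeasure_def, Measure.smul_apply, Measure.smul_apply,
    ENNReal.smul_def, ENNReal.smul_def, smul_eq_mul, smul_eq_mul, mul_left_comm]
  gcongr
  simpa [ENNReal.ofReal] using h3

/-- `S` has the approximate tangent plane of `Q x` at each of its points `x`, in the strong sense
that secants of `S` near `x` are nearly parallel to that plane. -/
def HasTangentPlanes (S : Set E3) (Q : E3 → E3 →L[ℝ] E3) : Prop :=
  ∀ x ∈ S, IsPlaneProj (Q x) ∧ ∀ ε > 0, ∃ U ∈ 𝓝 x, ∀ y ∈ S ∩ U, ∀ z ∈ S ∩ U,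
    ‖(y - z) - Q x (y - z)‖ ≤ ε * ‖y - z‖

theorem HasTangentPlanes.mono {S T : Set E3} {Q : E3 → E3 →L[ℝ] E3} (h : HasTangentPlanes S Q)
    (hT : T ⊆ S) : HasTangentPlanes T Q := fun x hx =>
  ⟨(h x (hT hx)).1, fun ε hε => by
    obtain ⟨U, hU, h1⟩ := (h x (hT hx)).2 ε hε
    exact ⟨U, hU, fun y hy z hz => h1 y ⟨hT hy.1, hy.2⟩ z ⟨hT hz.1, hz.2⟩⟩⟩

/-- Near a point `x`, a map that is immersive along the tangent plane at `x` scales the areas of all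
subsets of `S` by the Jacobian at `x`, up to a factor `K` arbitrarily close to `1`. -/
theorem HasTangentPlanes.area_image_nearby {S : Set E3} {Q : E3 → E3 →L[ℝ] E3}
    (hS : HasTangentPlanes S Q) {φ : E3 → E3} {x : E3} (hx : x ∈ S) {L : E3 →L[ℝ] E3}
    (hφ : HasStrictFDerivAt φ L x) (hL : ∀ v, Q x v = v → L v = 0 → v = 0)
    {K : ℝ} (hK : 1 < K) :
    ∃ U ∈ 𝓝 x, ∀ A ⊆ S ∩ U,
      μHE[2] (φ '' A) ≤ ENNReal.ofReal K * (ENNReal.ofReal (jac L (Q x)) * μHE[2] A) ∧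
      ENNReal.ofReal (jac L (Q x)) * μHE[2] A ≤ ENNReal.ofReal K * μHE[2] (φ '' A) := by
  obtain ⟨hP, hflat⟩ := hS x hx
  set P := Q x
  obtain ⟨C, hC0, hC⟩ : ∃ C > 0, ∀ v, ‖P v‖ ≤ C * ‖L (P v)‖ := by
    obtain ⟨C, hC0, hC⟩ := (L.toLinearMap.domRestrict P.range).exists_antilipschitzWith
      ((Submodule.eq_bot_iff _).2 fun v hv => Subtype.ext (hL v (hP.apply_of_mem v.2) hv))
    refine ⟨C, hC0, fun v => ?_⟩
    simpa using hC.le_mul_dist ⟨P v, v, rfl⟩ 0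
  -- `κ` is a Lipschitz constant. It enters areas squared, and twice: once for the projection to the
  -- tangent plane and once for `φ`.
  obtain ⟨κ, hκ1, hκ4⟩ : ∃ κ : ℝ, 1 < κ ∧ κ ^ 4 = K := by
    refine ⟨√√K, ?_, ?_⟩
    · exact Real.lt_sqrt_of_sq_lt (by simpa using Real.lt_sqrt_of_sq_lt (by simpa using hK))
    · rw [show (4 : ℕ) = 2 * 2 by norm_num, pow_mul, Real.sq_sqrt (by positivity),
        Real.sq_sqrt (by linarith)]
  have hκ0 : 0 < κ := by linarith
  set η := 1 - κ⁻¹ with hη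
  have hη0 : 0 < η := by rw [hη, sub_pos]; exact inv_lt_one_of_one_lt₀ hκ1
  have hηκ : η * κ = κ - 1 := by rw [hη]; field_simp
  set ε := min η (η / ((1 + ‖L‖) * κ * C)) with hε
  have hε0 : 0 < ε := lt_min hη0 (by positivity)
  have hε1 : ε * ((1 + ‖L‖) * κ * C) ≤ η := by
    rw [← le_div_iff₀ (by positivity)]; exact min_le_right _ _
  obtain ⟨U, hU, hUf⟩ := hflat ε hε0
  have hd := hφ.isLittleO.def hε0
  rw [nhds_prod_eq] at hd
  obtain ⟨pV, hV, pV', hV', hVf⟩ := eventually_prod_iff.1 hd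
  -- Near `x`, the projection `P` to the tangent plane and the restriction of `φ` to `S` differ from
  -- an isometry and from `L ∘ P`, respectively, by a factor of at most `κ` in distances.
  have key : ∀ y ∈ S ∩ (U ∩ ({y | pV y} ∩ {y | pV' y})), ∀ z ∈ S ∩ (U ∩ ({y | pV y} ∩ {y | pV' y})),
      dist y z ≤ κ * dist (P y) (P z) ∧
      dist (φ y) (φ z) ≤ κ * dist (L (P y)) (L (P z)) ∧
      dist (L (P y)) (L (P z)) ≤ κ * dist (φ y) (φ z) := by
    intro y hy z hz
    have h1 := hUf y ⟨hy.1, hy.2.1⟩ z ⟨hz.1, hz.2.1⟩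
    have h2 : ‖φ y - φ z - L (y - z)‖ ≤ ε * ‖y - z‖ := hVf hy.2.2.1 hz.2.2.2
    simp only [dist_eq_norm, ← map_sub] at h2 ⊢
    set w := y - z
    have h3 : ‖w‖ ≤ κ * ‖P w‖ := by
      have h4 : ‖w‖ ≤ ‖w - P w‖ + ‖P w‖ := by simpa using norm_add_le (w - P w) (P w)
      have h5 : ε * ‖w‖ ≤ η * ‖w‖ := by gcongr; exact min_le_left _ _
      have h6 : κ⁻¹ * ‖w‖ ≤ ‖P w‖ := by
        have : κ⁻¹ = 1 - η := by rw [hη]; ring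
        rw [this]; linarith
      rwa [inv_mul_le_iff₀ hκ0] at h6
    have h7 : ‖φ y - φ z - L (P w)‖ ≤ η * ‖L (P w)‖ := by
      have e1 : φ y - φ z - L (P w) = (φ y - φ z - L w) + L (w - P w) := by
        rw [map_sub L w]; abel
      calc ‖φ y - φ z - L (P w)‖ ≤ ε * ‖w‖ + ‖L‖ * (ε * ‖w‖) := by
            rw [e1]
            refine (norm_add_le _ _).trans (add_le_add h2 ((L.le_opNorm _).trans ?_))
            gcongr
        _ = ε * (1 + ‖L‖) * ‖w‖ := by ring
        _ ≤ ε * (1 + ‖L‖) * (κ * (C * ‖L (P w)‖)) := by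
            gcongr
            exact h3.trans (by gcongr; exact hC w)
        _ = ε * ((1 + ‖L‖) * κ * C) * ‖L (P w)‖ := by ring
        _ ≤ η * ‖L (P w)‖ := by gcongr
    have h8 : ‖φ y - φ z‖ ≤ ‖φ y - φ z - L (P w)‖ + ‖L (P w)‖ := by
      simpa using norm_add_le (φ y - φ z - L (P w)) (L (P w))
    have h9 : ‖L (P w)‖ ≤ ‖φ y - φ z - L (P w)‖ + ‖φ y - φ z‖ := by
      have := norm_sub_le (φ y - φ z) (φ y - φ z - L (P w))
      rw [sub_sub_cancel] at this
      linarith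
    have hη1 : 1 + η ≤ κ := by nlinarith
    refine ⟨h3, ?_, ?_⟩
    · nlinarith [norm_nonneg (L (P w))]
    · have : κ⁻¹ * ‖L (P w)‖ ≤ ‖φ y - φ z‖ := by
        have : κ⁻¹ = 1 - η := by rw [hη]; ring
        rw [this]; linarith
      rwa [inv_mul_le_iff₀ hκ0] at this
  refine ⟨_, inter_mem hU (inter_mem hV hV'), fun A hA => ?_⟩
  have himg : μHE[2] ((fun y => L (P y)) '' A) = ENNReal.ofReal (jac L P) * μHE[2] (P '' A) := by
    rw [← hP.area_image L (by rintro _ ⟨v, -, rfl⟩; exact ⟨v, rfl⟩), image_image]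
  have hPA : μHE[2] (P '' A) ≤ μHE[2] A := by
    have := area_image_le_of_dist_le (A := A) (u := P) (v := id) (K := 1) zero_le_one
      fun y _ z _ => by
        rw [one_mul, dist_eq_norm, dist_eq_norm, ← map_sub]; exact hP.norm_apply_le _
    simpa using this
  have hAP := area_image_le_of_dist_le (A := A) (u := id) (v := P) hκ0.le
    fun y hy z hz => (key y (hA hy) z (hA hz)).1
  rw [image_id] at hAP
  have h1 := area_image_le_of_dist_le (A := A) (u := φ) (v := fun y => L (P y)) hκ0.le
    fun y hy z hz => (key y (hA hy) z (hA hz)).2.1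
  have h2 := area_image_le_of_dist_le (A := A) (u := fun y => L (P y)) (v := φ) hκ0.le
    fun y hy z hz => (key y (hA hy) z (hA hz)).2.2
  rw [himg] at h1 h2
  have hk : ENNReal.ofReal K = ENNReal.ofReal κ ^ 2 * ENNReal.ofReal κ ^ 2 := by
    rw [← hκ4, ← pow_add, ENNReal.ofReal_pow hκ0.le]
  have hk1 : 1 ≤ ENNReal.ofReal κ ^ 2 := one_le_pow₀ (by simpa using hκ1.le)
  constructor
  · refine h1.trans ?_
    rw [hk]
    gcongr
    exact le_mul_of_one_le_left' hk1
  · calc ENNReal.ofReal (jac L P) * μHE[2] A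
        ≤ ENNReal.ofReal (jac L P) * (ENNReal.ofReal κ ^ 2 * μHE[2] (P '' A)) := by gcongr
      _ = ENNReal.ofReal κ ^ 2 * (ENNReal.ofReal (jac L P) * μHE[2] (P '' A)) := by ring
      _ ≤ ENNReal.ofReal κ ^ 2 * (ENNReal.ofReal κ ^ 2 * μHE[2] (φ '' A)) := by gcongr
      _ = _ := by rw [hk, mul_assoc]

/-- A comparison of two measures that holds near each point of `S` holds on `S`. -/
theorem measure_le_mul_of_locally {S : Set E3} {m₁ m₂ : Measure E3} {c : ℝ≥0∞}
    (h : ∀ x ∈ S, ∃ U ∈ 𝓝 x, ∀ A ⊆ S ∩ U, MeasurableSet A → m₁ A ≤ c * m₂ A)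
    {A : Set E3} (hA : A ⊆ S) (hAm : MeasurableSet A) : m₁ A ≤ c * m₂ A := by
  have h' : ∀ x ∈ S, ∃ U, (IsOpen U ∧ x ∈ U) ∧
      ∀ A ⊆ S ∩ U, MeasurableSet A → m₁ A ≤ c * m₂ A := fun x hx => by
    obtain ⟨U, hU, h1⟩ := h x hx
    obtain ⟨V, hV, hVo, hxV⟩ := mem_nhds_iff.1 hU
    exact ⟨V, ⟨hVo, hxV⟩, fun A hA => h1 A (hA.trans (inter_subset_inter_right _ hV))⟩
  choose! U hU hU' using h'
  obtain ⟨t, htS, htc, hcov⟩ := TopologicalSpace.countable_cover_nhdsWithin (s := S) (f := U)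
    fun x hx => mem_nhdsWithin_of_mem_nhds ((hU x hx).1.mem_nhds (hU x hx).2)
  rcases t.eq_empty_or_nonempty with rfl | htn
  · have : A = ∅ := subset_empty_iff.1 (by simpa using hA.trans hcov)
    simp [this]
  obtain ⟨e, rfl⟩ := htc.exists_eq_range htn
  set B : ℕ → Set E3 := fun n => A ∩ disjointed (fun n => U (e n)) n
  have hBm (n) : MeasurableSet (B n) := hAm.inter
    (MeasurableSet.disjointed (fun n => (hU _ (htS ⟨n, rfl⟩)).1.measurableSet) n)
  have hBd : Pairwise (Function.onFun Disjoint B) := fun i j hij =>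
    ((disjoint_disjointed _ hij).mono inter_subset_right inter_subset_right)
  have hBU : A = ⋃ n, B n := by
    rw [← inter_iUnion, iUnion_disjointed, eq_comm, inter_eq_left]
    exact hA.trans (hcov.trans (by simp))
  rw [hBU, measure_iUnion hBd hBm, measure_iUnion hBd hBm, ← ENNReal.tsum_mul_left]
  refine ENNReal.tsum_le_tsum fun n => hU' _ (htS ⟨n, rfl⟩) _ ?_ (hBm n)
  exact fun y hy => ⟨hA hy.1, disjointed_subset (fun n => U (e n)) n hy.2⟩

/-- **Area formula.** If `φ` is injective and immersive on `S`, then the area of `φ(S)` is the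
integral over `S` of the Jacobian of `φ` along the tangent planes. -/
theorem HasTangentPlanes.area_formula {S : Set E3} {Q : E3 → E3 →L[ℝ] E3}
    (hS : HasTangentPlanes S Q) (hSm : MeasurableSet S) (hQ : ContinuousOn Q S)
    {φ : E3 → E3} (hφ : ContDiff ℝ 1 φ) (hinj : InjOn φ S)
    (himm : ∀ x ∈ S, ∀ v, Q x v = v → fderiv ℝ φ x v = 0 → v = 0) :
    ((μHE[2].restrict S).withDensity
      fun x => ENNReal.ofReal (jac (fderiv ℝ φ x) (Q x))).map φ = μHE[2].restrict (φ '' S) := by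
  set J : E3 → ℝ := fun x => jac (fderiv ℝ φ x) (Q x) with hJ
  have hJc : ContinuousOn J S := (hφ.continuous_fderiv one_ne_zero).continuousOn.jac hQ
  have hJpos : ∀ x ∈ S, 0 < J x := fun x hx => (hS x hx).1.jac_pos _ (himm x hx)
  -- The measures `m₁ A = ℋ²(φ(A))` and `m₂ A = ∫_A J` agree locally up to a factor `K²` for every
  -- `K > 1`, and hence agree.
  set m₂ := (μHE[2].restrict S).withDensity fun x => ENNReal.ofReal (J x) with hm₂
  have hemb : MeasurableEmbedding (S.domRestrict φ) :=
    hφ.continuous.continuousOn.measurableEmbedding hSm hinj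
  set m₁ : Measure E3 := (Measure.comap (S.domRestrict φ) μHE[2]).map Subtype.val with hm₁
  have hm₁a (A : Set E3) (hA : MeasurableSet A) (hAS : A ⊆ S) : m₁ A = μHE[2] (φ '' A) := by
    rw [hm₁, Measure.map_apply measurable_subtype_coe hA, hemb.comap_apply,
      image_domRestrict, inter_eq_left.2 hAS]
  have hm₂a (A : Set E3) (hA : MeasurableSet A) (hAS : A ⊆ S) :
      m₂ A = ∫⁻ x in A, ENNReal.ofReal (J x) ∂μHE[2] := by
    rw [hm₂, withDensity_apply _ hA, Measure.restrict_restrict hA, inter_eq_left.2 hAS]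
  have local_est : ∀ K : ℝ, 1 < K → ∀ x ∈ S, ∃ U ∈ 𝓝 x, ∀ A ⊆ S ∩ U, MeasurableSet A →
      m₁ A ≤ (ENNReal.ofReal K * ENNReal.ofReal K) * m₂ A ∧
      m₂ A ≤ (ENNReal.ofReal K * ENNReal.ofReal K) * m₁ A := by
    intro K hK x hx
    obtain ⟨U, hU, hUA⟩ := hS.area_image_nearby hx
      (hφ.contDiffAt.hasStrictFDerivAt one_ne_zero) (himm x hx) hK
    have hJx := hJpos x hx
    have hev : ∀ᶠ y in 𝓝[S] x, J x < K * J y ∧ J y < K * J x :=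
      ((continuousWithinAt_const (b := J x)).eventually_lt
        ((hJc x hx).const_mul K) (by show J x < K * J x; nlinarith)).and
        ((hJc x hx).eventually_lt (continuousWithinAt_const (b := K * J x)) (by nlinarith))
    obtain ⟨V, hV, hVJ⟩ := mem_nhdsWithin_iff_exists_mem_nhds_inter.1 hev
    refine ⟨U ∩ V, inter_mem hU hV, fun A hA hAm => ?_⟩
    obtain ⟨h1, h2⟩ := hUA A fun y hy => ⟨(hA hy).1, (hA hy).2.1⟩
    have hAS : A ⊆ S := fun y hy => (hA hy).1
    rw [hm₁a A hAm hAS, hm₂a A hAm hAS]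
    have hm : ENNReal.ofReal (J x) * μHE[2] A = ∫⁻ y in A, ENNReal.ofReal (J x) ∂μHE[2] := by
      rw [lintegral_const, Measure.restrict_apply_univ]
    have hKt : ENNReal.ofReal K ≠ ⊤ := ENNReal.ofReal_ne_top
    have hle1 : ENNReal.ofReal (J x) * μHE[2] A ≤
        ENNReal.ofReal K * ∫⁻ y in A, ENNReal.ofReal (J y) ∂μHE[2] := by
      rw [hm, ← lintegral_const_mul' _ _ hKt]
      refine setLIntegral_mono' hAm fun y hy => ?_
      rw [← ENNReal.ofReal_mul (by linarith)]
      exact ENNReal.ofReal_le_ofReal (hVJ ⟨(hA hy).2.2, hAS hy⟩).1.le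
    have hle2 : ∫⁻ y in A, ENNReal.ofReal (J y) ∂μHE[2] ≤
        ENNReal.ofReal K * (ENNReal.ofReal (J x) * μHE[2] A) := by
      rw [hm, ← lintegral_const_mul' _ _ hKt]
      refine setLIntegral_mono' hAm fun y hy => ?_
      rw [← ENNReal.ofReal_mul (by linarith)]
      exact ENNReal.ofReal_le_ofReal (hVJ ⟨(hA hy).2.2, hAS hy⟩).2.le
    constructor
    · rw [mul_assoc]
      exact h1.trans (by gcongr)
    · rw [mul_assoc]
      exact hle2.trans (by gcongr)
  have hlim : Tendsto (fun K : ℝ => ENNReal.ofReal K * ENNReal.ofReal K) (𝓝[>] 1) (𝓝 1) := by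
    have h1 : Tendsto ENNReal.ofReal (𝓝[>] 1) (𝓝 1) := by
      simpa using (ENNReal.continuous_ofReal.tendsto 1).mono_left nhdsWithin_le_nhds
    simpa using ENNReal.Tendsto.mul h1 (by simp) h1 (by simp)
  have hle : ∀ a b : ℝ≥0∞, (∀ K : ℝ, 1 < K → a ≤ (ENNReal.ofReal K * ENNReal.ofReal K) * b) →
      a ≤ b := fun a b hab => by
    have h1 : Tendsto (fun K : ℝ => (ENNReal.ofReal K * ENNReal.ofReal K) * b) (𝓝[>] 1)
        (𝓝 (1 * b)) := ENNReal.Tendsto.mul_const hlim (by simp)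
    rw [one_mul] at h1
    exact ge_of_tendsto h1 (eventually_nhdsWithin_of_forall fun K hK => hab K hK)
  have heq (A : Set E3) (hA : MeasurableSet A) (hAS : A ⊆ S) : m₂ A = m₁ A := by
    refine le_antisymm (hle _ _ fun K hK => ?_) (hle _ _ fun K hK => ?_)
    · refine measure_le_mul_of_locally (fun x hx => ?_) hAS hA
      obtain ⟨U, hU, h⟩ := local_est K hK x hx
      exact ⟨U, hU, fun A hA hAm => (h A hA hAm).2⟩
    · refine measure_le_mul_of_locally (fun x hx => ?_) hAS hA
      obtain ⟨U, hU, h⟩ := local_est K hK x hx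
      exact ⟨U, hU, fun A hA hAm => (h A hA hAm).1⟩
  ext A hA
  have hφm := hφ.continuous.measurable
  have h1 : m₂ (φ ⁻¹' A) = m₂ (φ ⁻¹' A ∩ S) := by
    rw [hm₂, withDensity_apply _ (hφm hA), withDensity_apply _ ((hφm hA).inter hSm),
      Measure.restrict_restrict (hφm hA), Measure.restrict_restrict ((hφm hA).inter hSm),
      inter_assoc, inter_self]
  rw [Measure.map_apply hφm hA, Measure.restrict_apply hA, h1,
    heq _ ((hφm hA).inter hSm) inter_subset_right, hm₁a _ ((hφm hA).inter hSm) inter_subset_right,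
    image_preimage_inter]

/-! ### Tangent planes of regular zero sets -/

/-- The orthogonal projection onto the kernel of a nonzero linear form `g`. -/
noncomputable def kerProj (g : E3 →L[ℝ] ℝ) : E3 →L[ℝ] E3 :=
  ContinuousLinearMap.id ℝ E3 -
    (‖g‖ ^ 2)⁻¹ • g.smulRight ((InnerProductSpace.toDual ℝ E3).symm g)

theorem kerProj_apply (g : E3 →L[ℝ] ℝ) (v : E3) :
    kerProj g v = v - (‖g‖ ^ 2)⁻¹ • g v • (InnerProductSpace.toDual ℝ E3).symm g := rfl

theorem norm_sub_kerProj (g : E3 →L[ℝ] ℝ) (v : E3) : ‖v - kerProj g v‖ = ‖g‖⁻¹ * |g v| := by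
  rw [kerProj_apply, sub_sub_cancel, norm_smul, norm_smul, LinearIsometryEquiv.norm_map, norm_inv,
    norm_pow, norm_norm, Real.norm_eq_abs]
  rcases eq_or_ne g 0 with rfl | hg
  · simp
  · have := norm_pos_iff.2 hg
    field_simp

theorem kerProj_eq (g : E3 →L[ℝ] ℝ) : kerProj g = g.ker.starProjection := by
  set n := (InnerProductSpace.toDual ℝ E3).symm g with hn
  have hgn (v : E3) : g v = ⟪n, v⟫_ℝ := by simp [hn]
  have hk : g.ker = (ℝ ∙ n)ᗮ := by
    ext v
    rw [Submodule.mem_orthogonal_singleton_iff_inner_right, ← hgn]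
    rfl
  have hnn : ‖g‖ = ‖n‖ := by simp [hn]
  ext1 v
  rw [kerProj_apply, ← hn]
  simp only [hk]
  rw [Submodule.starProjection_orthogonal', sub_apply,
    Submodule.starProjection_singleton, hgn, hnn, smul_smul, one_apply_eq_self,
    div_eq_inv_mul]
  simp

theorem isPlaneProj_kerProj {g : E3 →L[ℝ] ℝ} (hg : g ≠ 0) : IsPlaneProj (kerProj g) := by
  rw [kerProj_eq]
  refine ⟨isStarProjection_starProjection, ?_⟩
  rw [Submodule.range_starProjection]
  have h1 := g.toLinearMap.finrank_range_add_finrank_ker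
  have h2 : g.range = ⊤ := LinearMap.range_eq_top.2
    (LinearMap.surjective (fun h => hg (by ext1 v; exact congrArg (fun L : E3 →ₗ[ℝ] ℝ => L v) h)))
  rw [h2, finrank_top] at h1
  simp at h1
  change Module.finrank ℝ g.toLinearMap.ker = 2
  omega

theorem continuousAt_kerProj {g : E3 →L[ℝ] ℝ} (hg : g ≠ 0) : ContinuousAt kerProj g := by
  have h1 : Continuous fun g : E3 →L[ℝ] ℝ =>
      g.smulRight ((InnerProductSpace.toDual ℝ E3).symm g) := by
    have h2 : Continuous fun g : E3 →L[ℝ] ℝ => (InnerProductSpace.toDual ℝ E3).symm g :=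
      (InnerProductSpace.toDual ℝ E3).symm.continuous
    exact ((ContinuousLinearMap.smulRightL ℝ E3 E3).continuous.clm_apply h2)
  have h2 : ContinuousAt (fun g : E3 →L[ℝ] ℝ => (‖g‖ ^ 2)⁻¹) g :=
    (continuous_norm.pow 2).continuousAt.inv₀ (by simpa using hg)
  have h3 := h2.smul h1.continuousAt
  exact continuousAt_const.sub h3

/-- Near `x`, the set `S` is the regular zero set of the smooth function `f`. -/
def IsZeroSetNear (S : Set E3) (x : E3) (f : E3 → ℝ) : Prop :=
  ContDiff ℝ ∞ f ∧ ∀ᶠ y in 𝓝 x, (y ∈ S ↔ f y = 0) ∧ (f y = 0 → fderiv ℝ f y ≠ 0)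

/-- `S` is a smooth, properly embedded surface without boundary. -/
def IsSurface (S : Set E3) : Prop := ∀ x, ∃ f, IsZeroSetNear S x f

/-- The orthogonal projection onto the tangent plane `T_x S`. -/
noncomputable def tangentProj (S : Set E3) (x : E3) : E3 →L[ℝ] E3 :=
  (tangentPlane S x).starProjection

theorem IsLocallySmoothFamily.isSurface {n : ℕ} {S : Cube n → Set E3}
    (hS : IsLocallySmoothFamily S) (ν : Cube n) : IsSurface (S ν) := fun x => by
  obtain ⟨U, hU, B, hB, f, hf, -, h⟩ := hS ν x
  exact ⟨f ν, hf ν, eventually_of_mem hB (h ν (mem_of_mem_nhds hU))⟩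

namespace IsZeroSetNear

variable {S : Set E3} {x : E3} {f : E3 → ℝ}

theorem hasFDerivAt (h : IsZeroSetNear S x f) (y : E3) : HasFDerivAt f (fderiv ℝ f y) y :=
  (h.1.differentiable (by simp) y).hasFDerivAt

theorem zero (h : IsZeroSetNear S x f) (hx : x ∈ S) : f x = 0 := h.2.self_of_nhds.1.1 hx

theorem fderiv_ne (h : IsZeroSetNear S x f) (hx : x ∈ S) : fderiv ℝ f x ≠ 0 :=
  h.2.self_of_nhds.2 (h.zero hx)

theorem eventually (h : IsZeroSetNear S x f) : ∀ᶠ y in 𝓝 x, IsZeroSetNear S y f :=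
  h.2.eventually_nhds.mono fun _ hy => ⟨h.1, hy⟩

theorem mem_ker_of_mem_tangentConeAt (h : IsZeroSetNear S x f) (hx : x ∈ S) {v : E3}
    (hv : v ∈ tangentConeAt ℝ S x) : fderiv ℝ f x v = 0 := by
  obtain ⟨c, d, hd, hdS, hcd⟩ := mem_tangentConeAt_iff_exists_seq.1 hv
  have h1 := (h.hasFDerivAt x).hasFDerivWithinAt.lim (s := univ) hd (by simp) hcd
  refine tendsto_nhds_unique h1 (tendsto_const_nhds.congr' ?_)
  have h2 : Tendsto (fun n => x + d n) atTop (𝓝 x) := by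
    simpa using tendsto_const_nhds (x := x).add hd
  filter_upwards [h2.eventually h.2, hdS] with n h3 h4
  rw [h3.1.1 h4, h.zero hx, sub_zero, smul_zero]

/-- Along a direction in the kernel of the differential, the intermediate value theorem applied in
a transverse direction produces nearby points of the zero set. -/
theorem mem_tangentConeAt_of_mem_ker (h : IsZeroSetNear S x f) (hx : x ∈ S) {v : E3}
    (hv : fderiv ℝ f x v = 0) : v ∈ tangentConeAt ℝ S x := by
  obtain ⟨n, hn⟩ : ∃ n, 0 < fderiv ℝ f x n := by
    obtain ⟨n, hn⟩ := DFunLike.exists_ne (h.fderiv_ne hx)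
    rcases lt_or_gt_of_ne hn with h1 | h1
    · exact ⟨-n, by simpa using h1⟩
    · exact ⟨n, h1⟩
  have sgn (u : E3) (hu : 0 < fderiv ℝ f x u) : ∀ᶠ s in 𝓝[>] (0 : ℝ), 0 < f (x + s • u) := by
    have h1 : HasDerivAt (fun s : ℝ => f (x + s • u)) (fderiv ℝ f x u) 0 := by
      have h2 : HasDerivAt (fun s : ℝ => x + s • u) u 0 := by
        simpa using ((hasDerivAt_id (0 : ℝ)).smul_const u).const_add x
      have h3 : HasFDerivAt f (fderiv ℝ f x) (x + (0 : ℝ) • u) := by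
        simpa using h.hasFDerivAt x
      exact h3.comp_hasDerivAt (0 : ℝ) h2
    filter_upwards [h1.tendsto_slope_zero_right.eventually (lt_mem_nhds hu),
      self_mem_nhdsWithin] with s h2 h3
    have h4 : 0 < s⁻¹ * f (x + s • u) := by simpa [h.zero hx] using h2
    exact pos_of_mul_pos_right h4 (inv_pos.2 h3).le
  have sgn' (u : E3) (hu : fderiv ℝ f x u < 0) : ∀ᶠ s in 𝓝[>] (0 : ℝ), f (x + s • u) < 0 := by
    have h1 : HasDerivAt (fun s : ℝ => f (x + s • u)) (fderiv ℝ f x u) 0 := by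
      have h2 : HasDerivAt (fun s : ℝ => x + s • u) u 0 := by
        simpa using ((hasDerivAt_id (0 : ℝ)).smul_const u).const_add x
      have h3 : HasFDerivAt f (fderiv ℝ f x) (x + (0 : ℝ) • u) := by
        simpa using h.hasFDerivAt x
      exact h3.comp_hasDerivAt (0 : ℝ) h2
    filter_upwards [h1.tendsto_slope_zero_right.eventually (gt_mem_nhds hu),
      self_mem_nhdsWithin] with s h2 h3
    have h4 : s⁻¹ * f (x + s • u) < 0 := by simpa [h.zero hx] using h2
    exact neg_of_mul_neg_right h4 (inv_pos.2 h3).le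
  have step (k : ℕ) : ∃ s : ℝ, ∃ w : E3, 0 < s ∧ s ≤ 1 / (k + 1) ∧ ‖w‖ ≤ 1 / (k + 1) * ‖n‖ ∧
      x + s • (v + w) ∈ S := by
    set ε : ℝ := 1 / (k + 1) with hε
    have hε0 : 0 < ε := by positivity
    have hmem : ∀ᶠ s in 𝓝[>] (0 : ℝ), ∀ w ∈ Metric.closedBall (0 : E3) (ε * ‖n‖),
        (x + s • (v + w) ∈ S ↔ f (x + s • (v + w)) = 0) := by
      obtain ⟨r, hr, hr'⟩ := Metric.eventually_nhds_iff.1 h.2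
      have h1 : ∀ᶠ s in 𝓝[>] (0 : ℝ), s * (‖v‖ + ε * ‖n‖) < r := by
        have : Tendsto (fun s : ℝ => s * (‖v‖ + ε * ‖n‖)) (𝓝 0) (𝓝 0) := by
          simpa using (continuous_id.mul_const (‖v‖ + ε * ‖n‖)).tendsto (0 : ℝ)
        exact (this.mono_left nhdsWithin_le_nhds).eventually (gt_mem_nhds hr)
      filter_upwards [h1, self_mem_nhdsWithin] with s hs hs0 w hw
      refine (hr' ?_).1
      rw [dist_eq_norm, add_sub_cancel_left, norm_smul, Real.norm_of_nonneg (le_of_lt hs0)]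
      refine lt_of_le_of_lt ?_ hs
      rw [mem_closedBall_zero_iff] at hw
      have := norm_add_le v w
      exact mul_le_mul_of_nonneg_left (by linarith) (le_of_lt hs0)
    have h1 := sgn (v + ε • n) (by rw [map_add, hv, map_smul, smul_eq_mul]; positivity)
    have h2 := sgn' (v + (-ε) • n)
      (by rw [map_add, hv, map_smul, smul_eq_mul]; nlinarith)
    have h3 : ∀ᶠ s in 𝓝[>] (0 : ℝ), s ≤ ε :=
      nhdsWithin_le_nhds (Iic_mem_nhds hε0)
    obtain ⟨s, hs1, hs2, hs3, hs4, hs0⟩ :=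
      (h1.and (h2.and (h3.and (hmem.and self_mem_nhdsWithin)))).exists
    have hc : ContinuousOn (fun τ : ℝ => f (x + s • (v + τ • n))) (Icc (-ε) ε) := by
      have := h.1.continuous
      fun_prop
    obtain ⟨τ, hτ, hτ0⟩ := intermediate_value_Icc (by linarith) hc ⟨hs2.le, hs1.le⟩
    have hτn : ‖τ • n‖ ≤ ε * ‖n‖ := by
      rw [norm_smul]
      gcongr
      exact abs_le.2 hτ
    exact ⟨s, τ • n, hs0, hs3, hτn, (hs4 _ (by simpa using hτn)).2 hτ0⟩
  choose s w hs0 hs hw hS using step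
  have hlim : Tendsto (fun k : ℕ => 1 / ((k : ℝ) + 1)) atTop (𝓝 0) :=
    tendsto_one_div_add_atTop_nhds_zero_nat
  have hw0 : Tendsto w atTop (𝓝 0) :=
    squeeze_zero_norm hw (by simpa using hlim.mul_const ‖n‖)
  have hs0' : Tendsto s atTop (𝓝 0) :=
    squeeze_zero (fun k => (hs0 k).le) hs hlim
  refine mem_tangentConeAt_iff_exists_seq.2
    ⟨fun k => (s k)⁻¹, fun k => s k • (v + w k), ?_, Eventually.of_forall hS, ?_⟩
  · simpa using hs0'.smul (tendsto_const_nhds (x := v).add hw0)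
  · have : Tendsto (fun k => v + w k) atTop (𝓝 v) := by
      simpa using tendsto_const_nhds (x := v).add hw0
    refine this.congr fun k => ?_
    rw [smul_smul, inv_mul_cancel₀ (hs0 k).ne', one_smul]

theorem tangentPlane_eq (h : IsZeroSetNear S x f) (hx : x ∈ S) :
    tangentPlane S x = (fderiv ℝ f x).ker := by
  have : tangentConeAt ℝ S x = (fderiv ℝ f x).ker := by
    ext v
    exact ⟨h.mem_ker_of_mem_tangentConeAt hx, h.mem_tangentConeAt_of_mem_ker hx⟩
  rw [tangentPlane, this, Submodule.span_eq]

theorem tangentProj_eq (h : IsZeroSetNear S x f) (hx : x ∈ S) :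
    tangentProj S x = kerProj (fderiv ℝ f x) := by
  rw [kerProj_eq, tangentProj]
  simp only [h.tangentPlane_eq hx]

theorem isPlaneProj (h : IsZeroSetNear S x f) (hx : x ∈ S) : IsPlaneProj (tangentProj S x) := by
  rw [h.tangentProj_eq hx]
  exact isPlaneProj_kerProj (h.fderiv_ne hx)

end IsZeroSetNear

namespace IsSurface

variable {S : Set E3}

theorem isPlaneProj (hS : IsSurface S) {x : E3} (hx : x ∈ S) : IsPlaneProj (tangentProj S x) := by
  obtain ⟨f, hf⟩ := hS x
  exact hf.isPlaneProj hx

theorem isClosed (hS : IsSurface S) : IsClosed S := by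
  rw [← isOpen_compl_iff, isOpen_iff_mem_nhds]
  intro x hx
  obtain ⟨f, hf⟩ := hS x
  have h1 : f x ≠ 0 := fun h => hx (hf.2.self_of_nhds.1.2 h)
  filter_upwards [hf.2, hf.1.continuous.continuousAt.eventually_ne h1] with y h2 h3 h4
  exact h3 (h2.1.1 h4)

theorem continuousOn_tangentProj (hS : IsSurface S) : ContinuousOn (tangentProj S) S := by
  intro x hx
  obtain ⟨f, hf⟩ := hS x
  have h1 : ContinuousAt (fun y => kerProj (fderiv ℝ f y)) x :=
    (continuousAt_kerProj (hf.fderiv_ne hx)).comp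
      (hf.1.continuous_fderiv (by simp)).continuousAt
  refine h1.continuousWithinAt.congr_of_eventuallyEq ?_ (hf.tangentProj_eq hx)
  filter_upwards [nhdsWithin_le_nhds hf.eventually, self_mem_nhdsWithin] with y hy hyS
  exact hy.tangentProj_eq hyS

theorem hasTangentPlanes (hS : IsSurface S) : HasTangentPlanes S (tangentProj S) := by
  intro x hx
  refine ⟨hS.isPlaneProj hx, fun ε hε => ?_⟩
  obtain ⟨f, hf⟩ := hS x
  have hg := norm_pos_iff.2 (hf.fderiv_ne hx)
  have hd := (hf.1.contDiffAt.hasStrictFDerivAt (x := x) (by simp)).isLittleO.def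
    (mul_pos hε hg)
  rw [nhds_prod_eq] at hd
  obtain ⟨pV, hV, pV', hV', hVf⟩ := eventually_prod_iff.1 hd
  refine ⟨{y | (y ∈ S ↔ f y = 0) ∧ pV y ∧ pV' y}, ?_, fun y hy z hz => ?_⟩
  · filter_upwards [hf.2, hV, hV'] with y h1 h2 h3
    exact ⟨h1.1, h2, h3⟩
  · have h1 : ‖f y - f z - fderiv ℝ f x (y - z)‖ ≤ ε * ‖fderiv ℝ f x‖ * ‖y - z‖ :=
      hVf hy.2.2.1 hz.2.2.2
    rw [hy.2.1.1 hy.1, hz.2.1.1 hz.1, sub_zero, zero_sub, norm_neg, Real.norm_eq_abs] at h1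
    rw [hf.tangentProj_eq hx, norm_sub_kerProj, inv_mul_le_iff₀ hg]
    linarith

end IsSurface

/-! ### The Gaussian measure of a surface -/

/-- The Gaussian area measure `(4π)⁻¹ exp (-|x|²/4) ℋ²` of a surface, as a measure on `ℝ³`. -/
noncomputable def gaussMeasure (S : Set E3) : Measure E3 :=
  (μHE[2].restrict S).withDensity fun x => ENNReal.ofReal (gaussWeight x)

theorem continuous_gaussWeight : Continuous gaussWeight := by
  unfold gaussWeight
  fun_prop

theorem gaussWeight_pos (x : E3) : 0 < gaussWeight x := by
  unfold gaussWeight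
  positivity

theorem gaussMeasure_univ (S : Set E3) : gaussMeasure S univ = gaussArea S := by
  rw [gaussMeasure, withDensity_apply _ MeasurableSet.univ, Measure.restrict_univ, gaussArea]

theorem isFiniteMeasure_gaussMeasure {S : Set E3} (h : gaussArea S < ⊤) :
    IsFiniteMeasure (gaussMeasure S) := ⟨by rwa [gaussMeasure_univ]⟩

theorem gaussMeasure_real_univ (S : Set E3) : (gaussMeasure S).real univ = (gaussArea S).toReal := by
  rw [Measure.real, gaussMeasure_univ]

theorem gaussMeasure_ac (S : Set E3) : gaussMeasure S ≪ μHE[2].restrict S :=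
  withDensity_absolutelyContinuous _ _

theorem ae_gaussMeasure {S : Set E3} (hS : IsSurface S) : ∀ᵐ x ∂gaussMeasure S, x ∈ S :=
  (gaussMeasure_ac S).ae_le (ae_restrict_mem hS.isClosed.measurableSet)

theorem integral_gaussMeasure (S : Set E3) (k : E3 → ℝ) :
    ∫ x, k x ∂gaussMeasure S = ∫ x in S, gaussWeight x * k x ∂μHE[2] := by
  rw [gaussMeasure]
  have := integral_withDensity_eq_integral_smul (μ := μHE[2].restrict S)
    (f := fun x => (gaussWeight x).toNNReal)
    (continuous_gaussWeight.measurable.real_toNNReal) k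
  refine Eq.trans this ?_
  refine integral_congr_ae (Eventually.of_forall fun x => ?_)
  simp [NNReal.smul_def, (gaussWeight_pos x).le]

theorem ContinuousOn.aestronglyMeasurable_gaussMeasure {S : Set E3} (hS : IsSurface S) {k : E3 → ℝ}
    (hk : ContinuousOn k S) : AEStronglyMeasurable k (gaussMeasure S) :=
  (hk.aestronglyMeasurable hS.isClosed.measurableSet).mono_ac (gaussMeasure_ac S)

theorem IsSurface.integrable {S : Set E3} (hS : IsSurface S) (hF : gaussArea S < ⊤)
    {h : E3 → (E3 →L[ℝ] E3) → ℝ} (hc : Continuous fun q : E3 × (E3 →L[ℝ] E3) => h q.1 q.2) {C : ℝ}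
    (hC : ∀ x P, IsPlaneProj P → |h x P| ≤ C) :
    Integrable (fun x => h x (tangentProj S x)) (gaussMeasure S) := by
  have := isFiniteMeasure_gaussMeasure hF
  have hm : ContinuousOn (fun x => h x (tangentProj S x)) S :=
    hc.comp_continuousOn (f := fun x => (x, tangentProj S x))
      (continuousOn_id.prodMk hS.continuousOn_tangentProj)
  refine Integrable.of_bound (hm.aestronglyMeasurable_gaussMeasure hS) C ?_
  filter_upwards [ae_gaussMeasure hS] with x hx
  exact hC x _ (hS.isPlaneProj hx)

/-- The point `(x, T_x S)` of `G₂(ℝ³)` when `x` lies on the surface `S`. The value off `S` is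
immaterial. -/
noncomputable def tangentPoint (S : Set E3) (x : E3) : GrR3 :=
  haveI := Classical.propDecidable (IsPlaneProj (tangentProj S x))
  if h : IsPlaneProj (tangentProj S x) then ⟨(x, tangentProj S x), h⟩ else
    ⟨(0, kerProj (innerSL ℝ (EuclideanSpace.single 0 1))), isPlaneProj_kerProj fun h => by
      have := congrArg (fun L : E3 →L[ℝ] ℝ => L (EuclideanSpace.single 0 1)) h
      simp at this⟩

theorem IsSurface.tangentPoint_val {S : Set E3} (hS : IsSurface S) {x : E3} (hx : x ∈ S) :
    (tangentPoint S x).1 = (x, tangentProj S x) := by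
  rw [tangentPoint, dif_pos (hS.isPlaneProj hx)]

theorem IsSurface.continuousOn_tangentPoint {S : Set E3} (hS : IsSurface S) :
    ContinuousOn (tangentPoint S) S := by
  refine Topology.IsInducing.subtypeVal.continuousOn_iff.2 ?_
  refine ContinuousOn.congr (continuousOn_id.prodMk hS.continuousOn_tangentProj) fun x hx => ?_
  exact hS.tangentPoint_val hx

/-- The Gaussian varifold is the image of the Gaussian measure under `x ↦ (x, T_x S)`, lifted to the
sphere. -/
theorem IsSurface.gaussVarifold_eq {S : Set E3} (hS : IsSurface S) :
    gaussVarifold S = (gaussMeasure S).map fun x => grLift (tangentPoint S x) := by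
  have hSm := hS.isClosed.measurableSet
  have hq : AEMeasurable (tangentPoint S) (μHE[2].restrict S) :=
    hS.continuousOn_tangentPoint.aemeasurable hSm
  have hemb : MeasurableEmbedding (Subtype.val : GrR3 → E3 × (E3 →L[ℝ] E3)) :=
    MeasurableEmbedding.subtype_coe
      (isClosed_isPlaneProj.preimage continuous_snd).measurableSet
  have h1 : surfaceVarifold S = (μHE[2].restrict S).map (tangentPoint S) := by
    rw [surfaceVarifold, ← hemb.comap_map ((μHE[2].restrict S).map (tangentPoint S)),
      AEMeasurable.map_map_of_aemeasurable hemb.measurable.aemeasurable hq]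
    congr 1
    refine Measure.map_congr ?_
    filter_upwards [ae_restrict_mem hSm] with x hx
    exact (hS.tangentPoint_val hx).symm
  have hw : Measurable fun q : GrR3 => ENNReal.ofReal (gaussWeight q.1.1) :=
    (continuous_gaussWeight.comp (continuous_fst.comp continuous_subtype_val)).measurable.ennreal_ofReal
  have h2 : (surfaceVarifold S).withDensity (fun q => ENNReal.ofReal (gaussWeight q.1.1)) =
      (gaussMeasure S).map (tangentPoint S) := by
    have hq' := hq.mono_ac (gaussMeasure_ac S)
    ext A hA
    rw [withDensity_apply _ hA, h1, Measure.restrict_map_of_aemeasurable hq hA,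
      lintegral_map' hw.aemeasurable (hq.mono_measure Measure.restrict_le_self),
      Measure.map_apply_of_aemeasurable hq' hA, gaussMeasure]
    have hnull : NullMeasurableSet (tangentPoint S ⁻¹' A) (μHE[2].restrict S) :=
      hq.nullMeasurable hA
    rw [withDensity_apply₀ _ hnull]
    refine lintegral_congr_ae ?_
    filter_upwards [ae_restrict_of_ae (ae_restrict_mem hSm)] with x hx
    rw [hS.tangentPoint_val hx]
  rw [gaussVarifold, h2, AEMeasurable.map_map_of_aemeasurable
    continuous_grLift.measurable.aemeasurable (hq.mono_ac (gaussMeasure_ac S))]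
  rfl

theorem IsSurface.aemeasurable_grLift {S : Set E3} (hS : IsSurface S) :
    AEMeasurable (fun x => grLift (tangentPoint S x)) (gaussMeasure S) :=
  ((continuous_grLift.comp_continuousOn hS.continuousOn_tangentPoint).aemeasurable
    hS.isClosed.measurableSet).mono_ac (gaussMeasure_ac S)

theorem IsSurface.gaussVarifold_univ {S : Set E3} (hS : IsSurface S) :
    gaussVarifold S univ = gaussArea S := by
  rw [hS.gaussVarifold_eq, Measure.map_apply_of_aemeasurable hS.aemeasurable_grLift
    MeasurableSet.univ, preimage_univ, gaussMeasure_univ]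

theorem IsSurface.integral_gaussVarifold {S : Set E3} (hS : IsSurface S) {f : GrS3 → ℝ}
    (hf : Continuous f) :
    ∫ q, f q ∂gaussVarifold S = ∫ x, f (grLift (tangentPoint S x)) ∂gaussMeasure S := by
  rw [hS.gaussVarifold_eq, integral_map hS.aemeasurable_grLift]
  exact hf.measurable.aestronglyMeasurable

/-! ### Families of surfaces as families of graphs -/

/-- The gradient direction of a linear form, normalized so that the form takes the value `1`. -/
noncomputable def kerNormal (g : E3 →L[ℝ] ℝ) : E3 :=
  (‖g‖ ^ 2)⁻¹ • (InnerProductSpace.toDual ℝ E3).symm g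

theorem kerProj_add_kerNormal (g : E3 →L[ℝ] ℝ) (v : E3) : kerProj g v + g v • kerNormal g = v := by
  rw [kerProj_apply, kerNormal, smul_comm, sub_add_cancel]

theorem apply_kerNormal {g : E3 →L[ℝ] ℝ} (hg : g ≠ 0) : g (kerNormal g) = 1 := by
  have h1 : g ((InnerProductSpace.toDual ℝ E3).symm g) = ‖g‖ ^ 2 := by
    conv_lhs => rw [← (InnerProductSpace.toDual ℝ E3).apply_symm_apply g]
    rw [InnerProductSpace.toDual_apply_apply, LinearIsometryEquiv.apply_symm_apply,
      real_inner_self_eq_norm_sq, LinearIsometryEquiv.norm_map]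
  have := norm_pos_iff.2 hg
  rw [kerNormal, map_smul, h1, smul_eq_mul, inv_mul_cancel₀ (by positivity)]

theorem apply_kerProj {g : E3 →L[ℝ] ℝ} (v : E3) : g (kerProj g v) = 0 := by
  rcases eq_or_ne g 0 with rfl | hg
  · simp
  have h := congrArg g (kerProj_add_kerNormal g v)
  rw [map_add, map_smul, apply_kerNormal hg, smul_eq_mul, mul_one] at h
  linarith

theorem kerProj_kerNormal {g : E3 →L[ℝ] ℝ} (hg : g ≠ 0) : kerProj g (kerNormal g) = 0 := by
  have h := kerProj_add_kerNormal g (kerNormal g)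
  rw [apply_kerNormal hg, one_smul] at h
  simpa using h

/-- The points of `ℝ³` whose components tangential and normal to `ker g`, relative to `p`, are less
than `r` and `σ`. -/
def tangentCylinder (g : E3 →L[ℝ] ℝ) (p : E3) (r σ : ℝ) : Set E3 :=
  {x | ‖kerProj g (x - p)‖ < r ∧ |g (x - p)| < σ}

theorem isOpen_tangentCylinder (g : E3 →L[ℝ] ℝ) (p : E3) (r σ : ℝ) :
    IsOpen (tangentCylinder g p r σ) := by
  have h1 : Continuous fun x : E3 => ‖kerProj g (x - p)‖ := by fun_prop
  have h2 : Continuous fun x : E3 => |g (x - p)| := by fun_prop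
  exact (isOpen_lt h1 continuous_const).inter (isOpen_lt h2 continuous_const)

/-- **Implicit functions by monotonicity.** The zero sets of a continuous family of functions with
continuous differentials are, near a regular zero, graphs of a continuous family of functions over
the tangent plane; moreover the cylinder may be taken within a given neighbourhood. -/
theorem exists_graph {X : Type*} [TopologicalSpace X] {f : X → E3 → ℝ}
    (hf : Continuous fun q : X × E3 => f q.1 q.2) (hd : ∀ ν, Differentiable ℝ (f ν))
    (hf' : Continuous fun q : X × E3 => fderiv ℝ (f q.1) q.2) {ν₀ : X} {p : E3}
    (h0 : f ν₀ p = 0) {g : E3 →L[ℝ] ℝ} (hg : fderiv ℝ (f ν₀) p = g) (hg0 : g ≠ 0)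
    {O : Set (X × E3)} (hO : O ∈ 𝓝 (ν₀, p)) :
    ∃ U ∈ 𝓝 ν₀, ∃ r > 0, ∃ σ > 0, ∃ u : X → E3 → ℝ,
      (∀ ν ∈ U, ∀ x ∈ tangentCylinder g p r σ, (ν, x) ∈ O) ∧
      (∀ ν ∈ U, ∀ x ∈ tangentCylinder g p r σ, (f ν x = 0 ↔ g (x - p) = u ν (kerProj g (x - p)))) ∧
      (∀ ν ∈ U, ∀ y, ‖y‖ < r → |u ν y| < σ) ∧
      ContinuousOn (fun q : X × E3 => u q.1 q.2) (U ×ˢ Metric.ball 0 r) := by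
  set n := kerNormal g with hn
  have hgn : g n = 1 := apply_kerNormal hg0
  have hpos : ∀ᶠ q : X × E3 in 𝓝 (ν₀, p), 0 < fderiv ℝ (f q.1) q.2 n := by
    have h1 : Continuous fun q : X × E3 => fderiv ℝ (f q.1) q.2 n :=
      hf'.clm_apply continuous_const
    refine h1.continuousAt.eventually (lt_mem_nhds ?_)
    change 0 < fderiv ℝ (f ν₀) p n
    rw [hg, hgn]
    exact one_pos
  -- In a neighbourhood of `(ν₀, p)`, the functions increase in the direction `n`.
  obtain ⟨U₁, hU₁, B, hB, hUB⟩ := mem_nhds_prod_iff.1 (inter_mem hO hpos)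
  obtain ⟨ρ, hρ, hρB⟩ := Metric.mem_nhds_iff.1 hB
  set σ := ρ / (2 * (‖n‖ + 1)) with hσ
  have hσ0 : 0 < σ := by positivity
  have hσn : σ * ‖n‖ < ρ / 2 := by
    rw [hσ, div_mul_eq_mul_div, div_lt_div_iff₀ (by positivity) (by positivity)]
    nlinarith [norm_nonneg n]
  have hball : ∀ y s, ‖y‖ < ρ / 2 → |s| ≤ σ → p + y + s • n ∈ B := fun y s hy hs => by
    refine hρB ?_
    rw [Metric.mem_ball, dist_eq_norm, show p + y + s • n - p = y + s • n by abel]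
    refine (norm_add_le _ _).trans_lt ?_
    rw [norm_smul, Real.norm_eq_abs]
    have : |s| * ‖n‖ ≤ σ * ‖n‖ := by gcongr
    linarith
  have hmono : ∀ ν ∈ U₁, ∀ y, ‖y‖ < ρ / 2 →
      StrictMonoOn (fun s : ℝ => f ν (p + y + s • n)) (Icc (-σ) σ) := by
    intro ν hν y hy
    have hder (s : ℝ) : HasDerivAt (fun s : ℝ => f ν (p + y + s • n))
        (fderiv ℝ (f ν) (p + y + s • n) n) s := by
      have h2 : HasDerivAt (fun s : ℝ => p + y + s • n) n s := by
        simpa using ((hasDerivAt_id s).smul_const n).const_add (p + y)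
      exact (hd ν _).hasFDerivAt.comp_hasDerivAt s h2
    refine strictMonoOn_of_deriv_pos (convex_Icc _ _)
      (fun s _ => (hder s).continuousAt.continuousWithinAt) fun s hs => ?_
    rw [interior_Icc] at hs
    rw [(hder s).deriv]
    exact (hUB (mk_mem_prod hν (hball y s hy (abs_le.2 ⟨hs.1.le, hs.2.le⟩)))).2
  have hl : (-σ) ∈ Icc (-σ) σ := ⟨le_rfl, by linarith⟩
  have hr : σ ∈ Icc (-σ) σ := ⟨by linarith, le_rfl⟩
  have hm : (0 : ℝ) ∈ Icc (-σ) σ := ⟨by linarith, hσ0.le⟩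
  have hm0 := hmono ν₀ (mem_of_mem_nhds hU₁) 0 (by simpa using half_pos hρ)
  have hev : ∀ᶠ q : X × E3 in 𝓝 (ν₀, 0),
      f q.1 (p + q.2 + (-σ) • n) < 0 ∧ 0 < f q.1 (p + q.2 + σ • n) := by
    have hc (s : ℝ) : Continuous fun q : X × E3 => f q.1 (p + q.2 + s • n) := by
      have : Continuous fun q : X × E3 => p + q.2 + s • n := by fun_prop
      exact hf.comp (continuous_fst.prodMk this)
    refine ((hc (-σ)).continuousAt.eventually (gt_mem_nhds ?_)).and
      ((hc σ).continuousAt.eventually (lt_mem_nhds ?_))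
    · have := hm0 hl hm (by linarith)
      simpa [h0] using this
    · have := hm0 hm hr hσ0
      simpa [h0] using this
  obtain ⟨U₂, hU₂, B₂, hB₂, hUB₂⟩ := mem_nhds_prod_iff.1 hev
  obtain ⟨ρ₂, hρ₂, hρB₂⟩ := Metric.mem_nhds_iff.1 hB₂
  set r := min (ρ / 2) ρ₂ with hrdef
  have hr0 : 0 < r := lt_min (half_pos hρ) hρ₂
  set U := U₁ ∩ U₂
  -- The sign changes between heights `-σ` and `σ` over each point of the tangent plane, which gives
  -- the graph, and monotonicity makes it unique.
  have hex : ∀ ν ∈ U, ∀ y, ‖y‖ < r → ∃ s, |s| < σ ∧ f ν (p + y + s • n) = 0 := by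
    intro ν hν y hy
    have h1 : (ν, y) ∈ U₂ ×ˢ B₂ := mk_mem_prod hν.2
      (hρB₂ (by simpa using hy.trans_le (min_le_right _ _)))
    obtain ⟨h2, h3⟩ := hUB₂ h1
    have hc : ContinuousOn (fun s : ℝ => f ν (p + y + s • n)) (Icc (-σ) σ) := by
      have := (hd ν).continuous
      fun_prop
    obtain ⟨s, hs, hs0⟩ := intermediate_value_Ioo (by linarith) hc ⟨h2, h3⟩
    exact ⟨s, abs_lt.2 hs, hs0⟩
  choose! u hu hu0 using hex
  have huniq : ∀ ν ∈ U, ∀ y, ‖y‖ < r → ∀ s, |s| ≤ σ → f ν (p + y + s • n) = 0 → s = u ν y := by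
    intro ν hν y hy s hs hs0
    exact (hmono ν hν.1 y (hy.trans_le (min_le_left _ _))).injOn (abs_le.1 hs)
      (abs_le.1 (hu ν hν y hy).le) (hs0.trans (hu0 ν hν y hy).symm)
  have hx (x : E3) : p + kerProj g (x - p) + g (x - p) • n = x := by
    rw [add_assoc, kerProj_add_kerNormal, add_sub_cancel]
  refine ⟨U, inter_mem hU₁ hU₂, r, hr0, σ, hσ0, u, fun ν hν x hxc => ?_, fun ν hν x hxc => ?_,
    hu, ?_⟩
  · have := hball _ _ (hxc.1.trans_le (min_le_left _ _)) hxc.2.le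
    rw [hx] at this
    exact (hUB (mk_mem_prod hν.1 this)).1
  · constructor
    · intro h
      exact huniq ν hν _ hxc.1 _ hxc.2.le (by rw [hx, h])
    · intro h
      have := hu0 ν hν _ hxc.1
      rwa [← h, hx] at this
  · rintro ⟨ν₁, y₁⟩ ⟨hν₁, hy₁⟩
    rw [mem_ball_zero_iff] at hy₁
    have hy₁ : ‖y₁‖ < r := hy₁
    rw [ContinuousWithinAt, Metric.tendsto_nhds]
    intro ε hε
    have hu₁ := abs_lt.1 (hu ν₁ hν₁ y₁ hy₁)
    set δ := min (ε / 2) (min (σ - u ν₁ y₁) (σ + u ν₁ y₁)) with hδ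
    have hδ0 : 0 < δ := lt_min (half_pos hε) (lt_min (by linarith) (by linarith))
    have hδε : δ < ε := (min_le_left _ _).trans_lt (half_lt_self hε)
    have hδ1 : δ ≤ σ - u ν₁ y₁ := (min_le_right _ _).trans (min_le_left _ _)
    have hδ2 : δ ≤ σ + u ν₁ y₁ := (min_le_right _ _).trans (min_le_right _ _)
    have hI0 : u ν₁ y₁ ∈ Icc (-σ) σ := ⟨by linarith, by linarith⟩
    have hI1 : u ν₁ y₁ + δ ∈ Icc (-σ) σ := ⟨by linarith, by linarith⟩
    have hI2 : u ν₁ y₁ - δ ∈ Icc (-σ) σ := ⟨by linarith, by linarith⟩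
    have hmono₁ := hmono ν₁ hν₁.1 y₁ (hy₁.trans_le (min_le_left _ _))
    have hc (s : ℝ) : Continuous fun q : X × E3 => f q.1 (p + q.2 + s • n) := by
      have : Continuous fun q : X × E3 => p + q.2 + s • n := by fun_prop
      exact hf.comp (continuous_fst.prodMk this)
    -- Continuity of `u`: the strict signs at the heights `u ν₁ y₁ ± δ` persist nearby and trap `u`.
    have e1 : ∀ᶠ q : X × E3 in 𝓝 (ν₁, y₁), 0 < f q.1 (p + q.2 + (u ν₁ y₁ + δ) • n) := by
      refine (hc _).continuousAt.eventually (lt_mem_nhds ?_)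
      have := hmono₁ hI0 hI1 (by linarith)
      simpa only [hu0 ν₁ hν₁ y₁ hy₁] using this
    have e2 : ∀ᶠ q : X × E3 in 𝓝 (ν₁, y₁), f q.1 (p + q.2 + (u ν₁ y₁ - δ) • n) < 0 := by
      refine (hc _).continuousAt.eventually (gt_mem_nhds ?_)
      have := hmono₁ hI2 hI0 (by linarith)
      simpa only [hu0 ν₁ hν₁ y₁ hy₁] using this
    filter_upwards [nhdsWithin_le_nhds e1, nhdsWithin_le_nhds e2, self_mem_nhdsWithin]
      with q h1 h2 hq
    have hq2 : ‖q.2‖ < r := by simpa using hq.2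
    have hm₂ := hmono q.1 hq.1.1 q.2 (hq2.trans_le (min_le_left _ _))
    have hIq := abs_le.1 (hu q.1 hq.1 q.2 hq2).le
    have hz := hu0 q.1 hq.1 q.2 hq2
    rw [Real.dist_eq]
    refine lt_of_lt_of_le (abs_lt.2 ⟨?_, ?_⟩) hδε.le
    · by_contra hcon
      have := hm₂.monotoneOn hIq hI2 (by linarith)
      simp only [hz] at this
      linarith
    · by_contra hcon
      have := hm₂.monotoneOn hI1 hIq (by linarith)
      simp only [hz] at this
      linarith

/-! ### Continuity of integrals over a family of surfaces -/

theorem IsPlaneProj.area_ball_lt_top {P : E3 →L[ℝ] E3} (hP : IsPlaneProj P) (r : ℝ) :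
    μHE[2] {y : E3 | P y = y ∧ ‖y‖ < r} < ⊤ := by
  have h := InnerProductSpace.euclideanHausdorffMeasure_eq_volume (V := P.range)
  rw [hP.2] at h
  have h1 : {y : E3 | P y = y ∧ ‖y‖ < r} ⊆ Subtype.val '' (Metric.ball (0 : P.range) r) := by
    rintro y ⟨h1, h2⟩
    exact ⟨⟨y, y, h1⟩, by simpa using h2, rfl⟩
  refine (measure_mono h1).trans_lt ?_
  rw [isometry_subtype_coe.euclideanHausdorffMeasure_image, h]
  exact measure_ball_lt_top

/-- Change of variables from a surface to its image under an immersion, for real integrands. -/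
theorem HasTangentPlanes.setIntegral_image {T : Set E3} {Q : E3 → E3 →L[ℝ] E3}
    (hT : HasTangentPlanes T Q) (hTm : MeasurableSet T) (hQ : ContinuousOn Q T)
    {φ : E3 → E3} (hφ : ContDiff ℝ 1 φ) (hinj : InjOn φ T)
    (himm : ∀ x ∈ T, ∀ v, Q x v = v → fderiv ℝ φ x v = 0 → v = 0) {k : E3 → ℝ}
    (hk : AEStronglyMeasurable k (μHE[2].restrict (φ '' T))) :
    ∫ y in φ '' T, k y ∂μHE[2] = ∫ x in T, jac (fderiv ℝ φ x) (Q x) * k (φ x) ∂μHE[2] := by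
  have h := hT.area_formula hTm hQ hφ hinj himm
  have hJ : ContinuousOn (fun x => jac (fderiv ℝ φ x) (Q x)) T :=
    (hφ.continuous_fderiv one_ne_zero).continuousOn.jac hQ
  rw [← h] at hk ⊢
  rw [integral_map hφ.continuous.measurable.aemeasurable hk,
    integral_withDensity_eq_integral_toReal_smul₀ (hJ.aemeasurable hTm).ennreal_ofReal
    (Eventually.of_forall fun x => ENNReal.ofReal_lt_top)]
  simp [ENNReal.toReal_ofReal (jac_nonneg _ _)]

/-- Every point has a neighbourhood `W` such that the integrals over the surfaces of functions
supported in `W` are continuous at `ν₀`. The surfaces are graphs there, and projecting them to the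
tangent plane at the point turns the integrals into integrals over a fixed disc. -/
theorem IsLocallySmoothFamily.continuousAt_setIntegral {n : ℕ} {S : Cube n → Set E3}
    (hS : IsLocallySmoothFamily S) (ν₀ : Cube n) (p : E3) :
    ∃ W, IsOpen W ∧ p ∈ W ∧ ∀ h : Cube n → E3 → (E3 →L[ℝ] E3) → ℝ,
      (Continuous fun q : Cube n × E3 × (E3 →L[ℝ] E3) => h q.1 q.2.1 q.2.2) →
      (∀ ν P, ∀ x ∉ W, h ν x P = 0) → ∀ C, (∀ ν x P, IsPlaneProj P → |h ν x P| ≤ C) →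
      ContinuousAt (fun ν => ∫ x in S ν, h ν x (tangentProj (S ν) x) ∂μHE[2]) ν₀ := by
  obtain ⟨U₀, hU₀, B, hB, f, hf, hfm, hfB⟩ := hS ν₀ p
  have hSm (ν) : MeasurableSet (S ν) := (hS.isSurface ν).isClosed.measurableSet
  have hf0 : Continuous fun q : Cube n × E3 => f q.1 q.2 := by
    have h1 := (hfm 0)
    have h2 : (fun q : Cube n × E3 => f q.1 q.2) = fun q : Cube n × E3 =>
      (continuousMultilinearCurryFin0 ℝ E3 ℝ) (iteratedFDeriv ℝ 0 (f q.1) q.2) := by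
      ext q
      simp
    rw [h2]
    exact (continuousMultilinearCurryFin0 ℝ E3 ℝ).continuous.comp h1
  have hf1 : Continuous fun q : Cube n × E3 => fderiv ℝ (f q.1) q.2 := by
    have h2 : (fun q : Cube n × E3 => fderiv ℝ (f q.1) q.2) = fun q : Cube n × E3 =>
      (continuousMultilinearCurryFin1 ℝ E3 ℝ) (iteratedFDeriv ℝ 1 (f q.1) q.2) := by
      ext q v
      simp
    rw [h2]
    exact (continuousMultilinearCurryFin1 ℝ E3 ℝ).continuous.comp (hfm 1)
  have hUB : U₀ ×ˢ interior B ∈ 𝓝 (ν₀, p) := prod_mem_nhds hU₀ (interior_mem_nhds.2 hB)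
  have hzero : ∀ ν ∈ U₀, ∀ x ∈ interior B, IsZeroSetNear (S ν) x (f ν) := fun ν hν x hx =>
    ⟨hf ν, eventually_of_mem (mem_interior_iff_mem_nhds.1 hx) (hfB ν hν)⟩
  by_cases hp : f ν₀ p = 0
  swap
  · -- away from the surface, the integrals vanish for nearby parameters
    obtain ⟨U, hU, W, hW, hUW⟩ := mem_nhds_prod_iff.1
      (inter_mem hUB (hf0.continuousAt.eventually_ne (x := (ν₀, p)) hp))
    refine ⟨interior W, isOpen_interior, mem_interior_iff_mem_nhds.2 hW, fun h hc hW0 C hC => ?_⟩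
    have : ∀ ν ∈ U, ∫ x in S ν, h ν x (tangentProj (S ν) x) ∂μHE[2] = 0 := by
      intro ν hν
      refine setIntegral_eq_zero_of_forall_eq_zero fun x hx => ?_
      by_cases hxW : x ∈ interior W
      · have h1 := hUW (mk_mem_prod hν (interior_subset hxW))
        exact absurd ((hzero ν h1.1.1 x h1.1.2).zero hx) h1.2
      · exact hW0 _ _ _ hxW
    exact continuousAt_const.congr (f := fun _ => (0 : ℝ))
      (eventually_of_mem hU fun ν hν => (this ν hν).symm)
  have hpS : p ∈ S ν₀ := (hfB ν₀ (mem_of_mem_nhds hU₀) p (mem_of_mem_nhds hB)).1.2 hp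
  obtain ⟨g, hg⟩ : ∃ g, fderiv ℝ (f ν₀) p = g := ⟨_, rfl⟩
  have hg0 : g ≠ 0 := by
    rw [← hg]
    exact (hzero ν₀ (mem_of_mem_nhds hU₀) p (mem_interior_iff_mem_nhds.2 hB)).fderiv_ne hpS
  have hP := isPlaneProj_kerProj hg0
  set P := kerProj g with hPdef
  set e := kerNormal g with he
  have hge : g e = 1 := apply_kerNormal hg0
  -- The Jacobian of the projection to the tangent plane at `p` is bounded below near `(ν₀, p)`.
  have hjac : ∀ᶠ q : Cube n × E3 in 𝓝 (ν₀, p), 1 / 2 < jac P (kerProj (fderiv ℝ (f q.1) q.2)) := by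
    have h1 : ContinuousAt (fun q : Cube n × E3 => kerProj (fderiv ℝ (f q.1) q.2)) (ν₀, p) :=
      (continuousAt_kerProj (by rwa [hg])).comp hf1.continuousAt
    have h2 : ContinuousAt (fun q : Cube n × E3 => jac P (kerProj (fderiv ℝ (f q.1) q.2)))
        (ν₀, p) :=
      (continuous_const.jac continuous_id).continuousAt.comp h1
    refine h2.eventually (lt_mem_nhds ?_)
    change 1 / 2 < jac P (kerProj (fderiv ℝ (f ν₀) p))
    rw [hg, hP.jac_self]
    norm_num
  have hpos : ∀ᶠ q : Cube n × E3 in 𝓝 (ν₀, p), fderiv ℝ (f q.1) q.2 e ≠ 0 := by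
    have h1 : Continuous fun q : Cube n × E3 => fderiv ℝ (f q.1) q.2 e :=
      hf1.clm_apply continuous_const
    refine h1.continuousAt.eventually_ne ?_
    change fderiv ℝ (f ν₀) p e ≠ 0
    rw [hg, hge]
    exact one_ne_zero
  obtain ⟨U, hU, r, hr, σ, hσ, u, hO, hgraph, hu, huc⟩ := exists_graph hf0
    (fun ν => (hf ν).differentiable (by simp)) hf1 hp hg hg0 (inter_mem hUB (hjac.and hpos))
  set Z := tangentCylinder g p r σ with hZ
  set D : Set E3 := {y | P y = y ∧ ‖y‖ < r} with hD
  have hDm : MeasurableSet D := (isClosed_eq P.continuous continuous_id).measurableSet.inter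
    (isOpen_lt continuous_norm continuous_const).measurableSet
  -- `G ν` parametrizes the surface `S ν` in the cylinder `Z` by the disc `D`; its inverse is the
  -- projection `x ↦ P (x - p)`.
  set G : Cube n → E3 → E3 := fun ν y => p + y + u ν y • e with hGdef
  have hPG : ∀ ν, ∀ y ∈ D, P (G ν y - p) = y := fun ν y hy => by
    rw [hGdef, show p + y + u ν y • e - p = y + u ν y • e by abel, map_add, map_smul,
      kerProj_kerNormal hg0, smul_zero, add_zero, hy.1]
  have hgG : ∀ ν, ∀ y ∈ D, g (G ν y - p) = u ν y := fun ν y hy => by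
    rw [hGdef, show p + y + u ν y • e - p = y + u ν y • e by abel, map_add, map_smul, hge,
      ← hy.1, apply_kerProj, hy.1, zero_add, smul_eq_mul, mul_one]
  have hGZ : ∀ ν ∈ U, ∀ y ∈ D, G ν y ∈ Z := fun ν hν y hy =>
    ⟨by rw [hPG ν y hy]; exact hy.2, by rw [hgG ν y hy]; exact hu ν hν y hy.2⟩
  have hGS : ∀ ν ∈ U, ∀ y ∈ D, G ν y ∈ S ν := fun ν hν y hy => by
    have h1 := hO ν hν _ (hGZ ν hν y hy)
    rw [(hfB ν h1.1.1 _ (interior_subset h1.1.2)).1, hgraph ν hν _ (hGZ ν hν y hy),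
      hPG ν y hy, hgG ν y hy]
  have hGP : ∀ ν ∈ U, ∀ x ∈ S ν ∩ Z, P (x - p) ∈ D ∧ G ν (P (x - p)) = x := fun ν hν x hx => by
    have h1 := hO ν hν _ hx.2
    have h2 := (hzero ν h1.1.1 x h1.1.2).zero hx.1
    rw [hgraph ν hν x hx.2] at h2
    refine ⟨⟨hP.idem _, hx.2.1⟩, ?_⟩
    rw [hGdef]
    simp only
    rw [← h2, add_assoc, kerProj_add_kerNormal, add_sub_cancel]
  have htp : ∀ ν ∈ U, ∀ x ∈ S ν ∩ Z,
      tangentProj (S ν) x = kerProj (fderiv ℝ (f ν) x) := fun ν hν x hx => by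
    have h1 := hO ν hν _ hx.2
    exact (hzero ν h1.1.1 x h1.1.2).tangentProj_eq hx.1
  refine ⟨Z, isOpen_tangentCylinder _ _ _ _, ⟨by simpa using hr, by simpa using hσ⟩,
    fun h hc hW0 C hC => ?_⟩
  have hC0 : 0 ≤ C := (abs_nonneg _).trans (hC ν₀ p P hP)
  -- The integrand of the integral over `D`. The Jacobian of the projection is divided out.
  set k : Cube n → E3 → ℝ := fun ν y => h ν (G ν y) (kerProj (fderiv ℝ (f ν) (G ν y))) /
    jac P (kerProj (fderiv ℝ (f ν) (G ν y))) with hk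
  have hkc : ContinuousOn (fun q : Cube n × E3 => k q.1 q.2) (U ×ˢ D) := by
    have hGc : ContinuousOn (fun q : Cube n × E3 => G q.1 q.2) (U ×ˢ D) := by
      have h1 : ContinuousOn (fun q : Cube n × E3 => u q.1 q.2) (U ×ˢ D) :=
        huc.mono (prod_mono_right fun y hy => by simpa using hy.2)
      exact (continuousOn_const.add continuousOn_snd).add (h1.smul continuousOn_const)
    have hQc : ContinuousOn (fun q : Cube n × E3 =>
        kerProj (fderiv ℝ (f q.1) (G q.1 q.2))) (U ×ˢ D) := by
      intro q hq
      have h1 := hO q.1 hq.1 _ (hGZ q.1 hq.1 q.2 hq.2)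
      have h2 : fderiv ℝ (f q.1) (G q.1 q.2) ≠ 0 := fun h0 => h1.2.2 (by simp [h0])
      have h3 : ContinuousWithinAt (fun q : Cube n × E3 => fderiv ℝ (f q.1) (G q.1 q.2))
          (U ×ˢ D) q :=
        (hf1.comp_continuousOn (f := fun q : Cube n × E3 => (q.1, G q.1 q.2))
          (continuousOn_fst.prodMk hGc)) q hq
      exact ContinuousAt.comp_continuousWithinAt (x := q)
        (f := fun q : Cube n × E3 => fderiv ℝ (f q.1) (G q.1 q.2)) (continuousAt_kerProj h2) h3
    refine ContinuousOn.div ?_ (continuousOn_const.jac hQc) fun q hq => ?_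
    · exact hc.comp_continuousOn (f := fun q : Cube n × E3 =>
        (q.1, G q.1 q.2, kerProj (fderiv ℝ (f q.1) (G q.1 q.2))))
        (continuousOn_fst.prodMk (hGc.prodMk hQc))
    · have h1 := hO q.1 hq.1 _ (hGZ q.1 hq.1 q.2 hq.2)
      have h2 := h1.2.1
      simp only at h2
      linarith
  have hkm : ∀ ν ∈ U, AEStronglyMeasurable (k ν) (μHE[2].restrict D) := fun ν hν =>
    (hkc.comp (f := fun y => (ν, y)) (by fun_prop) fun y hy => mk_mem_prod hν hy).aestronglyMeasurable
      hDm
  have key : ∀ ν ∈ U, ∫ x in S ν, h ν x (tangentProj (S ν) x) ∂μHE[2] =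
      ∫ y in D, k ν y ∂μHE[2] := by
    intro ν hν
    set φ : E3 → E3 := fun x => P (x - p) with hφdef
    have hφ : ContDiff ℝ 1 φ := by fun_prop
    have hφ' (x) : fderiv ℝ φ x = P := by
      have := (P.hasFDerivAt (x := x - p)).comp x ((hasFDerivAt_id x).sub_const p)
      rw [ContinuousLinearMap.comp_id] at this
      exact this.fderiv
    have himg : φ '' (S ν ∩ Z) = D := by
      ext y
      constructor
      · rintro ⟨x, hx, rfl⟩
        exact (hGP ν hν x hx).1
      · intro hy
        exact ⟨G ν y, ⟨hGS ν hν y hy, hGZ ν hν y hy⟩, hPG ν y hy⟩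
    have hZm : MeasurableSet (S ν ∩ Z) :=
      (hSm ν).inter (isOpen_tangentCylinder _ _ _ _).measurableSet
    have hinj : InjOn φ (S ν ∩ Z) := fun x hx y hy hxy => by
      rw [← (hGP ν hν x hx).2, ← (hGP ν hν y hy).2]
      exact congrArg (G ν) hxy
    have himm : ∀ x ∈ S ν ∩ Z, ∀ v, tangentProj (S ν) x v = v → fderiv ℝ φ x v = 0 → v = 0 := by
      intro x hx v hv hv0
      rw [htp ν hν x hx] at hv
      rw [hφ'] at hv0
      have h1 := kerProj_add_kerNormal g v
      rw [← hPdef, hv0, zero_add] at h1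
      have h2 := apply_kerProj (g := fderiv ℝ (f ν) x) v
      rw [hv, ← h1, map_smul, smul_eq_mul] at h2
      have h3 := (hO ν hν _ hx.2).2.2
      rw [← h1, (mul_eq_zero.1 h2).resolve_right h3, zero_smul]
    have h1 := ((hS.isSurface ν).hasTangentPlanes.mono inter_subset_left).setIntegral_image hZm
      ((hS.isSurface ν).continuousOn_tangentProj.mono inter_subset_left) hφ hinj himm
      (k := k ν) (by rw [himg]; exact hkm ν hν)
    rw [himg] at h1
    rw [h1, setIntegral_eq_of_subset_of_forall_sdiff_eq_zero (hSm ν) inter_subset_left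
      (s := S ν ∩ Z) fun x hx => hW0 _ _ _ fun hxZ => hx.2 ⟨hx.1, hxZ⟩]
    refine setIntegral_congr_fun hZm fun x hx => ?_
    have h2 := (hO ν hν _ hx.2).2.1
    simp only at h2
    change h ν x (tangentProj (S ν) x) = jac (fderiv ℝ φ x) (tangentProj (S ν) x) * k ν (φ x)
    rw [hφ' x, htp ν hν x hx]
    simp only [hk, hφdef, (hGP ν hν x hx).2]
    field_simp
  have hDfin : IsFiniteMeasure (μHE[2].restrict D) :=
    ⟨by rw [Measure.restrict_apply_univ]; exact hP.area_ball_lt_top r⟩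
  have hcont : ContinuousAt (fun ν => ∫ y in D, k ν y ∂μHE[2]) ν₀ := by
    refine continuousAt_of_dominated (bound := fun _ => 2 * C) (eventually_of_mem hU hkm) ?_
      (integrable_const _) ?_
    · filter_upwards [hU] with ν hν
      filter_upwards [ae_restrict_mem hDm] with y hy
      have h1 := hO ν hν _ (hGZ ν hν y hy)
      have h2 := h1.2.1
      simp only at h2
      have h3 : fderiv ℝ (f ν) (G ν y) ≠ 0 := fun h0 => h1.2.2 (by simp [h0])
      have h4 := hC ν (G ν y) _ (isPlaneProj_kerProj h3)
      rw [hk, Real.norm_eq_abs, abs_div, abs_of_pos (a := jac _ _) (by linarith),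
        div_le_iff₀ (by linarith)]
      nlinarith
    · filter_upwards [ae_restrict_mem hDm] with y hy
      have h1 := hkc (ν₀, y) (mk_mem_prod (mem_of_mem_nhds hU) hy)
      have h2 : Tendsto (fun ν : Cube n => (ν, y)) (𝓝 ν₀) (𝓝[U ×ˢ D] (ν₀, y)) := by
        rw [tendsto_nhdsWithin_iff]
        refine ⟨(continuous_id.prodMk continuous_const).tendsto ν₀, ?_⟩
        filter_upwards [hU] with ν hν
        exact mk_mem_prod hν hy
      exact h1.tendsto.comp h2
  exact hcont.congr (eventually_of_mem hU fun ν hν => (key ν hν).symm)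

theorem gaussWeight_le_one (x : E3) : gaussWeight x ≤ 1 := by
  unfold gaussWeight
  have h1 : Real.exp (-‖x‖ ^ 2 / 4) ≤ 1 := Real.exp_le_one_iff.2 (by nlinarith [sq_nonneg ‖x‖])
  have h2 : 1 / (4 * Real.pi) ≤ 1 := by
    rw [div_le_one (by positivity)]
    linarith [Real.pi_gt_three]
  exact mul_le_one₀ h2 (Real.exp_nonneg _) h1

/-- Integrals against the Gaussian measures are continuous in the parameter when the integrand is
supported in a fixed ball: a partition of unity splits it into pieces with small supports. -/
theorem IsLocallySmoothFamily.continuousAt_integral_of_support {n : ℕ} {S : Cube n → Set E3}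
    (hS : IsLocallySmoothFamily S) (hfin : ∀ ν, gaussArea (S ν) < ⊤) (ν₀ : Cube n)
    {h : Cube n → E3 → (E3 →L[ℝ] E3) → ℝ}
    (hc : Continuous fun q : Cube n × E3 × (E3 →L[ℝ] E3) => h q.1 q.2.1 q.2.2) {C : ℝ}
    (hC : ∀ ν x P, IsPlaneProj P → |h ν x P| ≤ C) {R : ℝ}
    (hR : ∀ ν x P, R < ‖x‖ → h ν x P = 0) :
    ContinuousAt (fun ν => ∫ x, h ν x (tangentProj (S ν) x) ∂gaussMeasure (S ν)) ν₀ := by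
  choose W hWo hWp hW using hS.continuousAt_setIntegral ν₀
  obtain ⟨t, ht⟩ := (isCompact_closedBall (0 : E3) R).elim_finite_subcover W hWo
    fun x _ => mem_iUnion.2 ⟨x, hWp x⟩
  have hcov : Metric.closedBall (0 : E3) R ⊆ ⋃ i : Fin t.card, W (t.equivFin.symm i) := by
    intro x hx
    obtain ⟨y, hy, hxy⟩ := mem_iUnion₂.1 (ht hx)
    exact mem_iUnion.2 ⟨t.equivFin ⟨y, hy⟩, by simpa using hxy⟩
  obtain ⟨φ, hφs, hφ1, hφI, -⟩ := exists_continuous_sum_one_of_isOpen_isCompact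
    (fun i => hWo _) (isCompact_closedBall (0 : E3) R) hcov
  have hφa (i x) : |φ i x| ≤ 1 := abs_le.2 ⟨by linarith [(hφI i x).1], (hφI i x).2⟩
  have hsum (ν x P) : h ν x P = ∑ i, φ i x * h ν x P := by
    by_cases hx : x ∈ Metric.closedBall (0 : E3) R
    · have := hφ1 hx
      simp only [Finset.sum_apply, Pi.one_apply] at this
      rw [← Finset.sum_mul, this, one_mul]
    · have : h ν x P = 0 := hR ν x P (by simpa using hx)
      simp [this]
  have hcφ (i) : Continuous fun q : Cube n × E3 × (E3 →L[ℝ] E3) =>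
      φ i q.2.1 * h q.1 q.2.1 q.2.2 := ((φ i).continuous.comp (by fun_prop)).mul hc
  have hint (ν i) : Integrable (fun x => φ i x * h ν x (tangentProj (S ν) x))
      (gaussMeasure (S ν)) := by
    refine (hS.isSurface ν).integrable (hfin ν) (C := C) (h := fun x P => φ i x * h ν x P)
      ((hcφ i).comp (continuous_const.prodMk continuous_id)) fun x P hP => ?_
    rw [abs_mul]
    exact (mul_le_of_le_one_left (abs_nonneg _) (hφa i x)).trans (hC ν x P hP)
  have heq : (fun ν => ∫ x, h ν x (tangentProj (S ν) x) ∂gaussMeasure (S ν)) = fun ν =>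
      ∑ i, ∫ x in S ν, gaussWeight x * (φ i x * h ν x (tangentProj (S ν) x)) ∂μHE[2] := by
    ext ν
    simp_rw [← integral_gaussMeasure]
    rw [← integral_finsetSum _ fun i _ => hint ν i]
    exact integral_congr_ae (Eventually.of_forall fun x => hsum _ _ _)
  rw [heq]
  refine tendsto_finsetSum _ fun i _ => ?_
  refine hW (t.equivFin.symm i) (fun ν x P => gaussWeight x * (φ i x * h ν x P)) ?_ ?_ C ?_
  · exact (continuous_gaussWeight.comp (by fun_prop)).mul (hcφ i)
  · intro ν P x hx
    have : φ i x = 0 := image_eq_zero_of_notMem_tsupport fun h => hx (hφs i h)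
    simp [this]
  · intro ν x P hP
    rw [abs_mul, abs_mul, abs_of_pos (gaussWeight_pos x)]
    refine (mul_le_of_le_one_left (by positivity) (gaussWeight_le_one x)).trans ?_
    exact (mul_le_of_le_one_left (abs_nonneg _) (hφa i x)).trans (hC ν x P hP)

/-- A continuous cutoff function, equal to `1` where `|x| ≤ R` and to `0` where `|x| ≥ R + 1`. -/
noncomputable def cutoff (R : ℝ) (x : E3) : ℝ := max 0 (min 1 (R + 1 - ‖x‖))

theorem continuous_cutoff (R : ℝ) : Continuous (cutoff R) := by
  unfold cutoff
  fun_prop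

theorem cutoff_mem (R : ℝ) (x : E3) : cutoff R x ∈ Icc (0 : ℝ) 1 :=
  ⟨le_max_left _ _, max_le zero_le_one (min_le_left _ _)⟩

theorem cutoff_eq_zero {R : ℝ} {x : E3} (h : R + 1 < ‖x‖) : cutoff R x = 0 :=
  max_eq_left ((min_le_right _ _).trans (by linarith))

theorem cutoff_eq_one {R : ℝ} {x : E3} (h : ‖x‖ ≤ R) : cutoff R x = 1 := by
  rw [cutoff, min_eq_left (by linarith), max_eq_right zero_le_one]

/-- **Narrow continuity of a family of surfaces.** Since the Gaussian area varies continuously, no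
mass escapes to infinity, and the Gaussian varifolds vary continuously when tested against bounded
continuous functions, which may themselves vary continuously with the parameter. -/
theorem IsLocallySmoothFamily.continuous_integral {n : ℕ} {S : Cube n → Set E3}
    (hS : IsLocallySmoothFamily S) (hfin : ∀ ν, gaussArea (S ν) < ⊤)
    (hF : Continuous fun ν => gaussArea (S ν)) {h : Cube n → E3 → (E3 →L[ℝ] E3) → ℝ}
    (hc : Continuous fun q : Cube n × E3 × (E3 →L[ℝ] E3) => h q.1 q.2.1 q.2.2) {C : ℝ}
    (hC : ∀ ν x P, IsPlaneProj P → |h ν x P| ≤ C) :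
    Continuous fun ν => ∫ x, h ν x (tangentProj (S ν) x) ∂gaussMeasure (S ν) := by
  refine continuous_iff_continuousAt.2 fun ν₀ => ?_
  have hfm (ν) := isFiniteMeasure_gaussMeasure (hfin ν)
  have hC0 : 0 ≤ C := by
    have hg : (innerSL ℝ (EuclideanSpace.single 0 1 : E3)) ≠ 0 := fun h => by
      have := congrArg (fun L : E3 →L[ℝ] ℝ => L (EuclideanSpace.single 0 1)) h
      simp at this
    exact (abs_nonneg _).trans (hC ν₀ 0 _ (isPlaneProj_kerProj hg))
  have hFr : Continuous fun ν => (gaussMeasure (S ν)).real univ := by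
    simp_rw [gaussMeasure_real_univ]
    exact continuous_iff_continuousAt.2 fun ν =>
      (ENNReal.tendsto_toReal (hfin ν).ne).comp (hF.tendsto ν)
  have hcutint (R ν) : Integrable (cutoff R) (gaussMeasure (S ν)) :=
    Integrable.of_bound (continuous_cutoff R).aestronglyMeasurable 1
      (Eventually.of_forall fun x => by
        rw [Real.norm_eq_abs, abs_of_nonneg (cutoff_mem R x).1]; exact (cutoff_mem R x).2)
  have hcut (R : ℝ) : ContinuousAt (fun ν => ∫ x, cutoff R x ∂gaussMeasure (S ν)) ν₀ := by
    refine hS.continuousAt_integral_of_support hfin ν₀ (h := fun _ x _ => cutoff R x) (C := 1)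
      (R := R + 1) ((continuous_cutoff R).comp (by fun_prop)) (fun _ x _ _ => ?_)
      fun _ x _ hx => cutoff_eq_zero hx
    rw [abs_of_nonneg (cutoff_mem R x).1]
    exact (cutoff_mem R x).2
  have htail0 : Tendsto (fun N : ℕ => ∫ x, cutoff N x ∂gaussMeasure (S ν₀)) atTop
      (𝓝 ((gaussMeasure (S ν₀)).real univ)) := by
    have : (gaussMeasure (S ν₀)).real univ = ∫ _, (1 : ℝ) ∂gaussMeasure (S ν₀) := by simp
    rw [this]
    refine tendsto_integral_of_dominated_convergence (fun _ => 1)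
      (fun N => (hcutint N ν₀).aestronglyMeasurable) (integrable_const _)
      (fun N => Eventually.of_forall fun x => by
        rw [Real.norm_eq_abs, abs_of_nonneg (cutoff_mem _ x).1]; exact (cutoff_mem _ x).2)
      (Eventually.of_forall fun x => ?_)
    refine tendsto_const_nhds.congr' ?_
    filter_upwards [tendsto_natCast_atTop_atTop.eventually (eventually_ge_atTop ‖x‖)] with N hN
    exact (cutoff_eq_one hN).symm
  rw [ContinuousAt, Metric.tendsto_nhds]
  intro ε hε
  set δ := ε / (4 * (C + 1)) with hδ
  have hδ0 : 0 < δ := by positivity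
  have hCδ : C * δ ≤ ε / 4 := by
    rw [hδ, mul_div_assoc', div_le_div_iff₀ (by positivity) (by norm_num)]
    nlinarith
  -- The mass outside a large ball is less than `δ` at `ν₀`, and remains so nearby because the total
  -- mass and the mass inside are continuous.
  obtain ⟨N, hN⟩ := (htail0.eventually (lt_mem_nhds (sub_lt_self _ hδ0))).exists
  have htail : ∀ᶠ ν in 𝓝 ν₀,
      (gaussMeasure (S ν)).real univ - ∫ x, cutoff N x ∂gaussMeasure (S ν) < δ :=
    (hFr.continuousAt.sub (hcut N)).eventually (gt_mem_nhds (by rw [Pi.sub_apply]; linarith))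
  have hcont : ContinuousAt
      (fun ν => ∫ x, cutoff N x * h ν x (tangentProj (S ν) x) ∂gaussMeasure (S ν)) ν₀ := by
    refine hS.continuousAt_integral_of_support hfin ν₀ (h := fun ν x P => cutoff N x * h ν x P)
      (C := C) (R := N + 1) (((continuous_cutoff N).comp (by fun_prop)).mul hc)
      (fun ν x P hP => ?_) fun _ x _ hx => by rw [cutoff_eq_zero hx, zero_mul]
    rw [abs_mul, abs_of_nonneg (cutoff_mem _ x).1]
    exact (mul_le_of_le_one_left (abs_nonneg _) (cutoff_mem _ x).2).trans (hC ν x P hP)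
  have hdiff : ∀ ν, |∫ x, h ν x (tangentProj (S ν) x) ∂gaussMeasure (S ν) -
      ∫ x, cutoff N x * h ν x (tangentProj (S ν) x) ∂gaussMeasure (S ν)| ≤
      C * ((gaussMeasure (S ν)).real univ - ∫ x, cutoff N x ∂gaussMeasure (S ν)) := by
    intro ν
    have hi1 := (hS.isSurface ν).integrable (hfin ν) (h := h ν)
      (hc.comp (continuous_const.prodMk continuous_id)) (hC ν)
    have hi2 : Integrable (fun x => cutoff N x * h ν x (tangentProj (S ν) x))
        (gaussMeasure (S ν)) := by
      refine (hS.isSurface ν).integrable (hfin ν) (C := C) (h := fun x P => cutoff N x * h ν x P)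
        (((continuous_cutoff N).comp continuous_fst).mul
          (hc.comp (continuous_const.prodMk continuous_id))) fun x P hP => ?_
      rw [abs_mul, abs_of_nonneg (cutoff_mem _ x).1]
      exact (mul_le_of_le_one_left (abs_nonneg _) (cutoff_mem _ x).2).trans (hC ν x P hP)
    have h1 : (gaussMeasure (S ν)).real univ = ∫ _, (1 : ℝ) ∂gaussMeasure (S ν) := by simp
    rw [← integral_sub hi1 hi2, h1, ← integral_sub (integrable_const _) (hcutint N ν),
      ← integral_const_mul, ← Real.norm_eq_abs]
    refine (norm_integral_le_of_norm_le (g := fun x => C * (1 - cutoff N x))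
      (((integrable_const (1 : ℝ)).sub (hcutint N ν)).const_mul C) ?_)
    filter_upwards [ae_gaussMeasure (hS.isSurface ν)] with x hx
    have h2 := hC ν x _ ((hS.isSurface ν).isPlaneProj hx)
    have h3 : h ν x (tangentProj (S ν) x) - cutoff N x * h ν x (tangentProj (S ν) x) =
      (1 - cutoff N x) * h ν x (tangentProj (S ν) x) := by ring
    have h4 := (cutoff_mem N x).2
    rw [h3, Real.norm_eq_abs, abs_mul, abs_of_nonneg (a := 1 - cutoff N x) (by linarith), mul_comm]
    exact mul_le_mul_of_nonneg_right h2 (by linarith)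
  filter_upwards [htail, Metric.tendsto_nhds.1 hcont (ε / 4) (by positivity)] with ν h1 h2
  have h3 := hdiff ν
  have h4 := hdiff ν₀
  have h5 : C * ((gaussMeasure (S ν)).real univ - ∫ x, cutoff N x ∂gaussMeasure (S ν)) ≤ ε / 4 :=
    (mul_le_mul_of_nonneg_left h1.le hC0).trans hCδ
  have h6 : C * ((gaussMeasure (S ν₀)).real univ - ∫ x, cutoff N x ∂gaussMeasure (S ν₀)) ≤
      ε / 4 := (mul_le_mul_of_nonneg_left (by linarith) hC0).trans hCδ
  rw [Real.dist_eq] at h2 ⊢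
  have h7 := abs_le.1 (h3.trans h5)
  have h8 := abs_le.1 (h4.trans h6)
  have h9 := abs_lt.1 h2
  exact abs_lt.2 ⟨by linarith, by linarith⟩

/-! ### Perturbations of the identity -/

section Perturbation

variable {V : Type*} [NormedAddCommGroup V] [NormedSpace ℝ V]

/-- A smooth family of vector fields on `ℝ³` whose differentials have norm at most `1/2`, so that
`x ↦ x + X (ν, x)` is a diffeomorphism for every `ν`. -/
structure IsSmallFamily (X : V × E3 → E3) : Prop where
  contDiff : ContDiff ℝ ∞ X
  norm_fderiv_le : ∀ ν x, ‖fderiv ℝ (fun x => X (ν, x)) x‖ ≤ 1 / 2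

namespace IsSmallFamily

variable {X : V × E3 → E3} (hX : IsSmallFamily X)
include hX

theorem contDiff_slice (ν : V) : ContDiff ℝ ∞ fun x => X (ν, x) :=
  hX.contDiff.comp (contDiff_const.prodMk contDiff_id)

theorem norm_sub_le (ν : V) (x y : E3) : ‖X (ν, x) - X (ν, y)‖ ≤ 1 / 2 * ‖x - y‖ :=
  convex_univ.norm_image_sub_le_of_norm_fderiv_le (f := fun x => X (ν, x))
    (fun z _ => (hX.contDiff_slice ν).differentiable (by simp) z)
    (fun z _ => hX.norm_fderiv_le ν z) (mem_univ y) (mem_univ x)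

theorem norm_sub_le_two_mul (ν : V) (x y : E3) :
    ‖x - y‖ ≤ 2 * ‖(x + X (ν, x)) - (y + X (ν, y))‖ := by
  have h1 := hX.norm_sub_le ν x y
  have h2 : x - y = ((x + X (ν, x)) - (y + X (ν, y))) - (X (ν, x) - X (ν, y)) := by abel
  have h3 := _root_.norm_sub_le ((x + X (ν, x)) - (y + X (ν, y))) (X (ν, x) - X (ν, y))
  rw [← h2] at h3
  linarith

/-- The preimage of `y` is the fixed point of the contraction `x ↦ y - X (ν, x)`. -/
theorem exists_preimage (ν : V) (y : E3) : ∃ x, x + X (ν, x) = y := by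
  have h : ContractingWith (1 / 2) fun x => y - X (ν, x) := by
    refine ⟨by norm_num, LipschitzWith.of_dist_le_mul fun a b => ?_⟩
    rw [dist_eq_norm, dist_eq_norm, sub_sub_sub_cancel_left, norm_sub_rev a b]
    simpa using hX.norm_sub_le ν b a
  refine ⟨ContractingWith.fixedPoint _ h, ?_⟩
  have := h.fixedPoint_isFixedPt
  rw [Function.IsFixedPt, sub_eq_iff_eq_add] at this
  exact this.symm

/-- The inverse diffeomorphisms of `x ↦ x + X (ν, x)` depend smoothly on all variables. -/
theorem exists_inverse [FiniteDimensional ℝ V] : ∃ χ : V × E3 → E3, ContDiff ℝ ∞ χ ∧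
    (∀ ν x, χ (ν, x + X (ν, x)) = x) ∧ ∀ ν y, χ (ν, y) + X (ν, χ (ν, y)) = y := by
  choose χ hχ using hX.exists_preimage
  have hinj (ν : V) {x y : E3} (h : x + X (ν, x) = y + X (ν, y)) : x = y := by
    have := hX.norm_sub_le_two_mul ν x y
    rw [h, sub_self, norm_zero, mul_zero] at this
    exact sub_eq_zero.1 (norm_le_zero_iff.1 this)
  have hleft (ν x) : χ ν (x + X (ν, x)) = x := hinj ν (hχ ν _)
  have hXc : Continuous X := hX.contDiff.continuous
  have hcont : Continuous fun q : V × E3 => (q.1, χ q.1 q.2) := by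
    refine continuous_fst.prodMk (continuous_iff_continuousAt.2 fun q₀ => ?_)
    rw [ContinuousAt, tendsto_iff_norm_sub_tendsto_zero]
    have hb : ∀ q : V × E3, ‖χ q.1 q.2 - χ q₀.1 q₀.2‖ ≤
        2 * (‖q.2 - q₀.2‖ + ‖X (q.1, χ q₀.1 q₀.2) - X (q₀.1, χ q₀.1 q₀.2)‖) := by
      intro q
      refine (hX.norm_sub_le_two_mul q.1 _ _).trans ?_
      rw [hχ]
      gcongr
      have : q.2 - (χ q₀.1 q₀.2 + X (q.1, χ q₀.1 q₀.2)) =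
          (q.2 - q₀.2) - (X (q.1, χ q₀.1 q₀.2) - X (q₀.1, χ q₀.1 q₀.2)) := by
        conv_rhs => rw [← hχ q₀.1 q₀.2]
        rw [hχ]
        have := hχ q₀.1 q₀.2
        nth_rw 3 [← this]
        abel
      rw [this]
      exact _root_.norm_sub_le _ _
    refine squeeze_zero (fun _ => norm_nonneg _) hb ?_
    have hc : Continuous fun q : V × E3 =>
        2 * (‖q.2 - q₀.2‖ + ‖X (q.1, χ q₀.1 q₀.2) - X (q₀.1, χ q₀.1 q₀.2)‖) := by fun_prop
    simpa using hc.tendsto q₀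
  -- The inverse is smooth jointly in all variables because it is the second component of the
  -- inverse of `Θ (ν, x) = (ν, x + X (ν, x))`, a smooth homeomorphism with invertible
  -- differentials.
  let Θ : (V × E3) ≃ₜ (V × E3) :=
    { toFun := fun q => (q.1, q.2 + X q)
      invFun := fun q => (q.1, χ q.1 q.2)
      left_inv := fun q => Prod.ext rfl (hleft q.1 q.2)
      right_inv := fun q => Prod.ext rfl (hχ q.1 q.2)
      continuous_toFun := by fun_prop
      continuous_invFun := hcont }
  have hΘ : ContDiff ℝ ∞ (Θ : V × E3 → V × E3) :=
    contDiff_fst.prodMk (contDiff_snd.add hX.contDiff)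
  have hder (q : V × E3) : ∃ L : (V × E3) ≃L[ℝ] (V × E3),
      HasFDerivAt (Θ : V × E3 → V × E3) (L : (V × E3) →L[ℝ] (V × E3)) q := by
    have hXd : HasFDerivAt X (fderiv ℝ X q) q := (hX.contDiff.differentiable (by simp) q).hasFDerivAt
    have h1 : HasFDerivAt (Θ : V × E3 → V × E3)
        ((ContinuousLinearMap.fst ℝ V E3).prod (ContinuousLinearMap.snd ℝ V E3 + fderiv ℝ X q)) q :=
      (ContinuousLinearMap.fst ℝ V E3).hasFDerivAt.prodMk
        ((ContinuousLinearMap.snd ℝ V E3).hasFDerivAt.add hXd)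
    set A := (ContinuousLinearMap.fst ℝ V E3).prod
      (ContinuousLinearMap.snd ℝ V E3 + fderiv ℝ X q) with hA
    have hAinj : Function.Injective A := by
      rw [injective_iff_map_eq_zero]
      rintro ⟨a, v⟩ h
      have ha : a = 0 := congrArg Prod.fst h
      have hv : v + fderiv ℝ X q (a, v) = 0 := congrArg Prod.snd h
      subst ha
      have h2 : fderiv ℝ (fun x => X (q.1, x)) q.2 = fderiv ℝ X q ∘L
          ContinuousLinearMap.inr ℝ V E3 := by
        have h3 : HasFDerivAt (fun x : E3 => (q.1, x)) (ContinuousLinearMap.inr ℝ V E3) q.2 :=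
          hasFDerivAt_prodMk_right q.1 q.2
        exact (hXd.comp q.2 h3).fderiv
      have h3 : fderiv ℝ X q (0, v) = fderiv ℝ (fun x => X (q.1, x)) q.2 v := by
        rw [h2]; rfl
      have h5 : ‖v‖ ≤ 1 / 2 * ‖v‖ := by
        have h6 : fderiv ℝ X q (0, v) = -v := eq_neg_of_add_eq_zero_right hv
        rw [h3] at h6
        have h7 := (fderiv ℝ (fun x => X (q.1, x)) q.2).le_of_opNorm_le
          (hX.norm_fderiv_le q.1 q.2) v
        rwa [h6, norm_neg] at h7
      have h6 : ‖v‖ = 0 := by linarith [norm_nonneg v]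
      rw [norm_eq_zero.1 h6]
      rfl
    refine ⟨(LinearEquiv.ofInjectiveEndo A.toLinearMap hAinj).toContinuousLinearEquiv, ?_⟩
    convert h1
    ext <;> rfl
  choose L hL using hder
  have hΘs := Θ.contDiff_symm hL hΘ
  exact ⟨fun q => χ q.1 q.2, contDiff_snd.comp hΘs, hleft, hχ⟩

theorem isDiffeo [FiniteDimensional ℝ V] (ν : V) : IsDiffeo fun x => x + X (ν, x) := by
  obtain ⟨χ, hχ, h1, h2⟩ := hX.exists_inverse
  exact ⟨contDiff_id.add (hX.contDiff_slice ν), fun y => χ (ν, y),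
    hχ.comp (contDiff_const.prodMk contDiff_id), h1 ν, h2 ν⟩

/-- Scaling the field by `t ∈ [0, 1]` is an isotopy to the identity. -/
theorem isDiffZero [FiniteDimensional ℝ V] (ν : V) : IsDiffZero fun x => x + X (ν, x) := by
  refine ⟨fun q => q.2 + q.1 • X (ν, q.2), ?_, fun t ht => ?_, fun x => by simp,
    fun x => by simp⟩
  · refine ContDiff.contDiffOn (contDiff_snd.add (contDiff_fst.smul ?_))
    exact (hX.contDiff_slice ν).comp contDiff_snd
  · have h : IsSmallFamily fun q : V × E3 => t • X q := by
      refine ⟨hX.contDiff.const_smul t, fun ν x => ?_⟩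
      have h1 : fderiv ℝ (fun x => t • X (ν, x)) x = t • fderiv ℝ (fun x => X (ν, x)) x :=
        fderiv_fun_const_smul ((hX.contDiff_slice ν).differentiable (by simp) x) t
      rw [h1, norm_smul, Real.norm_eq_abs, abs_of_nonneg ht.1]
      exact (mul_le_of_le_one_left (norm_nonneg _) ht.2).trans (hX.norm_fderiv_le ν x)
    exact h.isDiffeo ν

end IsSmallFamily

end Perturbation

theorem IsDiffeo.comp {φ ψ : E3 → E3} (hφ : IsDiffeo φ) (hψ : IsDiffeo ψ) :
    IsDiffeo fun x => φ (ψ x) := by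
  obtain ⟨h1, φ', h2, h3, h4⟩ := hφ
  obtain ⟨k1, ψ', k2, k3, k4⟩ := hψ
  exact ⟨h1.comp k1, fun x => ψ' (φ' x), k2.comp h2,
    fun x => by simp only [h3 (ψ x), k3 x], fun x => by simp only [k4 (φ' x), h4 x]⟩

theorem IsDiffZero.comp {φ ψ : E3 → E3} (hφ : IsDiffZero φ) (hψ : IsDiffZero ψ) :
    IsDiffZero fun x => φ (ψ x) := by
  obtain ⟨H, h1, h2, h3, h4⟩ := hφ
  obtain ⟨K, k1, k2, k3, k4⟩ := hψ
  refine ⟨fun q => H (q.1, K q), ?_, fun t ht => (h2 t ht).comp (k2 t ht), fun x => ?_, fun x => ?_⟩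
  · exact h1.comp (contDiff_fst.contDiffOn.prodMk k1) fun q hq => ⟨hq.1, mem_univ _⟩
  · simp only [k3, h3]
  · simp only [k4, h4]

/-- Following a homotopy by a small family supported in the interior of the cube. -/
theorem IsHomotopicTo.perturb {n : ℕ} {S S₁ S' : Cube n → Set E3} (h : IsHomotopicTo S₁ S)
    {X : (Fin n → ℝ) × E3 → E3} (hX : IsSmallFamily X) {K : Set (Cube n)} (hK : IsCompact K)
    (hKo : K ⊆ openCube n) (hXK : ∀ ν : Cube n, ν ∉ K → ∀ x, X (ν, x) = 0)
    (hS' : ∀ ν : Cube n, S' ν = (fun x => x + X (ν, x)) '' S₁ ν) : IsHomotopicTo S' S := by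
  obtain ⟨ψ, h1, h2, ⟨K₁, h3, h4, h5⟩, h6⟩ := h
  refine ⟨fun q => ψ q + X (q.1, ψ q), ?_, fun ν => (hX.isDiffZero _).comp (h2 ν),
    ⟨K₁ ∪ K, h3.union hK, union_subset h4 hKo, fun ν hν x => ?_⟩, fun ν => ?_⟩
  · exact h1.add (hX.contDiff.comp_contDiffOn (contDiff_fst.contDiffOn.prodMk h1))
  · have hν1 : ν ∉ K₁ := fun h => hν (Or.inl h)
    have hν2 : ν ∉ K := fun h => hν (Or.inr h)
    simp only [h5 ν hν1, hXK ν hν2, add_zero]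
  · rw [hS', h6, image_image]

/-! ### Invariance of the genus -/

theorem HasGenus.exists_image {S : Set E3} (φ : E3 ≃ₜ E3) {k : ℕ}
    (h : ∃ γ : Fin k → Circle → E3,
      (∀ i, Continuous (γ i) ∧ Function.Injective (γ i) ∧ range (γ i) ⊆ S) ∧
      Pairwise (fun i j => Disjoint (range (γ i)) (range (γ j))) ∧
      ∀ x ∈ S, IsPreconnected (connectedComponentIn S x \ ⋃ i, range (γ i))) :
    ∃ γ : Fin k → Circle → E3,
      (∀ i, Continuous (γ i) ∧ Function.Injective (γ i) ∧ range (γ i) ⊆ φ '' S) ∧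
      Pairwise (fun i j => Disjoint (range (γ i)) (range (γ j))) ∧
      ∀ x ∈ φ '' S, IsPreconnected (connectedComponentIn (φ '' S) x \ ⋃ i, range (γ i)) := by
  obtain ⟨γ, h1, h2, h3⟩ := h
  refine ⟨fun i => φ ∘ γ i, fun i => ⟨φ.continuous.comp (h1 i).1, φ.injective.comp (h1 i).2.1, ?_⟩,
    fun i j hij => ?_, ?_⟩
  · rw [range_comp]
    exact image_mono (h1 i).2.2
  · simp only [range_comp]
    exact (disjoint_image_iff φ.injective).2 (h2 hij)
  · rintro _ ⟨x, hx, rfl⟩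
    have : connectedComponentIn (φ '' S) (φ x) \ ⋃ i, range (φ ∘ γ i) =
        φ '' (connectedComponentIn S x \ ⋃ i, range (γ i)) := by
      rw [image_sdiff φ.injective, image_iUnion, φ.image_connectedComponentIn hx]
      simp only [range_comp]
    rw [this]
    exact (h3 x hx).image _ φ.continuous.continuousOn

theorem HasGenus.image {S : Set E3} {g : ℕ} (h : HasGenus S g) (φ : E3 ≃ₜ E3) :
    HasGenus (φ '' S) g := by
  unfold HasGenus at h ⊢
  refine ⟨HasGenus.exists_image φ h.1, fun k hk => h.2 ?_⟩
  have := HasGenus.exists_image φ.symm hk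
  have e : φ.symm '' (φ '' S) = S := by
    rw [image_image]
    simp
  rw [e] at this
  exact this

theorem IsDiffeo.hasGenus_image {S : Set E3} {g : ℕ} (h : HasGenus S g) {φ : E3 → E3}
    (hφ : IsDiffeo φ) : HasGenus (φ '' S) g := by
  obtain ⟨h1, χ, h2, h3, h4⟩ := hφ
  exact h.image
    { toFun := φ
      invFun := χ
      left_inv := h3
      right_inv := h4
      continuous_toFun := h1.continuous
      continuous_invFun := h2.continuous }

/-! ### Smooth dependence of the perturbed family -/

/-- Faà di Bruno's formula expresses the derivatives of a composition through those of its factors,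
so that continuity in a parameter passes to compositions. -/
theorem continuous_iteratedFDeriv_comp {Y : Type*} [TopologicalSpace Y] {f : Y → E3 → ℝ}
    {c : Y → E3 → E3} (hf : ∀ ν, ContDiff ℝ ∞ (f ν)) (hc : ∀ ν, ContDiff ℝ ∞ (c ν))
    (hfc : ∀ m : ℕ, Continuous fun q : Y × E3 => iteratedFDeriv ℝ m (f q.1) q.2)
    (hcc : ∀ m : ℕ, Continuous fun q : Y × E3 => iteratedFDeriv ℝ m (c q.1) q.2)
    (hc0 : Continuous fun q : Y × E3 => c q.1 q.2) (m : ℕ) :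
    Continuous fun q : Y × E3 => iteratedFDeriv ℝ m (f q.1 ∘ c q.1) q.2 := by
  have h1 : (fun q : Y × E3 => iteratedFDeriv ℝ m (f q.1 ∘ c q.1) q.2) = fun q =>
      ∑ p : OrderedFinpartition m, p.compAlongOrderedFinpartitionL ℝ E3 E3 ℝ
        (iteratedFDeriv ℝ p.length (f q.1) (c q.1 q.2))
        (fun i => iteratedFDeriv ℝ (p.partSize i) (c q.1) q.2) := by
    ext1 q
    rw [iteratedFDeriv_comp (hf q.1).contDiffAt (hc q.1).contDiffAt
      (WithTop.coe_le_coe.2 (le_top (a := (m : ℕ∞))))]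
    rfl
  rw [h1]
  refine continuous_finsetSum _ fun p _ => ?_
  have h2 : Continuous fun q : Y × E3 => p.compAlongOrderedFinpartitionL ℝ E3 E3 ℝ
      (iteratedFDeriv ℝ p.length (f q.1) (c q.1 q.2)) :=
    (ContinuousLinearMap.continuous _).comp ((hfc p.length).comp (continuous_fst.prodMk hc0))
  have h3 : Continuous fun q : Y × E3 => fun i : Fin p.length =>
    iteratedFDeriv ℝ (p.partSize i) (c q.1) q.2 := continuous_pi fun i => hcc _
  exact continuous_eval.comp (h2.prodMk h3)

theorem continuous_iteratedFDeriv_slice {V : Type*} [NormedAddCommGroup V] [NormedSpace ℝ V]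
    {χ : V × E3 → E3} (hχ : ContDiff ℝ ∞ χ) (m : ℕ) :
    Continuous fun q : V × E3 => iteratedFDeriv ℝ m (fun y => χ (q.1, y)) q.2 := by
  have h1 : (fun q : V × E3 => iteratedFDeriv ℝ m (fun y => χ (q.1, y)) q.2) = fun q =>
      ContinuousMultilinearMap.compContinuousLinearMapL
        (fun _ : Fin m => ContinuousLinearMap.inr ℝ V E3) (iteratedFDeriv ℝ m χ q) := by
    ext1 q
    have h2 : (fun y => χ (q.1, y)) =
        (fun z => χ ((q.1, 0) + z)) ∘ ContinuousLinearMap.inr ℝ V E3 := by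
      ext1 y
      simp
    have h3 : ContDiff ℝ ∞ fun z => χ ((q.1, 0) + z) := hχ.comp (contDiff_const.add contDiff_id)
    rw [h2, ContinuousLinearMap.iteratedFDeriv_comp_right _ h3 _
      (WithTop.coe_le_coe.2 (le_top (a := (m : ℕ∞)))), iteratedFDeriv_comp_add_left]
    simp
  rw [h1]
  exact (ContinuousLinearMap.continuous _).comp
    (hχ.continuous_iteratedFDeriv (WithTop.coe_le_coe.2 (le_top (a := (m : ℕ∞)))))

/-! ### Images of surfaces under diffeomorphisms -/

section Image

variable {S : Set E3} {φ χ : E3 → E3}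

theorem fderiv_inverse_apply (hφ : ContDiff ℝ ∞ φ) (hχ : ContDiff ℝ ∞ χ) (h1 : ∀ x, χ (φ x) = x)
    (x v : E3) : fderiv ℝ χ (φ x) (fderiv ℝ φ x v) = v := by
  have h3 := ((hχ.differentiable (by simp) (φ x)).hasFDerivAt.comp x
    (hφ.differentiable (by simp) x).hasFDerivAt).fderiv
  have h4 : χ ∘ φ = id := funext h1
  rw [h4, fderiv_id] at h3
  exact (congrArg (fun L : E3 →L[ℝ] E3 => L v) h3).symm

theorem fderiv_comp_inverse (hχ : ContDiff ℝ ∞ χ) {f : E3 → ℝ} (hf : ContDiff ℝ ∞ f) (y v : E3) :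
    fderiv ℝ (f ∘ χ) y v = fderiv ℝ f (χ y) (fderiv ℝ χ y v) := by
  rw [((hf.differentiable (by simp) (χ y)).hasFDerivAt.comp y
    (hχ.differentiable (by simp) y).hasFDerivAt).fderiv]
  rfl

theorem fderiv_comp_inverse_ne (hφ : ContDiff ℝ ∞ φ) (hχ : ContDiff ℝ ∞ χ)
    (h1 : ∀ x, χ (φ x) = x) (h2 : ∀ y, φ (χ y) = y) {f : E3 → ℝ} (hf : ContDiff ℝ ∞ f) {y : E3}
    (h : fderiv ℝ f (χ y) ≠ 0) : fderiv ℝ (f ∘ χ) y ≠ 0 := by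
  intro h3
  refine h (ContinuousLinearMap.ext fun v => ?_)
  have h4 := fderiv_inverse_apply hφ hχ h1 (χ y) v
  rw [h2] at h4
  rw [← h4, ← fderiv_comp_inverse hχ hf, h3]
  rfl

theorem mem_image_iff_inverse_mem (h1 : ∀ x, χ (φ x) = x) (h2 : ∀ y, φ (χ y) = y) {y : E3} :
    y ∈ φ '' S ↔ χ y ∈ S :=
  ⟨fun ⟨x, hx, hxy⟩ => by rwa [← hxy, h1], fun h => ⟨χ y, h, h2 y⟩⟩

theorem IsZeroSetNear.image {x : E3} {f : E3 → ℝ} (h : IsZeroSetNear S x f) (hφ : ContDiff ℝ ∞ φ)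
    (hχ : ContDiff ℝ ∞ χ) (h1 : ∀ x, χ (φ x) = x) (h2 : ∀ y, φ (χ y) = y) :
    IsZeroSetNear (φ '' S) (φ x) (f ∘ χ) := by
  refine ⟨h.1.comp hχ, ?_⟩
  have h3 : Tendsto χ (𝓝 (φ x)) (𝓝 x) := by
    have := hχ.continuous.tendsto (φ x)
    rwa [h1] at this
  filter_upwards [h3.eventually h.2] with y hy
  exact ⟨(mem_image_iff_inverse_mem h1 h2).trans hy.1,
    fun h0 => fderiv_comp_inverse_ne hφ hχ h1 h2 h.1 (hy.2 h0)⟩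

theorem IsSurface.image (hS : IsSurface S) (hφ : IsDiffeo φ) : IsSurface (φ '' S) := by
  obtain ⟨hφ, χ, hχ, h1, h2⟩ := hφ
  intro y
  obtain ⟨f, hf⟩ := hS (χ y)
  have := hf.image hφ hχ h1 h2
  rw [h2] at this
  exact ⟨_, this⟩

theorem kerProj_eq_self_iff {g : E3 →L[ℝ] ℝ} {v : E3} : kerProj g v = v ↔ g v = 0 := by
  rw [kerProj_eq, Submodule.starProjection_eq_self_iff]
  rfl

/-- The differential of a diffeomorphism maps the tangent planes of a surface onto those of its
image. -/
theorem IsSurface.tangentProj_image (hS : IsSurface S) (hφ : IsDiffeo φ) {x : E3} (hx : x ∈ S) :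
    (∀ v, tangentProj S x v = v →
      tangentProj (φ '' S) (φ x) (fderiv ℝ φ x v) = fderiv ℝ φ x v) ∧
    ∀ w, tangentProj (φ '' S) (φ x) w = w →
      ∃ u, tangentProj S x u = u ∧ fderiv ℝ φ x u = w := by
  obtain ⟨hφ, χ, hχ, h1, h2⟩ := hφ
  obtain ⟨f, hf⟩ := hS x
  have hf' := hf.image hφ hχ h1 h2
  rw [hf.tangentProj_eq hx, hf'.tangentProj_eq (mem_image_of_mem φ hx)]
  simp only [kerProj_eq_self_iff]
  refine ⟨fun v hv => ?_, fun w hw => ⟨fderiv ℝ χ (φ x) w, ?_, ?_⟩⟩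
  · rw [fderiv_comp_inverse hχ hf.1, fderiv_inverse_apply hφ hχ h1, h1, hv]
  · rwa [fderiv_comp_inverse hχ hf.1, h1] at hw
  · have := fderiv_inverse_apply hχ hφ h2 (φ x) w
    rwa [h1] at this

end Image

/-- If `id + E` maps one plane onto another and `E` is small, the planes are close. -/
theorem IsPlaneProj.norm_sub_le {P P' E : E3 →L[ℝ] E3} (hP : IsPlaneProj P) (hP' : IsPlaneProj P')
    {N : ℝ} (hE : ‖E‖ ≤ N) (hN : N ≤ 1 / 2) (h1 : ∀ v, P v = v → P' (v + E v) = v + E v)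
    (h2 : ∀ w, P' w = w → ∃ u, P u = u ∧ u + E u = w) : ‖P' - P‖ ≤ 3 * N := by
  have hN0 : 0 ≤ N := (norm_nonneg _).trans hE
  have hEv (v : E3) : ‖E v‖ ≤ N * ‖v‖ := E.le_of_opNorm_le hE v
  have hQ {R : E3 →L[ℝ] E3} (hR : IsPlaneProj R) (v : E3) : ‖v - R v‖ ≤ ‖v‖ := by
    have h3 : ⟪v - R v, R v⟫_ℝ = 0 := by
      rw [← hR.inner_left, map_sub, hR.idem, sub_self, inner_zero_left]
    have h4 : ‖v - R v + R v‖ ^ 2 = ‖v - R v‖ ^ 2 + ‖R v‖ ^ 2 := by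
      rw [norm_add_sq_real, h3]; ring
    rw [sub_add_cancel] at h4
    exact le_of_sq_le_sq (by nlinarith [sq_nonneg ‖R v‖]) (norm_nonneg _)
  -- The bound for `(1 - P') P`, from the images of vectors of the first plane.
  have a1 (v : E3) : ‖P v - P' (P v)‖ ≤ N * ‖v‖ := by
    have h3 := h1 (P v) (hP.idem v)
    have h4 : P v - P' (P v) = -(E (P v) - P' (E (P v))) := by
      rw [map_add] at h3
      have h5 : P' (P v) = P v + E (P v) - P' (E (P v)) := eq_sub_of_add_eq h3
      rw [h5]; abel
    rw [h4, norm_neg]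
    exact (hQ hP' _).trans ((hEv _).trans (mul_le_mul_of_nonneg_left (hP.norm_apply_le v) hN0))
  -- The bound for `(1 - P) P'`, from the preimages of vectors of the second plane.
  have a2 (v : E3) : ‖P' v - P (P' v)‖ ≤ 2 * N * ‖v‖ := by
    obtain ⟨u, hu, huw⟩ := h2 (P' v) (hP'.idem v)
    have h4 : P' v - P (P' v) = E u - P (E u) := by
      rw [← huw, map_add, hu]; abel
    have h5 : ‖u‖ ≤ 2 * ‖v‖ := by
      have h6 : u = P' v - E u := by rw [← huw]; abel
      have h7 : ‖u‖ ≤ ‖P' v‖ + ‖E u‖ := by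
        calc ‖u‖ = ‖P' v - E u‖ := by rw [← h6]
          _ ≤ _ := _root_.norm_sub_le _ _
      have h8 := hP'.norm_apply_le v
      have h9 : ‖E u‖ ≤ 1 / 2 * ‖u‖ :=
        (hEv u).trans (mul_le_mul_of_nonneg_right hN (norm_nonneg _))
      linarith
    rw [h4]
    refine (hQ hP _).trans ((hEv _).trans ?_)
    nlinarith
  -- The adjoint of `(1 - P) P'` is `P' (1 - P)`, which therefore satisfies the same bound.
  have a3 (v : E3) : ‖P' (v - P v)‖ ≤ 2 * N * ‖v‖ := by
    set z := P' (v - P v) with hz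
    have h3 : ‖z‖ ^ 2 = ⟪P' z - P (P' z), v⟫_ℝ := by
      have hzz : P' z = z := hP'.idem _
      rw [hzz, inner_sub_left, hP.inner_left, ← inner_sub_right, ← real_inner_self_eq_norm_sq]
      conv_lhs => rw [hz, hP'.inner_left, hzz, real_inner_comm]
    have h4 : ‖z‖ ^ 2 ≤ 2 * N * ‖z‖ * ‖v‖ := by
      rw [h3]
      exact (real_inner_le_norm _ _).trans (mul_le_mul_of_nonneg_right (a2 z) (norm_nonneg _))
    rcases (norm_nonneg z).eq_or_lt with h5 | h5
    · rw [← h5]; positivity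
    · refine le_of_mul_le_mul_right ?_ h5
      nlinarith
  refine ContinuousLinearMap.opNorm_le_bound _ (by positivity) fun v => ?_
  have h3 : (P' - P) v = P' (v - P v) - (P v - P' (P v)) := by
    rw [map_sub, sub_apply]; abel
  rw [h3]
  refine (_root_.norm_sub_le _ _).trans ?_
  linarith [a1 v, a3 v]

/-! ### Gaussian area of a perturbed surface -/

/-- The Gaussian divergence `div_P X - ⟨X, x⟩ / 2` at a point and a plane. -/
noncomputable def gaussDivAt (X : E3 → E3) (x : E3) (P : E3 →L[ℝ] E3) : ℝ :=
  LinearMap.trace ℝ E3 (P ∘L fderiv ℝ X x).toLinearMap - ⟪X x, x⟫_ℝ / 2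

/-- The factor by which `x ↦ x + Y x` changes the Gaussian area element of a plane `P` at `x`. -/
noncomputable def areaRatio (Y : E3 → E3) (x : E3) (P : E3 →L[ℝ] E3) : ℝ :=
  jac (ContinuousLinearMap.id ℝ E3 + fderiv ℝ Y x) P *
    Real.exp (-(2 * ⟪x, Y x⟫_ℝ + ‖Y x‖ ^ 2) / 4)

/-- Smooth vector fields with `|Y|`, `|DY|` and `|⟨Y, x⟩|` bounded by `N`. The last bound controls
the change of the Gaussian weight under `x ↦ x + Y x`. -/
structure IsControlled (Y : E3 → E3) (N : ℝ) : Prop where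
  contDiff : ContDiff ℝ ∞ Y
  norm_le : ∀ x, ‖Y x‖ ≤ N
  norm_fderiv_le : ∀ x, ‖fderiv ℝ Y x‖ ≤ N
  abs_inner_le : ∀ x, |⟪Y x, x⟫_ℝ| ≤ N

theorem areaRatio_nonneg (Y : E3 → E3) (x : E3) (P : E3 →L[ℝ] E3) : 0 ≤ areaRatio Y x P :=
  mul_nonneg (jac_nonneg _ _) (Real.exp_nonneg _)

theorem gaussWeight_add (x y : E3) : gaussWeight (x + y) =
    gaussWeight x * Real.exp (-(2 * ⟪x, y⟫_ℝ + ‖y‖ ^ 2) / 4) := by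
  rw [gaussWeight, gaussWeight, mul_assoc, ← Real.exp_add, norm_add_sq_real]
  ring_nf

theorem hasFDerivAt_id_add {Y : E3 → E3} (hY : ContDiff ℝ ∞ Y) (x : E3) :
    HasFDerivAt (fun x => x + Y x) (ContinuousLinearMap.id ℝ E3 + fderiv ℝ Y x) x :=
  (hasFDerivAt_id x).add (hY.differentiable (by simp) x).hasFDerivAt

namespace IsControlled

variable {Y : E3 → E3} {N : ℝ} (hY : IsControlled Y N)
include hY

theorem nonneg : 0 ≤ N := (norm_nonneg _).trans (hY.norm_le 0)

theorem mono {M : ℝ} (h : N ≤ M) : IsControlled Y M :=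
  ⟨hY.contDiff, fun x => (hY.norm_le x).trans h, fun x => (hY.norm_fderiv_le x).trans h,
    fun x => (hY.abs_inner_le x).trans h⟩

theorem abs_gaussDivAt_le (x : E3) {P : E3 →L[ℝ] E3} (hP : IsPlaneProj P) :
    |gaussDivAt Y x P| ≤ 3 * N := by
  have h1 := hP.abs_trace_comp_le (fderiv ℝ Y x)
  have h2 := hY.abs_inner_le x
  have h3 := hY.norm_fderiv_le x
  have h4 := hY.nonneg
  rw [abs_le] at *
  unfold gaussDivAt
  constructor <;> linarith

/-- The first order expansion of the area ratio, as an upper bound. -/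
theorem areaRatio_le (hN : N ≤ 1 / 2) (x : E3) {P : E3 →L[ℝ] E3} (hP : IsPlaneProj P) :
    areaRatio Y x P ≤ 1 + gaussDivAt Y x P + 4 * N ^ 2 := by
  have h0 := hY.nonneg
  have h1 := hP.jac_id_add_le (fderiv ℝ Y x)
  have h2 := hP.abs_trace_comp_le (fderiv ℝ Y x)
  have h3 := hY.norm_fderiv_le x
  have h4 := hY.abs_inner_le x
  have h5 : ‖fderiv ℝ Y x‖ ^ 2 ≤ N ^ 2 := pow_le_pow_left₀ (norm_nonneg _) h3 2
  unfold areaRatio gaussDivAt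
  set τ := LinearMap.trace ℝ E3 (P ∘L fderiv ℝ Y x).toLinearMap
  set σ : ℝ := -⟪Y x, x⟫_ℝ / 2 with hσ
  have hτ : |τ| ≤ 2 * N := by linarith
  have hσN : |σ| ≤ N / 2 := by rw [hσ, abs_div, abs_neg, abs_two]; linarith
  have h6 : Real.exp (-(2 * ⟪x, Y x⟫_ℝ + ‖Y x‖ ^ 2) / 4) ≤ 1 + σ + N ^ 2 / 4 := by
    have h7 : -(2 * ⟪x, Y x⟫_ℝ + ‖Y x‖ ^ 2) / 4 ≤ σ := by
      rw [hσ, real_inner_comm]; linarith [sq_nonneg ‖Y x‖]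
    refine (Real.exp_le_exp.2 h7).trans ?_
    have h8 := Real.abs_exp_sub_one_sub_id_le (x := σ) (by linarith)
    have h9 : σ ^ 2 ≤ (N / 2) ^ 2 := sq_le_sq' (by linarith [abs_le.1 hσN]) (abs_le.1 hσN).2
    linarith [(abs_le.1 h8).2]
  have h7 : jac (ContinuousLinearMap.id ℝ E3 + fderiv ℝ Y x) P ≤ 1 + τ + N ^ 2 := by linarith
  have h8 := mul_le_mul h7 h6 (Real.exp_nonneg _) ((jac_nonneg _ _).trans h7)
  refine h8.trans ?_
  have h9 : τ * σ ≤ N ^ 2 := by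
    refine (le_abs_self _).trans ?_
    rw [abs_mul]
    have := mul_le_mul hτ hσN (abs_nonneg _) (by linarith)
    linarith
  have h10 : τ ≤ 1 := (le_abs_self τ).trans (by linarith)
  have h11 : σ ≤ 1 / 4 := (le_abs_self σ).trans (by linarith)
  have h12 : N ^ 2 ≤ 1 / 4 := by nlinarith
  have h13 : -(⟪Y x, x⟫_ℝ) / 2 = σ := rfl
  have h14 := mul_le_mul_of_nonneg_right h10 (sq_nonneg N)
  have h15 := mul_le_mul_of_nonneg_right h11 (sq_nonneg N)
  have h16 := mul_le_mul_of_nonneg_right h12 (sq_nonneg N)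
  nlinarith

theorem areaRatio_le_one_add (hN : N ≤ 1 / 2) (x : E3) {P : E3 →L[ℝ] E3} (hP : IsPlaneProj P) :
    areaRatio Y x P ≤ 1 + 5 * N := by
  have h1 := hY.areaRatio_le hN x hP
  have h2 := (abs_le.1 (hY.abs_gaussDivAt_le x hP)).2
  have := hY.nonneg
  nlinarith

theorem isSmallFamily (hN : N ≤ 1 / 2) : IsSmallFamily fun q : ℝ × E3 => Y q.2 :=
  ⟨hY.contDiff.comp contDiff_snd, fun _ x => (hY.norm_fderiv_le x).trans hN⟩

theorem isDiffeo (hN : N ≤ 1 / 2) : IsDiffeo fun x => x + Y x := (hY.isSmallFamily hN).isDiffeo 0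

theorem continuous_areaRatio :
    Continuous fun q : E3 × (E3 →L[ℝ] E3) => areaRatio Y q.1 q.2 := by
  have h1 := hY.contDiff.continuous
  have h2 : Continuous (fderiv ℝ Y) := hY.contDiff.continuous_fderiv (by simp)
  unfold areaRatio
  refine Continuous.mul (Continuous.jac ?_ continuous_snd) (by fun_prop)
  exact continuous_const.add (h2.comp continuous_fst)

variable {S : Set E3}

theorem norm_tangentProj_sub_le (hN : N ≤ 1 / 2) (hS : IsSurface S) {x : E3} (hx : x ∈ S) :
    ‖tangentProj ((fun x => x + Y x) '' S) (x + Y x) - tangentProj S x‖ ≤ 3 * N := by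
  obtain ⟨h1, h2⟩ := hS.tangentProj_image (hY.isDiffeo hN) hx
  rw [(hasFDerivAt_id_add hY.contDiff x).fderiv] at h1 h2
  exact (hS.isPlaneProj hx).norm_sub_le
    ((hS.image (hY.isDiffeo hN)).isPlaneProj (mem_image_of_mem _ hx))
    (hY.norm_fderiv_le x) hN h1 h2

theorem injective_fderiv (hN : N ≤ 1 / 2) (x v : E3)
    (h : fderiv ℝ (fun x => x + Y x) x v = 0) : v = 0 := by
  rw [(hasFDerivAt_id_add hY.contDiff x).fderiv] at h
  have h1 : v + fderiv ℝ Y x v = 0 := h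
  have h2 := (fderiv ℝ Y x).le_of_opNorm_le ((hY.norm_fderiv_le x).trans hN) v
  rw [eq_neg_of_add_eq_zero_right h1, norm_neg] at h2
  exact norm_le_zero_iff.1 (by linarith [norm_nonneg v])

/-- The area formula for the diffeomorphism `x ↦ x + Y x` of a controlled field. -/
theorem area_formula (hN : N ≤ 1 / 2) (hS : IsSurface S) :
    ((μHE[2].restrict S).withDensity fun x => ENNReal.ofReal
      (jac (fderiv ℝ (fun x => x + Y x) x) (tangentProj S x))).map (fun x => x + Y x) =
      μHE[2].restrict ((fun x => x + Y x) '' S) := by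
  have hinj : Function.Injective fun x => x + Y x := (hY.isDiffeo hN).2.choose_spec.2.1.injective
  exact hS.hasTangentPlanes.area_formula hS.isClosed.measurableSet hS.continuousOn_tangentProj
    ((hY.isDiffeo hN).1.of_le (by exact_mod_cast le_top)) hinj.injOn
    fun x _ v _ => hY.injective_fderiv hN x v

/-- Integrals against the Gaussian measure of the perturbed surface, pulled back to the surface. -/
theorem integral_image (hN : N ≤ 1 / 2) (hS : IsSurface S) {k : E3 → ℝ}
    (hk : ContinuousOn k ((fun x => x + Y x) '' S)) :
    ∫ y, k y ∂gaussMeasure ((fun x => x + Y x) '' S) =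
      ∫ x, areaRatio Y x (tangentProj S x) * k (x + Y x) ∂gaussMeasure S := by
  have hS' := hS.image (hY.isDiffeo hN)
  have hinj : Function.Injective fun x => x + Y x := (hY.isDiffeo hN).2.choose_spec.2.1.injective
  rw [integral_gaussMeasure, integral_gaussMeasure,
    hS.hasTangentPlanes.setIntegral_image hS.isClosed.measurableSet hS.continuousOn_tangentProj
      ((hY.isDiffeo hN).1.of_le (by exact_mod_cast le_top)) hinj.injOn
      fun x _ v _ => hY.injective_fderiv hN x v]
  · refine integral_congr_ae (Eventually.of_forall fun x => ?_)
    simp only [(hasFDerivAt_id_add hY.contDiff x).fderiv, gaussWeight_add, areaRatio]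
    ring
  · exact (continuous_gaussWeight.continuousOn.mul hk).aestronglyMeasurable
      hS'.isClosed.measurableSet

theorem gaussArea_image_lt_top (hN : N ≤ 1 / 2) (hS : IsSurface S) (hF : gaussArea S < ⊤) :
    gaussArea ((fun x => x + Y x) '' S) < ⊤ := by
  have hw := continuous_gaussWeight.measurable.ennreal_ofReal
  have hsm : ContDiff ℝ ∞ fun x => x + Y x := (hY.isDiffeo hN).1
  have hw' : Measurable fun x => ENNReal.ofReal (gaussWeight (x + Y x)) :=
    hw.comp hsm.continuous.measurable
  have hd : AEMeasurable (fun x => ENNReal.ofReal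
      (jac (fderiv ℝ (fun x => x + Y x) x) (tangentProj S x))) (μHE[2].restrict S) :=
    ((hsm.continuous_fderiv (by simp)).continuousOn.jac
      hS.continuousOn_tangentProj).aemeasurable hS.isClosed.measurableSet |>.ennreal_ofReal
  rw [gaussArea, ← hY.area_formula hN hS, lintegral_map hw hsm.continuous.measurable,
    lintegral_withDensity_eq_lintegral_mul₀ hd hw'.aemeasurable]
  have h1 : ∀ᵐ x ∂μHE[2].restrict S, ENNReal.ofReal
      (jac (fderiv ℝ (fun x => x + Y x) x) (tangentProj S x)) *
        ENNReal.ofReal (gaussWeight (x + Y x)) ≤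
      ENNReal.ofReal (1 + 5 * N) * ENNReal.ofReal (gaussWeight x) := by
    filter_upwards [ae_restrict_mem hS.isClosed.measurableSet] with x hx
    have h2 := hY.areaRatio_le_one_add hN x (hS.isPlaneProj hx)
    have h3 := hY.nonneg
    rw [← ENNReal.ofReal_mul (jac_nonneg _ _), ← ENNReal.ofReal_mul (by linarith),
      (hasFDerivAt_id_add hY.contDiff x).fderiv, gaussWeight_add]
    refine ENNReal.ofReal_le_ofReal ?_
    unfold areaRatio at h2
    calc _ = _ := mul_left_comm _ _ _
      _ ≤ gaussWeight x * (1 + 5 * N) := mul_le_mul_of_nonneg_left h2 (gaussWeight_pos x).le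
      _ = _ := mul_comm _ _
  refine (lintegral_mono_ae h1).trans_lt ?_
  rw [lintegral_const_mul _ hw]
  exact ENNReal.mul_lt_top ENNReal.ofReal_lt_top hF

theorem toReal_gaussArea_image (hN : N ≤ 1 / 2) (hS : IsSurface S) :
    (gaussArea ((fun x => x + Y x) '' S)).toReal =
      ∫ x, areaRatio Y x (tangentProj S x) ∂gaussMeasure S := by
  have := hY.integral_image hN hS (k := fun _ => 1) continuousOn_const
  simpa [gaussMeasure_real_univ] using this

end IsControlled

/-! ### Perturbed families stay in the saturated set -/

section PerturbedFamily

variable {n : ℕ} {S : Cube n → Set E3} {X : (Fin n → ℝ) × E3 → E3}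

/-- Defining functions of the perturbed surfaces are obtained by composition with the inverse
diffeomorphisms, which depend smoothly on the parameter. -/
theorem IsLocallySmoothFamily.image (hS : IsLocallySmoothFamily S) (hX : IsSmallFamily X) :
    IsLocallySmoothFamily fun ν => (fun x => x + X (ν, x)) '' S ν := by
  obtain ⟨χ, hχ, h1, h2⟩ := hX.exists_inverse
  intro ν₀ p
  obtain ⟨U, hU, B, hB, f, hf, hfm, hfB⟩ := hS ν₀ (χ (ν₀, p))
  have hχc : Continuous fun q : Cube n × E3 => χ (q.1, q.2) := by
    have := hχ.continuous
    fun_prop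
  obtain ⟨U₁, hU₁, B₁, hB₁, h3⟩ := mem_nhds_prod_iff.1
    (hχc.continuousAt (x := (ν₀, p)) |>.preimage_mem_nhds hB)
  have hχs (ν : Cube n) : ContDiff ℝ ∞ fun y => χ (ν, y) := hχ.comp (contDiff_prodMk_right _)
  refine ⟨U ∩ U₁, inter_mem hU hU₁, B₁, hB₁, fun ν => f ν ∘ fun y => χ (ν, y),
    fun ν => (hf ν).comp (hχs ν), ?_, fun ν hν y hy => ?_⟩
  · refine continuous_iteratedFDeriv_comp (c := fun ν : Cube n => fun y => χ (ν, y)) hf hχs hfm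
      (fun m => ?_) hχc
    exact (continuous_iteratedFDeriv_slice hχ m).comp
      ((continuous_subtype_val.comp continuous_fst).prodMk continuous_snd)
  · have h4 := hfB ν hν.1 (χ (ν, y)) (h3 (mk_mem_prod hν.2 hy))
    have hsm : ContDiff ℝ ∞ fun x => x + X (ν, x) := contDiff_id.add (hX.contDiff_slice ν)
    exact ⟨(mem_image_iff_inverse_mem (φ := fun x => x + X (ν, x)) (χ := fun y => χ (ν, y))
      (h1 ν) (h2 ν)).trans h4.1,
      fun h0 => fderiv_comp_inverse_ne hsm (hχs ν) (h1 ν) (h2 ν) (hf ν) (h4.2 h0)⟩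

theorem continuous_fderiv_slice {V : Type*} [NormedAddCommGroup V] [NormedSpace ℝ V]
    {X : V × E3 → E3} (hX : ContDiff ℝ ∞ X) :
    Continuous fun q : V × E3 => fderiv ℝ (fun x => X (q.1, x)) q.2 := by
  have h : (fun q : V × E3 => fderiv ℝ (fun x => X (q.1, x)) q.2) = fun q =>
      fderiv ℝ X q ∘L ContinuousLinearMap.inr ℝ V E3 := by
    ext1 q
    exact ((hX.differentiable (by simp) q).hasFDerivAt.comp q.2
      (hasFDerivAt_prodMk_right q.1 q.2)).fderiv
  rw [h]
  exact (hX.continuous_fderiv (by simp)).clm_comp continuous_const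

/-- `X` is a smooth family of fields controlled by `1/2`, vanishing for parameters outside a
compact subset of the open cube. -/
structure IsControlledFamily (X : (Fin n → ℝ) × E3 → E3) : Prop where
  contDiff : ContDiff ℝ ∞ X
  controlled : ∀ ν : Fin n → ℝ, IsControlled (fun x => X (ν, x)) (1 / 2)
  support : ∃ K : Set (Cube n), IsCompact K ∧ K ⊆ openCube n ∧
    ∀ ν : Cube n, ν ∉ K → ∀ x, X (ν, x) = 0

theorem IsControlledFamily.isSmallFamily (hX : IsControlledFamily X) : IsSmallFamily X :=
  ⟨hX.contDiff, fun ν => (hX.controlled ν).norm_fderiv_le⟩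

/-- The Gaussian areas of the perturbed surfaces are the integrals of the area ratios over the
original surfaces, to which the narrow continuity of the family applies. -/
theorem IsControlledFamily.continuous_gaussArea_image (hX : IsControlledFamily X)
    (hS : IsLocallySmoothFamily S) (hfin : ∀ ν, gaussArea (S ν) < ⊤)
    (hF : Continuous fun ν => gaussArea (S ν)) :
    Continuous fun ν : Cube n => gaussArea ((fun x => x + X (ν, x)) '' S ν) := by
  have hval : Continuous fun q : Cube n × E3 × (E3 →L[ℝ] E3) => (((q.1 : Fin n → ℝ), q.2.1)) := by
    fun_prop
  have h1 : Continuous fun q : Cube n × E3 × (E3 →L[ℝ] E3) => X (q.1, q.2.1) :=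
    hX.contDiff.continuous.comp hval
  have h2 : Continuous fun q : Cube n × E3 × (E3 →L[ℝ] E3) =>
      fderiv ℝ (fun x => X (q.1, x)) q.2.1 := (continuous_fderiv_slice hX.contDiff).comp hval
  have h3 : Continuous fun q : Cube n × E3 × (E3 →L[ℝ] E3) =>
      areaRatio (fun x => X (q.1, x)) q.2.1 q.2.2 := by
    unfold areaRatio
    refine Continuous.mul (Continuous.jac (continuous_const.add h2) (by fun_prop)) ?_
    have h4 : Continuous fun q : Cube n × E3 × (E3 →L[ℝ] E3) => q.2.1 := by fun_prop
    exact Real.continuous_exp.comp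
      ((((h4.inner h1).const_mul 2).add (h1.norm.pow 2)).neg.div_const 4)
  have h4 := hS.continuous_integral hfin hF (h := fun ν x P => areaRatio (fun x => X (ν, x)) x P)
    h3 (C := 1 + 5 * (1 / 2)) fun ν x P hP => by
      rw [abs_of_nonneg (areaRatio_nonneg _ _ _)]
      exact (hX.controlled ν).areaRatio_le_one_add le_rfl x hP
  have h5 := ENNReal.continuous_ofReal.comp h4
  refine h5.congr fun ν => ?_
  have h6 := (hX.controlled ν).toReal_gaussArea_image le_rfl (hS.isSurface ν)
  have h7 := (hX.controlled ν).gaussArea_image_lt_top le_rfl (hS.isSurface ν) (hfin ν)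
  simp only [Function.comp_apply, ← h6]
  exact ENNReal.ofReal_toReal h7.ne

theorem IsContinuousFamily.gaussArea_lt_top {g : ℕ} (hS : IsContinuousFamily g S) (ν : Cube n) :
    gaussArea (S ν) < ⊤ := (le_iSup (fun ν => gaussArea (S ν)) ν).trans_lt hS.bounded

theorem IsControlledFamily.image_mem_saturation {g : ℕ} {S₀ : Cube n → Set E3}
    (hX : IsControlledFamily X) (hS : S ∈ saturation g S₀) :
    (fun ν : Cube n => (fun x => x + X (ν, x)) '' S ν) ∈ saturation g S₀ := by
  obtain ⟨hS, hS₀⟩ := hS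
  obtain ⟨K, hK, hKo, hXK⟩ := hX.support
  have hc := hX.continuous_gaussArea_image hS.smooth hS.gaussArea_lt_top hS.continuous_area
  refine ⟨⟨hS.smooth.image hX.isSmallFamily,
    fun ν hν => (hX.isSmallFamily.isDiffeo (ν : Fin n → ℝ)).hasGenus_image (hS.genus ν hν), ?_,
    hc, fun ν hν => ?_⟩, ?_⟩
  · obtain ⟨ν₀, -, h⟩ := isCompact_univ.exists_isMaxOn (α := ℝ≥0∞)
      ⟨(⟨0, by simp⟩ : Cube n), mem_univ _⟩ hc.continuousOn
    exact (iSup_le fun ν => h (mem_univ ν)).trans_lt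
      ((hX.controlled ν₀).gaussArea_image_lt_top le_rfl (hS.smooth.isSurface ν₀)
        (hS.gaussArea_lt_top ν₀))
  · have h1 : ν ∉ K := fun h => hν (hKo h)
    have h2 : (fun x => x + X (ν, x)) '' S ν = S ν := by simp [hXK ν h1]
    simp only [h2]
    exact hS.boundary ν hν
  · exact hS₀.perturb hX.isSmallFamily hK hKo hXK fun ν => rfl

end PerturbedFamily

/-! ### The compact space `G₂(S³)` -/

section PlaneProj

variable {E : Type*} [NormedAddCommGroup E] [InnerProductSpace ℝ E] [FiniteDimensional ℝ E]
  [CompleteSpace E]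

/-- The rank condition on a projection is closed, since the rank is the trace. -/
theorem isClosed_setOf_isPlaneProj : IsClosed {P : E →L[ℝ] E | IsPlaneProj P} := by
  have h : {P : E →L[ℝ] E | IsPlaneProj P} = {P | P * P = P} ∩ {P | star P = P} ∩
      {P | LinearMap.trace ℝ E (ContinuousLinearMap.coeLM ℝ P) = 2} := by
    ext P
    have key (hP : P * P = P) : LinearMap.trace ℝ E (ContinuousLinearMap.coeLM ℝ P) =
        Module.finrank ℝ P.range := by
      refine LinearMap.IsProj.trace (p := P.range) ⟨fun v => ⟨v, rfl⟩, ?_⟩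
      rintro _ ⟨v, rfl⟩
      exact congrArg (fun L : E →L[ℝ] E => L v) hP
    constructor
    · rintro ⟨⟨h1, h2⟩, h3⟩
      refine ⟨⟨h1, h2⟩, ?_⟩
      change LinearMap.trace ℝ E (ContinuousLinearMap.coeLM ℝ P) = 2
      rw [key h1, h3]
      norm_num
    · rintro ⟨⟨h1, h2⟩, h3⟩
      refine ⟨⟨h1, h2⟩, ?_⟩
      change LinearMap.trace ℝ E (ContinuousLinearMap.coeLM ℝ P) = 2 at h3
      rw [key h1] at h3
      exact_mod_cast h3
  rw [h]
  refine ((isClosed_eq (by fun_prop) continuous_id).inter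
    (isClosed_eq (ContinuousLinearMap.adjoint (𝕜 := ℝ) (E := E) (F := E)).continuous
      continuous_id)).inter (isClosed_eq ?_ continuous_const)
  exact LinearMap.continuous_of_finiteDimensional
    ((LinearMap.trace ℝ E).comp (ContinuousLinearMap.coeLM ℝ))

end PlaneProj

theorem IsPlaneProj.opNorm_le_one {E : Type*} [NormedAddCommGroup E] [InnerProductSpace ℝ E]
    [CompleteSpace E] {P : E →L[ℝ] E} (hP : IsPlaneProj P) : ‖P‖ ≤ 1 := by
  obtain ⟨_, h⟩ := isStarProjection_iff_eq_starProjection_range.1 hP.1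
  rw [h]
  exact Submodule.starProjection_norm_le _

instance : CompactSpace GrS3 := by
  refine isCompact_iff_compactSpace.1 (Metric.isCompact_of_isClosed_isBounded
    (s := {q : E4 × (E4 →L[ℝ] E4) | ‖q.1‖ = 1 ∧ IsPlaneProj q.2 ∧ q.2 q.1 = 0}) ?_ ?_)
  · exact (isClosed_eq continuous_fst.norm continuous_const).inter
      ((isClosed_setOf_isPlaneProj.preimage continuous_snd).inter
        (isClosed_eq (continuous_snd.clm_apply continuous_fst) continuous_const))
  · refine (Metric.isBounded_closedBall (x := 0) (r := 1)).subset fun q hq => ?_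
    rw [mem_closedBall_zero_iff]
    exact max_le hq.1.le hq.2.1.opNorm_le_one

/-- Stereographic projection from the north pole; the value at the north pole is immaterial. -/
noncomputable def stereoInv (y : E4) : E3 := (1 - y.snd)⁻¹ • y.fst

theorem normSq_eq (y : E4) : ‖y‖ ^ 2 = ‖y.fst‖ ^ 2 + y.snd ^ 2 := by
  rw [WithLp.prod_norm_sq_eq_of_L2, Real.norm_eq_abs, sq_abs]

theorem snd_ne_one {y : E4} (hy : ‖y‖ = 1) (h : y ≠ northPole) : 1 - y.snd ≠ 0 := by
  intro h1
  have h2 := normSq_eq y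
  have h3 : y.snd = 1 := by linarith
  rw [hy, h3] at h2
  have h4 : ‖y.fst‖ ^ 2 = 0 := by linarith
  have h5 : y.fst = 0 := norm_eq_zero.1 (pow_eq_zero_iff (two_ne_zero) |>.1 h4)
  exact h (WithLp.ofLp_injective 2 (Prod.ext h5 h3))

theorem stereoFactor_stereoInv {y : E4} (hy : ‖y‖ = 1) (h : y ≠ northPole) :
    stereoFactor (stereoInv y) = 1 - y.snd := by
  have h1 := snd_ne_one hy h
  have h2 := normSq_eq y
  have h3 : (1 - y.snd) * (1 + ‖stereoInv y‖ ^ 2) = 2 := by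
    rw [stereoInv, norm_smul, mul_pow, norm_inv, Real.norm_eq_abs, inv_pow, sq_abs]
    field_simp
    rw [hy] at h2
    linear_combination (-1 : ℝ) * h2
  have h4 := stereoFactor_mul (stereoInv y)
  exact mul_right_cancel₀ (one_add_normSq_pos _).ne' (h4.trans h3.symm)

theorem stereo_stereoInv {y : E4} (hy : ‖y‖ = 1) (h : y ≠ northPole) :
    stereo (stereoInv y) = y := by
  rw [stereo_eq, stereoFactor_stereoInv hy h, stereoInv, smul_smul,
    mul_inv_cancel₀ (snd_ne_one hy h), one_smul, sub_sub_cancel]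
  rfl

theorem snd_stereo (x : E3) : (stereo x).snd = 1 - stereoFactor x := by
  rw [stereo_eq]
  rfl

theorem stereo_ne_northPole (x : E3) : stereo x ≠ northPole := by
  intro h
  have h1 := snd_stereo x
  rw [h] at h1
  have h2 : northPole.snd = 1 := rfl
  linarith [stereoFactor_pos x]

theorem adjoint_stereoFrame (x : E3) (v : E4) : (stereoFrame x).adjoint v =
    v.fst + (stereoFactor x * (v.snd - ⟪x, v.fst⟫_ℝ)) • x := by
  refine ext_inner_left ℝ fun u => ?_
  rw [ContinuousLinearMap.adjoint_inner_right, stereoFrame_apply, WithLp.prod_inner_apply,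
    inner_add_right, real_inner_smul_right]
  simp only [inner_sub_left, real_inner_smul_left, RCLike.inner_apply, conj_trivial,
    real_inner_comm u x]
  change ⟪u, v.fst⟫_ℝ - stereoFactor x * ⟪u, x⟫_ℝ * ⟪x, v.fst⟫_ℝ +
    v.snd * (stereoFactor x * ⟪u, x⟫_ℝ) = _
  ring

/-- The frame identifies `ℝ³` with the orthogonal complement of `stereo x`. -/
theorem stereoFrame_adjoint (x : E3) (v : E4) :
    stereoFrame x ((stereoFrame x).adjoint v) = v - ⟪stereo x, v⟫_ℝ • stereo x := by
  have h1 := stereoFactor_mul x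
  have h2 : ⟪stereo x, v⟫_ℝ = stereoFactor x * ⟪x, v.fst⟫_ℝ + (1 - stereoFactor x) * v.snd := by
    rw [stereo_eq, WithLp.prod_inner_apply]
    simp only [real_inner_smul_left, RCLike.inner_apply, conj_trivial]
    change _ * ⟪x, v.fst⟫_ℝ + v.snd * _ = _
    ring
  rw [adjoint_stereoFrame, stereoFrame_apply, h2, stereo_eq]
  simp only [inner_add_right, real_inner_smul_right, real_inner_self_eq_norm_sq]
  set a := ⟪x, v.fst⟫_ℝ
  set l := stereoFactor x
  refine WithLp.ofLp_injective 2 (Prod.ext ?_ ?_)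
  · change _ = v.fst - (l * a + (1 - l) * v.snd) • l • x
    change v.fst + _ - _ = _
    rw [smul_smul, sub_eq_add_neg (v.fst), ← neg_smul, add_sub_assoc, ← sub_smul]
    congr 2
    linear_combination (-l * (v.snd - a)) * h1
  · change _ = v.snd - (l * a + (1 - l) * v.snd) * (1 - l)
    change l * _ = _
    linear_combination (l * (v.snd - a)) * h1

/-- Away from the north pole every point of `G₂(S³)` is the lift of a point of `G₂(ℝ³)`, which is
given by an explicit formula. -/
theorem mem_range_grLift {q : GrS3} (hq : q.1.1 ≠ northPole) : ∃ p : GrR3, grLift p = q ∧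
    p.1 = (stereoInv q.1.1,
      (stereoFrame (stereoInv q.1.1)).adjoint ∘L q.1.2 ∘L stereoFrame (stereoInv q.1.1)) := by
  obtain ⟨⟨y, Q⟩, hy, hQ, hQy⟩ := q
  simp only at hy hQ hQy hq ⊢
  set x := stereoInv y with hx
  have hxy : stereo x = y := stereo_stereoInv hy hq
  set P := (stereoFrame x).adjoint ∘L Q ∘L stereoFrame x with hP
  have hQs := hQ.1.isSelfAdjoint
  rw [ContinuousLinearMap.isSelfAdjoint_iff'] at hQs
  have h1 (v : E4) : Q (stereoFrame x ((stereoFrame x).adjoint v)) = Q v := by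
    rw [stereoFrame_adjoint, hxy, map_sub, map_smul, hQy, smul_zero, sub_zero]
  have h2 (v : E4) : stereoFrame x ((stereoFrame x).adjoint (Q v)) = Q v := by
    rw [stereoFrame_adjoint, hxy]
    have : ⟪y, Q v⟫_ℝ = 0 := by
      rw [← ContinuousLinearMap.adjoint_inner_left, hQs, hQy, inner_zero_left]
    rw [this, zero_smul, sub_zero]
  have hlift : liftProj x P = Q := by
    ext1 v
    simp only [liftProj, hP, ContinuousLinearMap.comp_apply]
    rw [h2, h1]
  have hPP : IsPlaneProj P := by
    refine ⟨⟨?_, ?_⟩, ?_⟩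
    · change P * P = P
      ext1 v
      simp only [hP, mul_apply_eq_comp, ContinuousLinearMap.comp_apply, h1]
      exact congrArg (stereoFrame x).adjoint
        (congrArg (fun L : E4 →L[ℝ] E4 => L (stereoFrame x v)) hQ.1.isIdempotentElem.eq)
    · rw [ContinuousLinearMap.isSelfAdjoint_iff', hP]
      simp [ContinuousLinearMap.adjoint_comp, hQs, ContinuousLinearMap.comp_assoc]
    · have h3 := hQ.2
      have h0 := (stereoFactor_pos x).ne'
      rw [← hlift, range_liftProj] at h3
      rw [← h3]
      refine (Submodule.equivMapOfInjective _ (fun v w h => ?_) _).finrank_eq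
      rw [ContinuousLinearMap.coe_coe, fderiv_stereo_apply, fderiv_stereo_apply] at h
      exact stereoFrame_injective x (smul_right_injective _ h0 h)
  exact ⟨⟨(x, P), hPP⟩, Subtype.ext (Prod.ext hxy hlift), rfl⟩

theorem continuous_stereoFrame : Continuous stereoFrame := by
  have h1 : Continuous stereoFactor := by
    unfold stereoFactor
    exact continuous_const.div (by fun_prop) fun x => (one_add_normSq_pos x).ne'
  refine continuous_clm_apply.2 fun v => ?_
  simp only [stereoFrame_apply]
  fun_prop

/-- A continuous function on `G₂(ℝ³)` which tends to the constant `c` at infinity extends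
continuously to `G₂(S³)`. -/
theorem exists_extension {h : E3 → (E3 →L[ℝ] E3) → ℝ}
    (hc : Continuous fun q : E3 × (E3 →L[ℝ] E3) => h q.1 q.2) {c : ℝ}
    (hlim : ∀ ε > 0, ∃ R : ℝ, ∀ x P, IsPlaneProj P → R < ‖x‖ → |h x P - c| < ε) :
    ∃ D : C(GrS3, ℝ), (∀ q, D (grLift q) = h q.1.1 q.1.2) ∧
      ∀ q : GrS3, q.1.1 = northPole → D q = c := by
  classical
  let G : GrS3 → E3 × (E3 →L[ℝ] E3) := fun q => (stereoInv q.1.1,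
      (stereoFrame (stereoInv q.1.1)).adjoint ∘L q.1.2 ∘L stereoFrame (stereoInv q.1.1))
  let D : GrS3 → ℝ := fun q => if q.1.1 = northPole then c else h (G q).1 (G q).2
  have hfst : Continuous fun q : GrS3 => q.1.1 := continuous_fst.comp continuous_subtype_val
  have hsnd : Continuous fun q : GrS3 => q.1.2 := continuous_snd.comp continuous_subtype_val
  have hs : Continuous fun q : GrS3 => 1 - q.1.1.snd :=
    continuous_const.sub ((WithLp.continuous_snd _ _ _).comp hfst)
  have hD (q) : D (grLift q) = h q.1.1 q.1.2 := by
    have h1 : (grLift q).1.1 ≠ northPole := stereo_ne_northPole _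
    obtain ⟨p, hp, hpG⟩ := mem_range_grLift h1
    obtain rfl := injective_grLift hp
    simp only [D, if_neg h1]
    rw [hpG]
  refine ⟨⟨D, continuous_iff_continuousAt.2 fun q => ?_⟩, hD, fun q hq => if_pos hq⟩
  by_cases hq : q.1.1 = northPole
  · have h1 : D q = c := if_pos hq
    rw [ContinuousAt, h1, Metric.tendsto_nhds]
    intro ε hε
    obtain ⟨R, hR⟩ := hlim ε hε
    have h2 : ∀ᶠ p : GrS3 in 𝓝 q, 1 - p.1.1.snd < 2 / (1 + R ^ 2) := by
      refine hs.continuousAt.eventually_lt continuousAt_const ?_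
      have : q.1.1.snd = 1 := by rw [hq]; rfl
      rw [this, sub_self]
      positivity
    filter_upwards [h2] with p hp
    by_cases hpn : p.1.1 = northPole
    · have h3 : D p = c := if_pos hpn
      rwa [h3, dist_self]
    · obtain ⟨p', hp', hpG⟩ := mem_range_grLift hpn
      rw [← hp', hD, Real.dist_eq]
      refine hR _ _ p'.2 ?_
      rw [← stereoFactor_stereoInv p.2.1 hpn] at hp
      have h4 : p'.1.1 = stereoInv p.1.1 := by rw [hpG]
      rw [← h4, stereoFactor, div_lt_div_iff_of_pos_left two_pos (by positivity)
        (by positivity)] at hp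
      have h5 : R ^ 2 < ‖p'.1.1‖ ^ 2 := by linarith
      exact lt_of_pow_lt_pow_left₀ 2 (norm_nonneg _) h5
  · have h1 : ContinuousAt (fun q : GrS3 => stereoInv q.1.1) q :=
      (hs.continuousAt.inv₀ (snd_ne_one q.2.1 hq)).smul
        ((WithLp.continuous_fst _ _ _).comp hfst).continuousAt
    have h2 : ContinuousAt (fun q : GrS3 => stereoFrame (stereoInv q.1.1)) q :=
      ContinuousAt.comp (g := stereoFrame) (f := fun q : GrS3 => stereoInv q.1.1)
        continuous_stereoFrame.continuousAt h1
    have h3 : ContinuousAt (fun q : GrS3 => (stereoFrame (stereoInv q.1.1)).adjoint) q :=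
      ContinuousAt.comp (g := fun L : E3 →L[ℝ] E4 => L.adjoint)
        (f := fun q : GrS3 => stereoFrame (stereoInv q.1.1))
        ContinuousLinearMap.adjoint.continuous.continuousAt h2
    have h4 : ContinuousAt G q := h1.prodMk (h3.clm_comp (hsnd.continuousAt.clm_comp h2))
    have h5 : ContinuousAt (fun q => h (G q).1 (G q).2) q :=
      ContinuousAt.comp (g := fun q : E3 × (E3 →L[ℝ] E3) => h q.1 q.2) (f := G)
        hc.continuousAt h4
    refine h5.congr ?_
    have h6 : ∀ᶠ p : GrS3 in 𝓝 q, p.1.1 ≠ northPole := hfst.continuousAt.eventually_ne hq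
    filter_upwards [h6] with p hp
    exact (if_neg hp).symm

/-! ### Test fields -/

theorem gaussDivAt_smul {X : E3 → E3} (hX : ContDiff ℝ ∞ X) (c : ℝ) (x : E3) (P : E3 →L[ℝ] E3) :
    gaussDivAt (fun x => c • X x) x P = c * gaussDivAt X x P := by
  have h1 : fderiv ℝ (fun x => c • X x) x = c • fderiv ℝ X x :=
    fderiv_fun_const_smul (hX.differentiable (by simp) x) c
  rw [gaussDivAt, gaussDivAt, h1, ContinuousLinearMap.comp_smul, real_inner_smul_left]
  simp only [ContinuousLinearMap.toLinearMap_smul, map_smul, smul_eq_mul]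
  ring

theorem gaussDivAt_sum {ι : Type*} (s : Finset ι) {X : ι → E3 → E3}
    (hX : ∀ i ∈ s, ContDiff ℝ ∞ (X i)) (x : E3) (P : E3 →L[ℝ] E3) :
    gaussDivAt (fun x => ∑ i ∈ s, X i x) x P = ∑ i ∈ s, gaussDivAt (X i) x P := by
  have h1 : fderiv ℝ (fun x => ∑ i ∈ s, X i x) x = ∑ i ∈ s, fderiv ℝ (X i) x :=
    fderiv_fun_sum fun i hi => (hX i hi).differentiable (by simp) x
  have h2 : LinearMap.trace ℝ E3 (P ∘L ∑ i ∈ s, fderiv ℝ (X i) x).toLinearMap =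
      ∑ i ∈ s, LinearMap.trace ℝ E3 (P ∘L fderiv ℝ (X i) x).toLinearMap := by
    rw [ContinuousLinearMap.comp_finsetSum, ← map_sum]
    congr 1
    ext1 v
    simp
  simp only [gaussDivAt, h1, h2, sum_inner, Finset.sum_sub_distrib, Finset.sum_div]

theorem continuous_gaussDivAt {X : E3 → E3} (hX : ContDiff ℝ ∞ X) :
    Continuous fun q : E3 × (E3 →L[ℝ] E3) => gaussDivAt X q.1 q.2 := by
  have h1 : Continuous (fderiv ℝ X) := hX.continuous_fderiv (by simp)
  have h2 : Continuous fun q : E3 × (E3 →L[ℝ] E3) => q.2 ∘L fderiv ℝ X q.1 :=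
    continuous_snd.clm_comp (h1.comp continuous_fst)
  have h3 := hX.continuous
  unfold gaussDivAt
  exact (continuous_trace.comp h2).sub (((h3.comp continuous_fst).inner continuous_fst).div_const 2)

namespace IsControlled

theorem smul {X : E3 → E3} {N : ℝ} (hX : IsControlled X N) (c : ℝ) :
    IsControlled (fun x => c • X x) (|c| * N) := by
  refine ⟨hX.contDiff.const_smul c, fun x => ?_, fun x => ?_, fun x => ?_⟩
  · rw [norm_smul, Real.norm_eq_abs]
    exact mul_le_mul_of_nonneg_left (hX.norm_le x) (abs_nonneg c)
  · have h1 : fderiv ℝ (fun x => c • X x) x = c • fderiv ℝ X x :=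
      fderiv_fun_const_smul (hX.contDiff.differentiable (by simp) x) c
    rw [h1, norm_smul, Real.norm_eq_abs]
    exact mul_le_mul_of_nonneg_left (hX.norm_fderiv_le x) (abs_nonneg c)
  · rw [real_inner_smul_left, abs_mul]
    exact mul_le_mul_of_nonneg_left (hX.abs_inner_le x) (abs_nonneg c)

theorem sum {ι : Type*} (s : Finset ι) {X : ι → E3 → E3} {N : ι → ℝ}
    (hX : ∀ i ∈ s, IsControlled (X i) (N i)) :
    IsControlled (fun x => ∑ i ∈ s, X i x) (∑ i ∈ s, N i) := by
  refine ⟨ContDiff.sum fun i hi => (hX i hi).contDiff, fun x => ?_, fun x => ?_, fun x => ?_⟩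
  · exact norm_sum_le_of_le _ fun i hi => (hX i hi).norm_le x
  · rw [fderiv_fun_sum fun i hi => (hX i hi).contDiff.differentiable (by simp) x]
    exact norm_sum_le_of_le _ fun i hi => (hX i hi).norm_fderiv_le x
  · rw [sum_inner, ← Real.norm_eq_abs]
    exact norm_sum_le_of_le _ fun i hi => by
      rw [Real.norm_eq_abs]; exact (hX i hi).abs_inner_le x

end IsControlled

/-- The continuous functions on `G₂(S³)` which extend the Gaussian divergence of a field controlled
by `1`. -/
def testFunctions : Set C(GrS3, ℝ) :=
  {D | ∃ X, IsControlled X 1 ∧ ∀ q : GrR3, D (grLift q) = gaussDivAt X q.1.1 q.1.2}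

theorem testFunctions_nonempty : testFunctions.Nonempty := by
  refine ⟨0, fun _ => 0, ⟨contDiff_const, fun x => ?_, fun x => ?_, fun x => ?_⟩, fun q => ?_⟩
  · simp
  · simp
  · simp
  · simp [gaussDivAt]

/-- A multiple of every compactly supported field is a test field. -/
theorem exists_testFunction {X : E3 → E3} (hX : ContDiff ℝ ∞ X) (hc : HasCompactSupport X) :
    ∃ c > 0, ∃ D ∈ testFunctions, (∀ q : GrR3, D (grLift q) = c * gaussDivAt X q.1.1 q.1.2) ∧
      ∀ q : GrS3, q.1.1 = northPole → D q = 0 := by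
  obtain ⟨C₁, h1⟩ := hc.exists_bound_of_continuous hX.continuous
  obtain ⟨C₂, h2⟩ := (hc.fderiv ℝ).exists_bound_of_continuous (hX.continuous_fderiv (by simp))
  obtain ⟨R, hR⟩ := hc.isCompact.isBounded.subset_closedBall 0
  have hout {x : E3} (hx : R < ‖x‖) : x ∉ tsupport X := fun h => by
    have := hR h
    rw [mem_closedBall_zero_iff] at this
    linarith
  set N : ℝ := |C₁| + |C₂| + |C₁| * |R| with hN
  have hN0 : 0 ≤ |C₁| * |R| := by positivity
  have hXN : IsControlled X N := by
    refine ⟨hX, fun x => ?_, fun x => ?_, fun x => ?_⟩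
    · linarith [h1 x, le_abs_self C₁, abs_nonneg C₂]
    · linarith [h2 x, le_abs_self C₂, abs_nonneg C₁]
    · by_cases hx : R < ‖x‖
      · rw [image_eq_zero_of_notMem_tsupport (hout hx), inner_zero_left, abs_zero]
        positivity
      · have h3 := abs_real_inner_le_norm (X x) x
        have h4 : ‖X x‖ * ‖x‖ ≤ |C₁| * |R| :=
          mul_le_mul ((h1 x).trans (le_abs_self _)) ((not_lt.1 hx).trans (le_abs_self _))
            (norm_nonneg _) (abs_nonneg _)
        linarith [abs_nonneg C₁, abs_nonneg C₂]
  have hN1 : 0 < N + 1 := by linarith [hXN.nonneg]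
  obtain ⟨D, hD, hD0⟩ := exists_extension (continuous_gaussDivAt
    (X := fun x => (N + 1)⁻¹ • X x) (hX.const_smul _)) (c := 0) fun ε hε => by
      refine ⟨R, fun x P _ hx => ?_⟩
      rw [gaussDivAt_smul hX, sub_zero]
      have h3 : fderiv ℝ X x = 0 := by
        have := image_eq_zero_of_notMem_tsupport (f := fderiv ℝ X)
          (fun h => hout hx (tsupport_fderiv_subset ℝ h))
        exact this
      simp [gaussDivAt, h3, image_eq_zero_of_notMem_tsupport (hout hx), hε]
  refine ⟨(N + 1)⁻¹, by positivity, D, ⟨_, (hXN.smul (N + 1)⁻¹).mono ?_, hD⟩, fun q => ?_, hD0⟩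
  · rw [abs_of_pos (by positivity), inv_mul_le_one₀ hN1]
    linarith
  · rw [hD, gaussDivAt_smul hX]

/-- The field `x / (3 (R + |x|²))`. It decreases to zero as `R → ∞`, but its Gaussian divergence has
a nonzero limit at infinity. -/
noncomputable def radialField (R : ℝ) (x : E3) : E3 := (3 * (R + ‖x‖ ^ 2))⁻¹ • x

theorem contDiff_radialField {R : ℝ} (hR : 1 ≤ R) : ContDiff ℝ ∞ (radialField R) := by
  have h (x : E3) : 3 * (R + ‖x‖ ^ 2) ≠ 0 := by positivity
  exact ((contDiff_const.mul (contDiff_const.add (contDiff_norm_sq ℝ))).inv h).smul contDiff_id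

theorem norm_fderiv_radialField_le {R : ℝ} (hR : 1 ≤ R) (x : E3) :
    ‖fderiv ℝ (radialField R) x‖ ≤ (R + ‖x‖ ^ 2)⁻¹ := by
  have h0 : 0 < R + ‖x‖ ^ 2 := by positivity
  have h1 : HasFDerivAt (fun y : E3 => 3 * (R + ‖y‖ ^ 2)) ((3 : ℝ) • (2 • innerSL ℝ x)) x :=
    ((hasStrictFDerivAt_norm_sq x).hasFDerivAt.const_add R).const_mul 3
  have h2 := ((hasDerivAt_inv (by positivity : 3 * (R + ‖x‖ ^ 2) ≠ 0)).comp_hasFDerivAt x h1).smul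
    (hasFDerivAt_id x)
  have h3 : fderiv ℝ (radialField R) x = _ := h2.fderiv
  rw [h3]
  refine ContinuousLinearMap.opNorm_le_bound _ (by positivity) fun v => ?_
  have h4 : ‖(3 * (R + ‖x‖ ^ 2))⁻¹ • v‖ = (R + ‖x‖ ^ 2)⁻¹ / 3 * ‖v‖ := by
    rw [norm_smul, Real.norm_of_nonneg (by positivity), mul_inv]
    ring
  have h5 : ‖(2 * ⟪x, v⟫_ℝ * (3 * (R + ‖x‖ ^ 2) ^ 2)⁻¹) • x‖ ≤
      2 / 3 * (R + ‖x‖ ^ 2)⁻¹ * ‖v‖ := by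
    rw [norm_smul, Real.norm_eq_abs, abs_mul, abs_mul, abs_two,
      abs_of_pos (by positivity : 0 < (3 * (R + ‖x‖ ^ 2) ^ 2)⁻¹)]
    have h6 := abs_real_inner_le_norm x v
    calc _ ≤ 2 * (‖x‖ * ‖v‖) * (3 * (R + ‖x‖ ^ 2) ^ 2)⁻¹ * ‖x‖ := by gcongr
      _ = 2 / 3 * ‖x‖ ^ 2 * ((R + ‖x‖ ^ 2)⁻¹) ^ 2 * ‖v‖ := by field_simp
      _ ≤ 2 / 3 * (R + ‖x‖ ^ 2) * ((R + ‖x‖ ^ 2)⁻¹) ^ 2 * ‖v‖ := by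
        gcongr
        linarith
      _ = _ := by field_simp
  have h7 := norm_sub_le ((3 * (R + ‖x‖ ^ 2))⁻¹ • v)
    ((2 * ⟪x, v⟫_ℝ * (3 * (R + ‖x‖ ^ 2) ^ 2)⁻¹) • x)
  refine Eq.trans_le (congrArg norm ?_) (h7.trans (by rw [h4]; linarith))
  simp
  rw [← sub_eq_add_neg]
  congr 2
  field_simp

theorem inner_radialField {R : ℝ} (x : E3) :
    ⟪radialField R x, x⟫_ℝ = ‖x‖ ^ 2 / (3 * (R + ‖x‖ ^ 2)) := by
  rw [radialField, real_inner_smul_left, real_inner_self_eq_norm_sq, inv_mul_eq_div]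

theorem isControlled_radialField {R : ℝ} (hR : 1 ≤ R) : IsControlled (radialField R) 1 := by
  refine ⟨contDiff_radialField hR, fun x => ?_, fun x => ?_, fun x => ?_⟩
  · have h0 : 0 < R + ‖x‖ ^ 2 := by positivity
    rw [radialField, norm_smul, Real.norm_of_nonneg (by positivity), inv_mul_le_one₀ (by positivity)]
    nlinarith [sq_nonneg (‖x‖ - 1)]
  · refine (norm_fderiv_radialField_le hR x).trans (inv_le_one_of_one_le₀ ?_)
    nlinarith [sq_nonneg ‖x‖]
  · have h0 : 0 < R + ‖x‖ ^ 2 := by positivity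
    rw [inner_radialField, abs_of_nonneg (by positivity), div_le_one (by positivity)]
    linarith

theorem abs_gaussDivAt_radialField {R : ℝ} (hR : 1 ≤ R) (x : E3) {P : E3 →L[ℝ] E3}
    (hP : IsPlaneProj P) :
    |gaussDivAt (radialField R) x P + ‖x‖ ^ 2 / (6 * (R + ‖x‖ ^ 2))| ≤ 2 * (R + ‖x‖ ^ 2)⁻¹ := by
  have h1 := hP.abs_trace_comp_le (fderiv ℝ (radialField R) x)
  have h2 := norm_fderiv_radialField_le hR x
  have h3 : ‖x‖ ^ 2 / (6 * (R + ‖x‖ ^ 2)) = ‖x‖ ^ 2 / (3 * (R + ‖x‖ ^ 2)) / 2 := by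
    rw [div_div]; ring_nf
  rw [gaussDivAt, inner_radialField, h3, sub_add_cancel]
  linarith

/-- The radial fields are test fields; the Gaussian divergence tends to `-1/6` at infinity. -/
theorem exists_testFunction_radial {R : ℝ} (hR : 1 ≤ R) : ∃ D ∈ testFunctions,
    (∀ q : GrR3, D (grLift q) = gaussDivAt (radialField R) q.1.1 q.1.2) ∧
      ∀ q : GrS3, q.1.1 = northPole → D q = -1 / 6 := by
  obtain ⟨D, hD, hD0⟩ := exists_extension (continuous_gaussDivAt (contDiff_radialField hR))
    (c := -1 / 6) fun ε hε => by
      refine ⟨(R + 2) / ε + 1, fun x P hP hx => ?_⟩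
      have h1 := abs_gaussDivAt_radialField hR x hP
      have h0 : 0 < R + ‖x‖ ^ 2 := by positivity
      have h2 : gaussDivAt (radialField R) x P - -1 / 6 =
          (gaussDivAt (radialField R) x P + ‖x‖ ^ 2 / (6 * (R + ‖x‖ ^ 2))) +
            R / 6 * (R + ‖x‖ ^ 2)⁻¹ := by
        field_simp
        ring
      have h3 : 0 ≤ R / 6 * (R + ‖x‖ ^ 2)⁻¹ := by positivity
      rw [h2]
      refine (abs_add_le _ _).trans_lt ?_
      rw [abs_of_nonneg h3]
      have h4 : (R + 2) * (R + ‖x‖ ^ 2)⁻¹ < ε := by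
        rw [← div_eq_mul_inv, div_lt_comm₀ h0 hε]
        have h5 : 0 < (R + 2) / ε := by positivity
        nlinarith
      have h6 : 0 < (R + ‖x‖ ^ 2)⁻¹ := by positivity
      nlinarith
  exact ⟨D, ⟨_, isControlled_radialField hR, hD⟩, hD, hD0⟩

theorem range_grLift : range grLift = {q : GrS3 | q.1.1 ≠ northPole} := by
  ext q
  refine ⟨?_, fun h => ?_⟩
  · rintro ⟨p, rfl⟩
    exact stereo_ne_northPole _
  · obtain ⟨p, hp, -⟩ := mem_range_grLift h
    exact ⟨p, hp⟩

/-- A varifold on `S³` that annihilates the test functions is `F`-stationary and has no mass at the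
north pole. -/
theorem isFStationary_of_testFunctions {V : Measure GrS3} [IsFiniteMeasure V]
    (hV : ∀ D ∈ testFunctions, ∫ q, D q ∂V = 0) : IsFStationary V ∧ mass V {northPole} = 0 := by
  constructor
  · intro X hX hXc
    obtain ⟨c, hc, D, hD, hDc, hD0⟩ := exists_testFunction hX hXc
    have h1 : ∫ q, D q ∂V = ∫ q, c * gaussDiv X q ∂(V.comap grLift) := by
      rw [← setIntegral_eq_integral_of_forall_compl_eq_zero (s := range grLift),
        ← measurableEmbedding_grLift.map_comap, measurableEmbedding_grLift.integral_map]
      · exact integral_congr_ae (Eventually.of_forall fun q => hDc q)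
      · intro q hq
        rw [range_grLift] at hq
        exact hD0 q (not_not.1 hq)
    rw [hV D hD, integral_const_mul, eq_comm, mul_eq_zero] at h1
    exact h1.resolve_left hc.ne'
  · choose D hD hDg hD0 using fun m : ℕ =>
      exists_testFunction_radial (R := (m : ℝ) + 1) (by simp)
    set A : Set GrS3 := {q | q.1.1 = northPole} with hA
    have hAm : MeasurableSet A :=
      (isClosed_eq (continuous_fst.comp continuous_subtype_val) continuous_const).measurableSet
    -- The test functions of the radial fields converge boundedly to `-1/6` times the indicator
    -- function of the fibre over the north pole.
    have h1 : Tendsto (fun m => ∫ q, D m q ∂V) atTop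
        (𝓝 (∫ q, A.indicator (fun _ => (-1 / 6 : ℝ)) q ∂V)) := by
      refine tendsto_integral_of_dominated_convergence (fun _ => 3)
        (fun m => (D m).continuous.aestronglyMeasurable) (integrable_const _)
        (fun m => Eventually.of_forall fun q => ?_) (Eventually.of_forall fun q => ?_)
      · by_cases hq : q ∈ A
        · rw [hD0 m q hq]; norm_num
        · obtain ⟨p, rfl, -⟩ := mem_range_grLift (q := q) hq
          rw [hDg, Real.norm_eq_abs]
          simpa using (isControlled_radialField (R := (m : ℝ) + 1)
            (by simp)).abs_gaussDivAt_le p.1.1 p.2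
      · by_cases hq : q ∈ A
        · rw [indicator_of_mem hq]
          exact tendsto_const_nhds.congr fun m => (hD0 m q hq).symm
        · rw [indicator_of_notMem hq]
          obtain ⟨p, rfl, -⟩ := mem_range_grLift (q := q) hq
          simp only [hDg]
          refine squeeze_zero_norm (a := fun m : ℕ => (2 + ‖p.1.1‖ ^ 2) * (1 / ((m : ℝ) + 1)))
            (fun m => ?_) (by simpa using
              (tendsto_one_div_add_atTop_nhds_zero_nat (𝕜 := ℝ)).const_mul (2 + ‖p.1.1‖ ^ 2))
          have h2 := abs_gaussDivAt_radialField (R := (m : ℝ) + 1) (by simp) p.1.1 p.2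
          set r := ‖p.1.1‖ ^ 2 with hr
          have hr0 : 0 ≤ r := by positivity
          have h3 : ((m : ℝ) + 1 + r)⁻¹ ≤ 1 / ((m : ℝ) + 1) := by
            rw [one_div]
            exact inv_anti₀ (by positivity) (by linarith)
          have h4 : r / (6 * ((m : ℝ) + 1 + r)) ≤ r * (1 / ((m : ℝ) + 1)) := by
            rw [div_eq_mul_inv, mul_inv]
            have : 0 ≤ ((m : ℝ) + 1 + r)⁻¹ := by positivity
            refine mul_le_mul_of_nonneg_left ?_ hr0
            linarith
          have h5 : 0 ≤ r / (6 * ((m : ℝ) + 1 + r)) := by positivity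
          rw [Real.norm_eq_abs]
          rw [abs_le] at h2 ⊢
          constructor <;> linarith
    simp only [hV _ (hD _)] at h1
    have h2 := tendsto_nhds_unique h1 tendsto_const_nhds
    rw [integral_indicator_const _ hAm, smul_eq_mul] at h2
    have h3 : V.real A = 0 := by linarith
    rw [measureReal_eq_zero_iff] at h3
    exact h3

/-! ### The first variation of the Gaussian area -/

/-- The first variation `∫ (div X - ⟨X, x⟩ / 2)` of the Gaussian area of a surface. -/
noncomputable def areaVariation (S : Set E3) (X : E3 → E3) : ℝ :=
  ∫ x, gaussDivAt X x (tangentProj S x) ∂gaussMeasure S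

namespace IsControlled

variable {X : E3 → E3} {N : ℝ} {S : Set E3}

theorem integrable_gaussDivAt (hX : IsControlled X N) (hS : IsSurface S) (hF : gaussArea S < ⊤) :
    Integrable (fun x => gaussDivAt X x (tangentProj S x)) (gaussMeasure S) :=
  hS.integrable hF (continuous_gaussDivAt hX.contDiff) fun x _ hP => hX.abs_gaussDivAt_le x hP

theorem integrable_areaRatio (hX : IsControlled X N) (hN : N ≤ 1 / 2) (hS : IsSurface S)
    (hF : gaussArea S < ⊤) :
    Integrable (fun x => areaRatio X x (tangentProj S x)) (gaussMeasure S) :=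
  hS.integrable hF hX.continuous_areaRatio (C := 1 + 5 * N) fun x _ hP => by
    rw [abs_of_nonneg (areaRatio_nonneg _ _ _)]
    exact hX.areaRatio_le_one_add hN x hP

theorem abs_areaVariation_le (hX : IsControlled X N) (hS : IsSurface S) (hF : gaussArea S < ⊤) :
    |areaVariation S X| ≤ 3 * N * (gaussArea S).toReal := by
  have := isFiniteMeasure_gaussMeasure hF
  have h := norm_integral_le_of_norm_le_const (μ := gaussMeasure S) (C := 3 * N)
    (f := fun x => gaussDivAt X x (tangentProj S x)) (by
      filter_upwards [ae_gaussMeasure hS] with x hx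
      exact hX.abs_gaussDivAt_le x (hS.isPlaneProj hx))
  rwa [gaussMeasure_real_univ] at h

/-- The Gaussian area of a perturbed surface is bounded by its first order expansion. -/
theorem toReal_gaussArea_image_le (hX : IsControlled X N) (hN : N ≤ 1 / 2) (hS : IsSurface S)
    (hF : gaussArea S < ⊤) : (gaussArea ((fun x => x + X x) '' S)).toReal ≤
      (gaussArea S).toReal + areaVariation S X + 4 * N ^ 2 * (gaussArea S).toReal := by
  have := isFiniteMeasure_gaussMeasure hF
  have h1 := hX.integrable_gaussDivAt hS hF
  have h0 : Integrable (fun x => 1 + gaussDivAt X x (tangentProj S x)) (gaussMeasure S) :=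
    (integrable_const _).add h1
  have h2 : ∫ x, (1 + gaussDivAt X x (tangentProj S x) + 4 * N ^ 2) ∂gaussMeasure S =
      (gaussArea S).toReal + areaVariation S X + 4 * N ^ 2 * (gaussArea S).toReal := by
    rw [integral_add h0 (integrable_const _),
      integral_add (integrable_const _) h1, integral_const, integral_const,
      gaussMeasure_real_univ, areaVariation]
    simp [mul_comm]
  rw [hX.toReal_gaussArea_image hN hS, ← h2]
  refine integral_mono_ae (hX.integrable_areaRatio hN hS hF)
    (h0.add (integrable_const _)) ?_
  filter_upwards [ae_gaussMeasure hS] with x hx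
  exact hX.areaRatio_le hN x (hS.isPlaneProj hx)

end IsControlled

theorem areaVariation_sum {ι : Type*} (s : Finset ι) (r : ι → ℝ) {X : ι → E3 → E3} {N : ι → ℝ}
    {S : Set E3} (hX : ∀ i, IsControlled (X i) (N i)) (hS : IsSurface S) (hF : gaussArea S < ⊤) :
    areaVariation S (fun x => ∑ i ∈ s, r i • X i x) = ∑ i ∈ s, r i * areaVariation S (X i) := by
  unfold areaVariation
  have h1 : ∀ x, gaussDivAt (fun x => ∑ i ∈ s, r i • X i x) x (tangentProj S x) =
      ∑ i ∈ s, r i * gaussDivAt (X i) x (tangentProj S x) := fun x => by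
    rw [gaussDivAt_sum s (X := fun i x => r i • X i x) fun i _ => ((hX i).smul (r i)).contDiff]
    exact Finset.sum_congr rfl fun i _ => gaussDivAt_smul (hX i).contDiff (r i) x _
  simp only [h1]
  rw [integral_finsetSum _ fun i _ => ((hX i).integrable_gaussDivAt hS hF).const_mul (r i)]
  exact Finset.sum_congr rfl fun i _ => integral_const_mul _ _

theorem IsContinuousFamily.continuous_areaVariation {n g : ℕ} {S : Cube n → Set E3}
    (hS : IsContinuousFamily g S) {X : E3 → E3} {N : ℝ} (hX : IsControlled X N) :
    Continuous fun ν => areaVariation (S ν) X :=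
  hS.smooth.continuous_integral hS.gaussArea_lt_top hS.continuous_area
    (h := fun _ x P => gaussDivAt X x P)
    ((continuous_gaussDivAt hX.contDiff).comp continuous_snd)
    fun _ x _ hP => hX.abs_gaussDivAt_le x hP

/-! ### One step of descent -/

/-- The weights `2⁻¹, 2⁻², …` of the test fields. -/
noncomputable def fieldWeight (i : ℕ) : ℝ := (1 / 2) ^ (i + 1)

theorem fieldWeight_pos (i : ℕ) : 0 < fieldWeight i := by unfold fieldWeight; positivity

theorem sum_fieldWeight_le (k : ℕ) : ∑ i ∈ Finset.range k, fieldWeight i ≤ 1 := by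
  have h : ∑ i ∈ Finset.range k, fieldWeight i = 1 - (1 / 2) ^ k := by
    induction k with
    | zero => simp
    | succ k ih => rw [Finset.sum_range_succ, ih, fieldWeight]; ring
  rw [h]
  have : (0 : ℝ) ≤ (1 / 2) ^ k := by positivity
  linarith

/-- A continuous cutoff, `0` for `s ≤ w₀` and `1` for `w₁ ≤ s`. -/
noncomputable def ramp (w₀ w₁ s : ℝ) : ℝ := max 0 (min 1 ((s - w₀) / (w₁ - w₀)))

theorem continuous_ramp (w₀ w₁ : ℝ) : Continuous (ramp w₀ w₁) := by
  unfold ramp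
  fun_prop

theorem ramp_nonneg (w₀ w₁ s : ℝ) : 0 ≤ ramp w₀ w₁ s := le_max_left _ _

theorem ramp_le_one (w₀ w₁ s : ℝ) : ramp w₀ w₁ s ≤ 1 := max_le zero_le_one (min_le_left _ _)

theorem ramp_eq_zero {w₀ w₁ s : ℝ} (hw : w₀ < w₁) (h : s ≤ w₀) : ramp w₀ w₁ s = 0 :=
  max_eq_left ((min_le_right _ _).trans (div_nonpos_of_nonpos_of_nonneg (by linarith)
    (by linarith)))

theorem ramp_self {w₀ w₁ : ℝ} (hw : w₀ < w₁) : ramp w₀ w₁ w₁ = 1 := by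
  rw [ramp, div_self (by linarith), min_self, max_eq_right zero_le_one]

/-- The squared sizes of the first variations in the first `k` directions, summed with weights. -/
noncomputable def gradientSq (S : Set E3) (X : ℕ → E3 → E3) (k : ℕ) : ℝ :=
  ∑ i ∈ Finset.range k, fieldWeight i * areaVariation S (X i) ^ 2

theorem gradientSq_nonneg (S : Set E3) (X : ℕ → E3 → E3) (k : ℕ) : 0 ≤ gradientSq S X k :=
  Finset.sum_nonneg fun i _ => mul_nonneg (fieldWeight_pos i).le (sq_nonneg _)

/-- The elementary estimate behind the descent: moving with coefficients `a i ≈ χ δ i` against the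
gradient decreases the area to first order by `χ ∑ c i (δ i)²`. -/
theorem descent_estimate (k : ℕ) {a δ : ℕ → ℝ} {χ η A : ℝ} (hχ0 : 0 ≤ χ)
    (hχ1 : χ ≤ 1) (hδ : ∀ i, |δ i| ≤ A) (ha : ∀ i, |a i - χ * δ i| ≤ η) :
    χ * ∑ i ∈ Finset.range k, fieldWeight i * δ i ^ 2 - η * A ≤
      ∑ i ∈ Finset.range k, fieldWeight i * (a i * δ i) ∧
    (∑ i ∈ Finset.range k, fieldWeight i * |a i|) ^ 2 ≤
      2 * χ * ∑ i ∈ Finset.range k, fieldWeight i * δ i ^ 2 + 2 * η ^ 2 := by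
  have hc := sum_fieldWeight_le k
  have hc0 : 0 ≤ ∑ i ∈ Finset.range k, fieldWeight i :=
    Finset.sum_nonneg fun i _ => (fieldWeight_pos i).le
  have hη : 0 ≤ η := (abs_nonneg _).trans (ha 0)
  have hA : 0 ≤ A := (abs_nonneg _).trans (hδ 0)
  constructor
  · have h1 : ∀ i ∈ Finset.range k, fieldWeight i * (χ * δ i ^ 2) - fieldWeight i * (η * A) ≤
        fieldWeight i * (a i * δ i) := fun i _ => by
      rw [← mul_sub]
      refine mul_le_mul_of_nonneg_left ?_ (fieldWeight_pos i).le
      have h2 := mul_le_mul (ha i) (hδ i) (abs_nonneg _) hη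
      rw [← abs_mul] at h2
      have h3 := (abs_le.1 h2).1
      nlinarith
    have h4 := Finset.sum_le_sum h1
    rw [Finset.sum_sub_distrib, ← Finset.sum_mul] at h4
    have h5 : ∑ i ∈ Finset.range k, fieldWeight i * (χ * δ i ^ 2) =
        χ * ∑ i ∈ Finset.range k, fieldWeight i * δ i ^ 2 := by
      rw [Finset.mul_sum]
      exact Finset.sum_congr rfl fun i _ => by ring
    have h6 := mul_le_mul_of_nonneg_right hc (mul_nonneg hη hA)
    linarith
  · have h1 := Finset.sum_sq_le_sum_mul_sum_of_sq_le_mul (Finset.range k)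
      (r := fun i => fieldWeight i * |a i|) (f := fieldWeight)
      (g := fun i => fieldWeight i * a i ^ 2) (fun i _ => (fieldWeight_pos i).le)
      (fun i _ => mul_nonneg (fieldWeight_pos i).le (sq_nonneg _))
      (fun i _ => le_of_eq (by rw [mul_pow, sq_abs]; ring))
    have h2 : ∀ i ∈ Finset.range k, fieldWeight i * a i ^ 2 ≤
        fieldWeight i * (2 * χ * δ i ^ 2) + fieldWeight i * (2 * η ^ 2) := fun i _ => by
      rw [← mul_add]
      refine mul_le_mul_of_nonneg_left ?_ (fieldWeight_pos i).le
      have h3 : (a i - χ * δ i) ^ 2 ≤ η ^ 2 := sq_le_sq' (abs_le.1 (ha i)).1 (abs_le.1 (ha i)).2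
      have h4 : χ ^ 2 * δ i ^ 2 ≤ χ * δ i ^ 2 :=
        mul_le_mul_of_nonneg_right (by nlinarith) (sq_nonneg _)
      nlinarith [sq_nonneg (a i - 2 * χ * δ i)]
    have h5 := Finset.sum_le_sum h2
    rw [Finset.sum_add_distrib, ← Finset.sum_mul] at h5
    have h6 : ∑ i ∈ Finset.range k, fieldWeight i * (2 * χ * δ i ^ 2) =
        2 * χ * ∑ i ∈ Finset.range k, fieldWeight i * δ i ^ 2 := by
      rw [Finset.mul_sum]
      exact Finset.sum_congr rfl fun i _ => by ring
    have h7 := mul_le_mul_of_nonneg_right hc (by positivity : 0 ≤ 2 * η ^ 2)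
    have h8 : 0 ≤ ∑ i ∈ Finset.range k, fieldWeight i * a i ^ 2 :=
      Finset.sum_nonneg fun i _ => mul_nonneg (fieldWeight_pos i).le (sq_nonneg _)
    have h9 := mul_le_mul_of_nonneg_right hc h8
    linarith

/-- The retraction of `ℝⁿ` onto the cube. -/
noncomputable def clampCube {n : ℕ} (ν : Fin n → ℝ) : Cube n :=
  ⟨fun i => max 0 (min 1 (ν i)), fun _ => le_max_left _ _,
    fun _ => max_le zero_le_one (min_le_left _ _)⟩

theorem continuous_clampCube {n : ℕ} : Continuous (clampCube (n := n)) := by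
  refine Continuous.subtype_mk (continuous_pi fun i => ?_) _
  fun_prop

theorem clampCube_coe {n : ℕ} (ν : Cube n) : clampCube (ν : Fin n → ℝ) = ν := by
  refine Subtype.ext (funext fun i => ?_)
  have h1 := ν.2.1 i
  have h2 := ν.2.2 i
  simp only [Pi.zero_apply, Pi.one_apply] at h1 h2
  simp [clampCube, h1, h2]

/-- One step of descent. A family of surfaces is moved against the gradient of the Gaussian area
along finitely many controlled fields; the coefficients are smooth functions of the parameter,
uniformly close to the first variations, and are cut off where the area is at most `w₀`. -/
theorem IsContinuousFamily.exists_descent {n g : ℕ} {S : Cube n → Set E3}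
    (hS : IsContinuousFamily g S) {M w₀ w₁ : ℝ} (hM0 : 0 ≤ M) (hw : w₀ < w₁)
    (hM : ∀ ν, (gaussArea (S ν)).toReal ≤ M)
    (hb : ∀ ν ∈ cubeBoundary n, (gaussArea (S ν)).toReal < w₀) {X : ℕ → E3 → E3}
    (hX : ∀ i, IsControlled (X i) 1) (k : ℕ) {η : ℝ} (hη : 0 < η) (hη1 : η ≤ 1) :
    ∃ Y : (Fin n → ℝ) × E3 → E3, IsControlledFamily Y ∧ ∀ ν : Cube n, ∃ N ≤ 1 / 2,
      IsControlled (fun x => Y (ν, x)) N ∧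
      N ^ 2 ≤ 2 * (ramp w₀ w₁ (gaussArea (S ν)).toReal * gradientSq (S ν) X k) + 2 * η ^ 2 ∧
      (gaussArea ((fun x => x + Y (ν, x)) '' S ν)).toReal + 1 / (32 * (M + 1)) *
        (ramp w₀ w₁ (gaussArea (S ν)).toReal * gradientSq (S ν) X k) ≤
        (gaussArea (S ν)).toReal + 2 * η := by
  set F : Cube n → ℝ := fun ν => (gaussArea (S ν)).toReal with hF
  have hFc : Continuous F := continuous_iff_continuousAt.2 fun ν =>
    (ENNReal.tendsto_toReal (hS.gaussArea_lt_top ν).ne).comp hS.continuous_area.continuousAt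
  set δ : Cube n → ℕ → ℝ := fun ν i => areaVariation (S ν) (X i) with hδ
  have hδc (i) : Continuous fun ν => δ ν i := hS.continuous_areaVariation (hX i)
  have hδM (ν i) : |δ ν i| ≤ 3 * M := by
    have h1 := (hX i).abs_areaVariation_le (hS.smooth.isSurface ν) (hS.gaussArea_lt_top ν)
    have h2 := hM ν
    linarith
  -- The desired coefficients, extended from the cube to `ℝⁿ` by the retraction.
  set b : ℕ → (Fin n → ℝ) → ℝ := fun i ν => ramp w₀ w₁ (F (clampCube ν)) * δ (clampCube ν) i
  have hbc (i) : Continuous (b i) :=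
    (((continuous_ramp w₀ w₁).comp hFc).mul (hδc i)).comp continuous_clampCube
  have hbM (i ν) : |b i ν| ≤ 3 * M := by
    rw [abs_mul, abs_of_nonneg (ramp_nonneg _ _ _)]
    exact (mul_le_of_le_one_left (abs_nonneg _) (ramp_le_one _ _ _)).trans (hδM _ _)
  -- Smooth approximations of the coefficients that vanish wherever the coefficients do.
  choose a ha hab hasupp using fun i => (hbc i).exists_contDiff_approx ⊤
    (ε := fun _ => η) continuous_const fun _ => hη
  have hab' (i ν) : |a i ν - b i ν| ≤ η := by
    rw [← Real.dist_eq]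
    exact (hab i ν).le
  -- The step size. Since the coefficients are at most `3 M + 1`, it keeps the field controlled by
  -- `1/2`, and since the areas are at most `M`, the second order term of the expansion of the area
  -- is at most half of the first order gain.
  set t : ℝ := 1 / (16 * (M + 1)) with ht
  have ht0 : 0 < t := by positivity
  have htM : t * (16 * (M + 1)) = 1 := by rw [ht]; field_simp
  set N : (Fin n → ℝ) → ℝ := fun ν => ∑ i ∈ Finset.range k, |-t * fieldWeight i * a i ν| * 1 with hN
  have hNeq (ν) : N ν = t * ∑ i ∈ Finset.range k, fieldWeight i * |a i ν| := by
    rw [hN, Finset.mul_sum]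
    refine Finset.sum_congr rfl fun i _ => ?_
    rw [mul_one, abs_mul, abs_mul, abs_neg, abs_of_pos ht0, abs_of_pos (fieldWeight_pos i), mul_assoc]
  have hNle (ν) : N ν ≤ 1 / 2 := by
    have h1 : ∑ i ∈ Finset.range k, fieldWeight i * |a i ν| ≤ 3 * M + 1 := by
      have h2 : ∀ i ∈ Finset.range k, fieldWeight i * |a i ν| ≤ fieldWeight i * (3 * M + 1) := by
        intro i _
        refine mul_le_mul_of_nonneg_left ?_ (fieldWeight_pos i).le
        have h3 := abs_sub_abs_le_abs_sub (a i ν) (b i ν)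
        linarith [hab' i ν, hbM i ν]
      refine (Finset.sum_le_sum h2).trans ?_
      rw [← Finset.sum_mul]
      exact mul_le_of_le_one_left (by positivity) (sum_fieldWeight_le k)
    rw [hNeq]
    nlinarith
  set Y : (Fin n → ℝ) × E3 → E3 := fun q =>
    ∑ i ∈ Finset.range k, (-t * fieldWeight i * a i q.1) • X i q.2 with hY
  have hYN (ν : Fin n → ℝ) : IsControlled (fun x => Y (ν, x)) (N ν) :=
    IsControlled.sum _ fun i _ => (hX i).smul (-t * fieldWeight i * a i ν)
  -- The field vanishes for parameters outside the compact set where the area is at least `w₀`.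
  refine ⟨Y, ⟨?_, fun ν => (hYN ν).mono (hNle ν), {ν | w₀ ≤ F ν}, ?_, ?_, ?_⟩, fun ν => ?_⟩
  · refine ContDiff.sum fun i _ => ?_
    have h1 : ContDiff ℝ ∞ fun q : (Fin n → ℝ) × E3 => -t * fieldWeight i * a i q.1 :=
      contDiff_const.mul ((ha i).comp contDiff_fst)
    have h2 : ContDiff ℝ ∞ fun q : (Fin n → ℝ) × E3 => X i q.2 :=
      (hX i).contDiff.comp contDiff_snd
    exact h1.smul h2
  · exact (isClosed_le continuous_const hFc).isCompact
  · intro ν hν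
    by_contra h
    exact absurd (hb ν h) (not_lt.2 hν)
  · intro ν hν x
    refine Finset.sum_eq_zero fun i _ => ?_
    have h1 : b i ν = 0 := by
      have h2 : F ν < w₀ := not_le.1 hν
      simp only [b]
      rw [clampCube_coe, ramp_eq_zero hw h2.le, zero_mul]
    have h2 : a i ν = 0 := by
      by_contra h3
      exact hasupp i (Function.mem_support.2 h3) h1
    rw [h2, mul_zero, zero_smul]
  · have hsurf := hS.smooth.isSurface ν
    have hfin := hS.gaussArea_lt_top ν
    obtain ⟨h1, h2⟩ := descent_estimate k (a := fun i => a i ν) (δ := δ ν)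
      (ramp_nonneg w₀ w₁ (F ν)) (ramp_le_one w₀ w₁ (F ν)) (hδM ν) (η := η) fun i => by
        have := hab' i ν
        simp only [b] at this
        rwa [clampCube_coe] at this
    have hG : gradientSq (S ν) X k = ∑ i ∈ Finset.range k, fieldWeight i * δ ν i ^ 2 := rfl
    have hG0 := gradientSq_nonneg (S ν) X k
    rw [← hG] at h1 h2
    have hr0 := ramp_nonneg w₀ w₁ (F ν)
    set G := gradientSq (S ν) X k
    set χ := ramp w₀ w₁ (F ν)
    set A := ∑ i ∈ Finset.range k, fieldWeight i * |a i ν|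
    have hN2 : N ν ^ 2 = t ^ 2 * A ^ 2 := by rw [hNeq, mul_pow]
    have ht1 : t ≤ 1 / 16 := by nlinarith
    have ht2 : t ^ 2 ≤ 1 := by nlinarith
    refine ⟨N ν, hNle ν, hYN ν, ?_, ?_⟩
    · rw [hN2]
      refine (mul_le_of_le_one_left (sq_nonneg A) ht2).trans ?_
      linarith
    · have h3 := (hYN ν).toReal_gaussArea_image_le (hNle ν) hsurf hfin
      have h4 : areaVariation (S ν) (fun x => Y (ν, x)) =
          -t * ∑ i ∈ Finset.range k, fieldWeight i * (a i ν * δ ν i) := by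
        have h5 := areaVariation_sum (Finset.range k) (fun i => -t * fieldWeight i * a i ν) hX
          hsurf hfin
        refine h5.trans ?_
        rw [Finset.mul_sum]
        exact Finset.sum_congr rfl fun i _ => by ring
      rw [h4, hN2] at h3
      have h5 : 1 / (32 * (M + 1)) = t / 2 := by rw [ht]; field_simp; norm_num
      have h6 : 4 * (t ^ 2 * A ^ 2) * F ν ≤ t / 4 * A ^ 2 := by
        have h7 : F ν ≤ M := hM ν
        have h8 : t * F ν ≤ 1 / 16 := by nlinarith
        have h9 := mul_le_mul_of_nonneg_right h8 (by positivity : 0 ≤ 4 * t * A ^ 2)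
        linarith
      have h7 : t / 4 * A ^ 2 ≤ t / 4 * (2 * χ * G + 2 * η ^ 2) :=
        mul_le_mul_of_nonneg_left h2 (by positivity)
      have h8 := mul_le_mul_of_nonneg_left h1 ht0.le
      have h9 : t * (η * (3 * M)) ≤ η := by nlinarith
      have h10 : t / 4 * (2 * η ^ 2) ≤ η := by nlinarith
      rw [h5]
      linarith

/-! ### Weak convergence of varifolds on `S³` -/

/-- Weak sequential compactness of measures with convergent total masses on a compact space. The
measures are normalized; the limit `W = 0` is included, since multiplying by `W` undoes this. -/
theorem exists_subseq_tendsto_integral {Ω : Type*} [MetricSpace Ω] [CompactSpace Ω]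
    [MeasurableSpace Ω] [BorelSpace Ω] [Nonempty Ω] {μ : ℕ → Measure Ω}
    [∀ k, IsFiniteMeasure (μ k)] {W : ℝ≥0∞} (hW : W ≠ ⊤)
    (h : Tendsto (fun k => μ k univ) atTop (𝓝 W)) :
    ∃ b : ℕ → ℕ, StrictMono b ∧ ∃ V : Measure Ω, IsFiniteMeasure V ∧ V univ = W ∧
      ∀ f : C(Ω, ℝ), Tendsto (fun k => ∫ q, f q ∂μ (b k)) atTop (𝓝 (∫ q, f q ∂V)) := by
  let ρ : ℕ → ProbabilityMeasure Ω := fun k =>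
    FiniteMeasure.normalize (⟨μ k, inferInstance⟩ : FiniteMeasure Ω)
  obtain ⟨π, b, hb, hπ⟩ := CompactSpace.tendsto_subseq ρ
  refine ⟨b, hb, W • (π : Measure Ω), ⟨?_⟩, ?_, fun f => ?_⟩
  · simpa using hW.lt_top
  · simp
  · have h1 (k : ℕ) : ∫ q, f q ∂μ k = (μ k univ).toReal * ∫ q, f q ∂(ρ k : Measure Ω) := by
      have h2 := FiniteMeasure.self_eq_mass_smul_normalize
        (⟨μ k, inferInstance⟩ : FiniteMeasure Ω)
      have h3 : μ k = (μ k univ) • (ρ k : Measure Ω) := by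
        have h4 := congrArg (fun m : FiniteMeasure Ω => (m : Measure Ω)) h2
        ext s hs
        have h5 := congrArg (fun m : Measure Ω => m s) h4
        rw [Measure.smul_apply]
        refine Eq.trans h5 ?_
        rw [FiniteMeasure.toMeasure_smul, Measure.smul_apply]
        change ((μ k univ).toNNReal : ℝ≥0∞) * _ = _
        rw [ENNReal.coe_toNNReal (measure_ne_top _ _)]
        rfl
      conv_lhs => rw [h3]
      rw [integral_smul_measure, smul_eq_mul]
    rw [integral_smul_measure, smul_eq_mul]
    simp only [h1]
    have h2 := ProbabilityMeasure.tendsto_iff_forall_integral_tendsto.1 hπ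
      (BoundedContinuousFunction.mkOfCompact f)
    exact ((ENNReal.tendsto_toReal hW).comp (h.comp hb.tendsto_atTop)).mul h2

/-- Weak convergence on the compact space `G₂(S³)` is uniform on the bounded Lipschitz functions,
which form a compact set by the theorem of Arzelà and Ascoli. -/
theorem tendsto_Fdist {μ : ℕ → Measure GrS3} [∀ k, IsFiniteMeasure (μ k)] {V : Measure GrS3}
    [IsFiniteMeasure V]
    (h : ∀ f : C(GrS3, ℝ), Tendsto (fun k => ∫ q, f q ∂μ k) atTop (𝓝 (∫ q, f q ∂V))) :
    Tendsto (fun k => Fdist (μ k) V) atTop (𝓝 0) := by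
  let A : Set (BoundedContinuousFunction GrS3 ℝ) := {f | (∀ q, |f q| ≤ 1) ∧ LipschitzWith 1 f}
  have hA : IsCompact A := by
    refine BoundedContinuousFunction.arzela_ascoli₂ (Icc (-1) 1) isCompact_Icc A ?_
      (fun f q hf => abs_le.1 (hf.1 q)) ?_
    · have h1 : A = (⋂ q, {f | |f q| ≤ 1}) ∩ ⋂ p : GrS3 × GrS3,
          {f | dist (f p.1) (f p.2) ≤ 1 * dist p.1 p.2} := by
        ext f
        simp only [A, mem_inter_iff, mem_iInter]
        refine and_congr Iff.rfl ⟨fun h p => h.dist_le_mul p.1 p.2, fun h => ?_⟩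
        exact LipschitzWith.of_dist_le_mul fun p q => h (p, q)
      rw [h1]
      have hev (q : GrS3) : Continuous fun f : BoundedContinuousFunction GrS3 ℝ => f q :=
        (BoundedContinuousFunction.lipschitz_eval_const q).continuous
      exact (isClosed_iInter fun q => isClosed_le (hev q).abs continuous_const).inter
        (isClosed_iInter fun p => isClosed_le ((hev p.1).dist (hev p.2)) continuous_const)
    · exact (LipschitzWith.uniformEquicontinuous _ 1 fun f : A => f.2.2).equicontinuous
  have hmass := h 1
  simp only [ContinuousMap.one_apply, integral_const, smul_eq_mul, mul_one] at hmass
  set C : ℝ := V.real univ with hC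
  have hC0 : 0 ≤ C := measureReal_nonneg
  rw [Metric.tendsto_nhds]
  intro ε hε
  set r : ℝ := ε / (8 * (C + 1)) with hr
  have hr0 : 0 < r := by positivity
  have hrC : r * (2 * C + 1) ≤ ε / 4 := by
    have : r * (8 * (C + 1)) = ε := by rw [hr]; field_simp
    nlinarith
  -- It suffices to test on finitely many functions, `r`-dense among the admissible ones.
  obtain ⟨t, htA, htf, hAt⟩ := hA.finite_cover_balls hr0
  have h1 : ∀ᶠ k in atTop, ∀ f ∈ t, |∫ q, f q ∂μ k - ∫ q, f q ∂V| < ε / 4 := by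
    refine (eventually_all_finite htf).2 fun f _ => ?_
    have h2 := Metric.tendsto_nhds.1 (h f.toContinuousMap) (ε / 4) (by positivity)
    exact h2.mono fun k hk => by rwa [Real.dist_eq] at hk
  have h2 : ∀ᶠ k in atTop, (μ k).real univ < C + 1 := hmass.eventually_lt_const (by linarith)
  filter_upwards [h1, h2] with k hk1 hk2
  have hb : ∀ s ∈ {s | ∃ f : GrS3 → ℝ, (∀ q, |f q| ≤ 1) ∧ LipschitzWith 1 f ∧
      s = ∫ q, f q ∂μ k - ∫ q, f q ∂V}, s ≤ ε / 2 := by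
    rintro s ⟨f, hf1, hf2, rfl⟩
    let f' : BoundedContinuousFunction GrS3 ℝ :=
      BoundedContinuousFunction.mkOfCompact ⟨f, hf2.continuous⟩
    have hf' : f' ∈ A := ⟨hf1, hf2⟩
    obtain ⟨e, he, hfe⟩ := mem_iUnion₂.1 (hAt hf')
    have h3 (q) : ‖f' q - e q‖ ≤ r := by
      rw [← dist_eq_norm]
      exact (BoundedContinuousFunction.dist_coe_le_dist q).trans (le_of_lt hfe)
    have hi (m : Measure GrS3) [IsFiniteMeasure m] (u : BoundedContinuousFunction GrS3 ℝ) :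
        Integrable u m := u.integrable m
    have h4 (m : Measure GrS3) [IsFiniteMeasure m] :
        |∫ q, f' q ∂m - ∫ q, e q ∂m| ≤ r * m.real univ := by
      rw [← integral_sub (hi m f') (hi m e)]
      exact norm_integral_le_of_norm_le_const (Eventually.of_forall h3)
    have h5 := h4 (μ k)
    have h6 := h4 V
    have h7 := hk1 e he
    have h8 : r * (μ k).real univ ≤ r * (C + 1) := mul_le_mul_of_nonneg_left hk2.le hr0.le
    change ∫ q, f' q ∂μ k - ∫ q, f' q ∂V ≤ ε / 2
    rw [abs_le] at h5 h6
    rw [abs_lt] at h7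
    linarith
  have h0 : (0 : ℝ) ∈ {s | ∃ f : GrS3 → ℝ, (∀ q, |f q| ≤ 1) ∧ LipschitzWith 1 f ∧
      s = ∫ q, f q ∂μ k - ∫ q, f q ∂V} :=
    ⟨fun _ => 0, by simp, LipschitzWith.const' 0, by simp⟩
  have h9 : 0 ≤ Fdist (μ k) V := le_csSup ⟨ε / 2, hb⟩ h0
  have h10 : Fdist (μ k) V ≤ ε / 2 := csSup_le ⟨0, h0⟩ hb
  rw [Real.dist_eq, sub_zero, abs_of_nonneg h9]
  linarith

/-! ### Uniform continuity of `grLift` -/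

/-- The vector `(x, -1) / √(1 + |x|²)`. Stereographic projection and its differential are
expressed through the reflection in the hyperplane orthogonal to it. -/
noncomputable def stereoAxis (x : E3) : E4 :=
  (√(1 + ‖x‖ ^ 2))⁻¹ • WithLp.toLp 2 (x, (-1 : ℝ))

theorem norm_toLp_neg_one (x : E3) : ‖(WithLp.toLp 2 (x, (-1 : ℝ)) : E4)‖ = √(1 + ‖x‖ ^ 2) := by
  rw [eq_comm, Real.sqrt_eq_iff_eq_sq (by positivity) (norm_nonneg _), normSq_eq]
  change _ = ‖x‖ ^ 2 + (-1 : ℝ) ^ 2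
  ring

theorem norm_stereoAxis (x : E3) : ‖stereoAxis x‖ = 1 := by
  have : 0 < √(1 + ‖x‖ ^ 2) := Real.sqrt_pos.2 (by positivity)
  rw [stereoAxis, norm_smul, norm_toLp_neg_one, Real.norm_of_nonneg (by positivity),
    inv_mul_cancel₀ this.ne']

theorem norm_stereoAxis_sub_le (x y : E3) : ‖stereoAxis x - stereoAxis y‖ ≤ 2 * ‖x - y‖ := by
  set a : E4 := WithLp.toLp 2 (x, (-1 : ℝ)) with ha
  set b : E4 := WithLp.toLp 2 (y, (-1 : ℝ)) with hb
  have hab : ‖a - b‖ = ‖x - y‖ := by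
    have h1 := normSq_eq (a - b)
    have h2 : (a - b).fst = x - y := rfl
    have h3 : (a - b).snd = 0 := sub_self (-1 : ℝ)
    rw [h2, h3] at h1
    have h4 : ‖a - b‖ ^ 2 = ‖x - y‖ ^ 2 := by rw [h1]; ring
    exact (pow_left_inj₀ (norm_nonneg _) (norm_nonneg _) two_ne_zero).1 h4
  have ha1 : 1 ≤ ‖a‖ := by
    rw [ha, norm_toLp_neg_one, Real.one_le_sqrt]
    linarith [sq_nonneg ‖x‖]
  have hb1 : 1 ≤ ‖b‖ := by
    rw [hb, norm_toLp_neg_one, Real.one_le_sqrt]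
    linarith [sq_nonneg ‖y‖]
  have h1 : stereoAxis x - stereoAxis y = ‖a‖⁻¹ • (a - b) + (‖a‖⁻¹ * (‖b‖ - ‖a‖) * ‖b‖⁻¹) • b := by
    rw [stereoAxis, stereoAxis, ← norm_toLp_neg_one, ← norm_toLp_neg_one, ← ha, ← hb]
    have : ‖a‖⁻¹ * (‖b‖ - ‖a‖) * ‖b‖⁻¹ = ‖a‖⁻¹ - ‖b‖⁻¹ := by field_simp
    rw [this, smul_sub, sub_smul]
    abel
  rw [h1, ← hab]
  refine (norm_add_le _ _).trans ?_
  have h2 : ‖a‖⁻¹ ≤ 1 := inv_le_one_of_one_le₀ ha1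
  have h3 : ‖‖a‖⁻¹ • (a - b)‖ ≤ ‖a - b‖ := by
    rw [norm_smul, norm_inv, norm_norm]
    exact mul_le_of_le_one_left (norm_nonneg _) h2
  have h4 : ‖(‖a‖⁻¹ * (‖b‖ - ‖a‖) * ‖b‖⁻¹) • b‖ ≤ ‖a - b‖ := by
    rw [norm_smul, norm_mul, norm_mul, norm_inv, norm_inv, norm_norm, norm_norm, mul_assoc,
      inv_mul_cancel₀ (by linarith), mul_one, Real.norm_eq_abs, abs_sub_comm]
    have h5 := abs_norm_sub_norm_le a b
    exact (mul_le_of_le_one_left (abs_nonneg _) h2).trans h5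
  linarith

theorem norm_reflection_sub_le {E : Type*} [NormedAddCommGroup E] [InnerProductSpace ℝ E]
    {e e' : E} (he : ‖e‖ = 1) (he' : ‖e'‖ = 1) (w : E) :
    ‖(w - (2 * ⟪e, w⟫_ℝ) • e) - (w - (2 * ⟪e', w⟫_ℝ) • e')‖ ≤ 4 * ‖e - e'‖ * ‖w‖ := by
  have h1 : (w - (2 * ⟪e, w⟫_ℝ) • e) - (w - (2 * ⟪e', w⟫_ℝ) • e') =
      -((2 * ⟪e, w⟫_ℝ) • (e - e') + (2 * ⟪e - e', w⟫_ℝ) • e') := by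
    rw [inner_sub_left, smul_sub, mul_sub, sub_smul]
    abel
  rw [h1, norm_neg]
  refine (norm_add_le _ _).trans ?_
  rw [norm_smul, norm_smul, he', Real.norm_eq_abs, Real.norm_eq_abs, abs_mul, abs_mul, abs_two]
  have h2 := abs_real_inner_le_norm e w
  have h3 := abs_real_inner_le_norm (e - e') w
  rw [he, one_mul] at h2
  have h4 := mul_le_mul_of_nonneg_right h2 (norm_nonneg (e - e'))
  nlinarith

theorem reflection_stereoAxis (x : E3) (w : E4) : w - (2 * ⟪stereoAxis x, w⟫_ℝ) • stereoAxis x =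
    w - (stereoFactor x * (⟪x, w.fst⟫_ℝ - w.snd)) • WithLp.toLp 2 (x, (-1 : ℝ)) := by
  have h1 : (√(1 + ‖x‖ ^ 2))⁻¹ * (√(1 + ‖x‖ ^ 2))⁻¹ = stereoFactor x / 2 := by
    rw [← mul_inv, Real.mul_self_sqrt (by positivity), stereoFactor]
    field_simp
  have h2 : ⟪(WithLp.toLp 2 (x, (-1 : ℝ)) : E4), w⟫_ℝ = ⟪x, w.fst⟫_ℝ - w.snd := by
    rw [WithLp.prod_inner_apply]
    change ⟪x, w.fst⟫_ℝ + w.snd * (-1) = _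
    ring
  rw [stereoAxis, real_inner_smul_left, h2, smul_smul]
  congr 2
  linear_combination (2 * (⟪x, w.fst⟫_ℝ - w.snd)) * h1

theorem stereo_eq_reflection (x : E3) :
    stereo x = northPole - (2 * ⟪stereoAxis x, northPole⟫_ℝ) • stereoAxis x := by
  rw [reflection_stereoAxis, stereo_eq]
  have h1 : northPole.fst = 0 := rfl
  have h2 : northPole.snd = 1 := rfl
  rw [h1, h2, inner_zero_right]
  refine WithLp.ofLp_injective 2 (Prod.ext ?_ ?_)
  · change stereoFactor x • x = 0 - (stereoFactor x * (0 - 1)) • x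
    rw [zero_sub, ← neg_smul]
    congr 1
    ring
  · change 1 - stereoFactor x = 1 - (stereoFactor x * (0 - 1)) * (-1)
    ring

theorem stereoFrame_eq_reflection (x v : E3) : stereoFrame x v = (WithLp.toLp 2 (v, (0 : ℝ)) : E4) -
    (2 * ⟪stereoAxis x, WithLp.toLp 2 (v, (0 : ℝ))⟫_ℝ) • stereoAxis x := by
  rw [reflection_stereoAxis, stereoFrame_apply]
  refine WithLp.ofLp_injective 2 (Prod.ext ?_ ?_)
  · change v - (stereoFactor x * ⟪x, v⟫_ℝ) • x = v - (stereoFactor x * (⟪x, v⟫_ℝ - 0)) • x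
    rw [sub_zero]
  · change stereoFactor x * ⟪x, v⟫_ℝ = 0 - (stereoFactor x * (⟪x, v⟫_ℝ - 0)) * (-1)
    ring

theorem norm_stereo_sub_le (x y : E3) : ‖stereo x - stereo y‖ ≤ 8 * ‖x - y‖ := by
  rw [stereo_eq_reflection, stereo_eq_reflection]
  have h1 := norm_reflection_sub_le (norm_stereoAxis x) (norm_stereoAxis y) northPole
  have h2 : ‖northPole‖ = 1 := by
    have h3 := normSq_eq northPole
    have h4 : northPole.fst = 0 := rfl
    have h5 : northPole.snd = 1 := rfl
    rw [h4, h5, norm_zero] at h3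
    nlinarith [norm_nonneg northPole]
  rw [h2] at h1
  linarith [norm_stereoAxis_sub_le x y]

theorem norm_stereoFrame_sub_le (x y : E3) : ‖stereoFrame x - stereoFrame y‖ ≤ 8 * ‖x - y‖ := by
  refine ContinuousLinearMap.opNorm_le_bound _ (by positivity) fun v => ?_
  rw [sub_apply, stereoFrame_eq_reflection, stereoFrame_eq_reflection]
  refine (norm_reflection_sub_le (norm_stereoAxis x) (norm_stereoAxis y) _).trans ?_
  have h2 : ‖(WithLp.toLp 2 (v, (0 : ℝ)) : E4)‖ = ‖v‖ := by
    have h3 := normSq_eq (WithLp.toLp 2 (v, (0 : ℝ)) : E4)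
    have h4 : (WithLp.toLp 2 (v, (0 : ℝ)) : E4).fst = v := rfl
    have h5 : (WithLp.toLp 2 (v, (0 : ℝ)) : E4).snd = 0 := rfl
    rw [h4, h5] at h3
    exact (pow_left_inj₀ (norm_nonneg _) (norm_nonneg _) two_ne_zero).1 (by rw [h3]; ring)
  rw [h2]
  have h3 := mul_le_mul_of_nonneg_right (norm_stereoAxis_sub_le x y) (norm_nonneg v)
  linarith

theorem norm_stereoFrame_le (x : E3) : ‖stereoFrame x‖ ≤ 1 :=
  ContinuousLinearMap.opNorm_le_bound _ zero_le_one fun v => by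
    have h : ‖stereoFrame x v‖ ^ 2 = ‖v‖ ^ 2 := by
      rw [← real_inner_self_eq_norm_sq, inner_stereoFrame, real_inner_self_eq_norm_sq]
    rw [one_mul]
    exact le_of_sq_le_sq h.le (norm_nonneg v)

/-- The lift from `G₂(ℝ³)` to `G₂(S³)` is Lipschitz. -/
theorem dist_grLift_le (p q : GrR3) :
    dist (grLift p) (grLift q) ≤ 16 * ‖p.1.1 - q.1.1‖ + ‖p.1.2 - q.1.2‖ := by
  have h1 : ‖p.1.2‖ ≤ 1 := p.2.opNorm_le_one
  have h2 := norm_stereoFrame_sub_le p.1.1 q.1.1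
  set A := stereoFrame p.1.1
  set B := stereoFrame q.1.1
  have hA : ‖A‖ ≤ 1 := norm_stereoFrame_le _
  have hB : ‖B‖ ≤ 1 := norm_stereoFrame_le _
  have hq : ‖q.1.2‖ ≤ 1 := q.2.opNorm_le_one
  have hA' : ‖A.adjoint‖ ≤ 1 := by rwa [LinearIsometryEquiv.norm_map]
  have hB' : ‖B.adjoint‖ ≤ 1 := by rwa [LinearIsometryEquiv.norm_map]
  have hAB : ‖A.adjoint - B.adjoint‖ ≤ 8 * ‖p.1.1 - q.1.1‖ := by
    rwa [← map_sub, LinearIsometryEquiv.norm_map]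
  have h3 : liftProj p.1.1 p.1.2 - liftProj q.1.1 q.1.2 =
      (A - B) ∘L (p.1.2 ∘L A.adjoint) + B ∘L ((p.1.2 - q.1.2) ∘L A.adjoint) +
        B ∘L (q.1.2 ∘L (A.adjoint - B.adjoint)) := by
    ext1 v
    simp [liftProj, A, B]
  have e1 : ‖(A - B) ∘L (p.1.2 ∘L A.adjoint)‖ ≤ 8 * ‖p.1.1 - q.1.1‖ := by
    refine (ContinuousLinearMap.opNorm_comp_le _ _).trans ?_
    have := (ContinuousLinearMap.opNorm_comp_le p.1.2 A.adjoint).trans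
      (mul_le_one₀ h1 (norm_nonneg _) hA')
    exact (mul_le_of_le_one_right (norm_nonneg _) this).trans h2
  have e2 : ‖B ∘L ((p.1.2 - q.1.2) ∘L A.adjoint)‖ ≤ ‖p.1.2 - q.1.2‖ := by
    refine (ContinuousLinearMap.opNorm_comp_le _ _).trans ?_
    have := (ContinuousLinearMap.opNorm_comp_le (p.1.2 - q.1.2) A.adjoint).trans
      (mul_le_of_le_one_right (norm_nonneg _) hA')
    exact (mul_le_of_le_one_left (norm_nonneg _) hB).trans this
  have e3 : ‖B ∘L (q.1.2 ∘L (A.adjoint - B.adjoint))‖ ≤ 8 * ‖p.1.1 - q.1.1‖ := by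
    refine (ContinuousLinearMap.opNorm_comp_le _ _).trans ?_
    have := (ContinuousLinearMap.opNorm_comp_le q.1.2 (A.adjoint - B.adjoint)).trans
      (mul_le_of_le_one_left (norm_nonneg _) hq)
    exact (mul_le_of_le_one_left (norm_nonneg _) hB).trans (this.trans hAB)
  have h4 : ‖liftProj p.1.1 p.1.2 - liftProj q.1.1 q.1.2‖ ≤
      16 * ‖p.1.1 - q.1.1‖ + ‖p.1.2 - q.1.2‖ := by
    rw [h3]
    refine (norm_add₃_le).trans ?_
    linarith
  have h5 := norm_stereo_sub_le p.1.1 q.1.1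
  rw [Subtype.dist_eq, Prod.dist_eq, dist_eq_norm, dist_eq_norm]
  refine max_le ?_ h4
  change ‖stereo p.1.1 - stereo q.1.1‖ ≤ _
  linarith [norm_nonneg (p.1.1 - q.1.1), norm_nonneg (p.1.2 - q.1.2)]

/-! ### Limits of perturbed surfaces -/

theorem IsSurface.isFiniteMeasure_gaussVarifold {S : Set E3} (hS : IsSurface S)
    (hF : gaussArea S < ⊤) : IsFiniteMeasure (gaussVarifold S) :=
  ⟨by rwa [hS.gaussVarifold_univ]⟩

/-- The Gaussian varifold of a slightly perturbed surface is weakly close to that of the surface.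
The area ratio is bounded above pointwise by a number close to `1`, so that it is close to `1` in
`L¹` as soon as the total areas are close. -/
theorem IsControlled.abs_integral_gaussVarifold_image_sub_le {Y : E3 → E3} {N : ℝ}
    (hY : IsControlled Y N) (hN : N ≤ 1 / 2) {S : Set E3} (hS : IsSurface S) (hF : gaussArea S < ⊤)
    {f : GrS3 → ℝ} (hf : Continuous f) {C κ : ℝ} (hC : ∀ q, |f q| ≤ C)
    (hκ : ∀ p q, dist p q ≤ 19 * N → |f p - f q| ≤ κ) :
    |∫ q, f q ∂gaussVarifold ((fun x => x + Y x) '' S) - ∫ q, f q ∂gaussVarifold S| ≤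
      C * (10 * N * (gaussArea S).toReal +
        ((gaussArea S).toReal - (gaussArea ((fun x => x + Y x) '' S)).toReal)) +
      κ * (gaussArea S).toReal := by
  have := isFiniteMeasure_gaussMeasure hF
  have hS' := hS.image (hY.isDiffeo hN)
  have hsm : Continuous fun x => x + Y x := (hY.isDiffeo hN).1.continuous
  set S' := (fun x => x + Y x) '' S with hS'def
  set u : E3 → ℝ := fun x => f (grLift (tangentPoint S' (x + Y x))) with hu
  set v : E3 → ℝ := fun x => f (grLift (tangentPoint S x)) with hv
  set ρ : E3 → ℝ := fun x => areaRatio Y x (tangentProj S x) with hρ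
  have hfg : Continuous fun p : GrR3 => f (grLift p) := hf.comp continuous_grLift
  have hk : ContinuousOn (fun y => f (grLift (tangentPoint S' y))) S' :=
    hfg.comp_continuousOn hS'.continuousOn_tangentPoint
  have huc : ContinuousOn u S := hk.comp hsm.continuousOn (mapsTo_image _ _)
  have hvc : ContinuousOn v S := hfg.comp_continuousOn hS.continuousOn_tangentPoint
  have hui : Integrable u (gaussMeasure S) :=
    Integrable.of_bound (huc.aestronglyMeasurable_gaussMeasure hS) C
      (Eventually.of_forall fun x => hC _)
  have hvi : Integrable v (gaussMeasure S) :=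
    Integrable.of_bound (hvc.aestronglyMeasurable_gaussMeasure hS) C
      (Eventually.of_forall fun x => hC _)
  have hρi : Integrable ρ (gaussMeasure S) := hY.integrable_areaRatio hN hS hF
  have hρu : Integrable (fun x => ρ x * u x) (gaussMeasure S) :=
    hρi.mul_bdd (huc.aestronglyMeasurable_gaussMeasure hS)
      (Eventually.of_forall fun x => hC _)
  rw [hS'.integral_gaussVarifold hf, hS.integral_gaussVarifold hf, hS'def,
    hY.integral_image hN hS hk, ← integral_sub hρu hvi]
  have hbi : Integrable (fun x => C * (10 * N + (1 - ρ x)) + κ) (gaussMeasure S) :=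
    (((integrable_const _).add ((integrable_const _).sub hρi)).const_mul C).add (integrable_const _)
  have hbound : ∀ᵐ x ∂gaussMeasure S, ‖ρ x * u x - v x‖ ≤ C * (10 * N + (1 - ρ x)) + κ := by
    filter_upwards [ae_gaussMeasure hS] with x hx
    have h1 : ρ x ≤ 1 + 5 * N := hY.areaRatio_le_one_add hN x (hS.isPlaneProj hx)
    have hN0 := hY.nonneg
    have h2 : |u x - v x| ≤ κ := by
      refine hκ _ _ ((dist_grLift_le _ _).trans ?_)
      rw [hS.tangentPoint_val hx, hS'.tangentPoint_val (mem_image_of_mem _ hx)]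
      have h3 := hY.norm_tangentProj_sub_le hN hS hx
      have h4 := hY.norm_le x
      simp only [add_sub_cancel_left]
      linarith
    -- As `ρ - 1 ≤ 5 N`, the positive part of `ρ - 1` is small, and so the absolute value is
    -- controlled by `1 - ρ`, whose integral is the loss of area.
    have h3 : |ρ x - 1| ≤ 10 * N + (1 - ρ x) := by
      rw [abs_le]
      constructor <;> linarith
    have h4 : ρ x * u x - v x = (ρ x - 1) * u x + (u x - v x) := by ring
    rw [h4, Real.norm_eq_abs]
    refine (abs_add_le _ _).trans (add_le_add ?_ h2)
    rw [abs_mul, mul_comm]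
    exact mul_le_mul (hC _) h3 (abs_nonneg _) ((abs_nonneg _).trans (hC (grLift (tangentPoint S x))))
  have h5 := norm_integral_le_of_norm_le hbi hbound
  rw [Real.norm_eq_abs] at h5
  refine h5.trans (le_of_eq ?_)
  have e1 : Integrable (fun x => 10 * N + (1 - ρ x)) (gaussMeasure S) :=
    (integrable_const _).add ((integrable_const _).sub hρi)
  have e2 : Integrable (fun x => 1 - ρ x) (gaussMeasure S) := (integrable_const _).sub hρi
  rw [integral_add (e1.const_mul C) (integrable_const _), integral_const_mul,
    integral_add (integrable_const _) e2, integral_sub (integrable_const _) hρi,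
    hY.toReal_gaussArea_image hN hS]
  simp only [integral_const, gaussMeasure_real_univ, smul_eq_mul, mul_one]
  ring

theorem tendsto_integral_gaussVarifold_image {T : ℕ → Set E3} (hT : ∀ k, IsSurface (T k))
    (hF : ∀ k, gaussArea (T k) < ⊤) {Y : ℕ → E3 → E3} {N : ℕ → ℝ}
    (hY : ∀ k, IsControlled (Y k) (N k)) (hN : ∀ k, N k ≤ 1 / 2) (hN0 : Tendsto N atTop (𝓝 0))
    {W : ℝ} (h1 : Tendsto (fun k => (gaussArea (T k)).toReal) atTop (𝓝 W))
    (h2 : Tendsto (fun k => (gaussArea ((fun x => x + Y k x) '' T k)).toReal) atTop (𝓝 W))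
    (f : C(GrS3, ℝ)) :
    Tendsto (fun k => ∫ q, f q ∂gaussVarifold ((fun x => x + Y k x) '' T k) -
      ∫ q, f q ∂gaussVarifold (T k)) atTop (𝓝 0) := by
  have hC (q) : |f q| ≤ ‖f‖ := f.norm_coe_le_norm q
  have hW : 0 ≤ W := ge_of_tendsto' h1 fun k => ENNReal.toReal_nonneg
  rw [Metric.tendsto_nhds]
  intro ε hε
  set κ : ℝ := ε / (4 * (W + 1)) with hκ
  have hκ0 : 0 < κ := by positivity
  obtain ⟨δ, hδ, hfδ⟩ := Metric.uniformContinuous_iff.1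
    (CompactSpace.uniformContinuous_of_continuous f.continuous) κ hκ0
  have e1 : ∀ᶠ k in atTop, 19 * N k < δ := by
    have := hN0.const_mul 19
    rw [mul_zero] at this
    exact this.eventually_lt_const hδ
  have e2 : ∀ᶠ k in atTop, ‖f‖ * (10 * N k * (gaussArea (T k)).toReal + ((gaussArea (T k)).toReal -
      (gaussArea ((fun x => x + Y k x) '' T k)).toReal)) < ε / 2 := by
    have := (((hN0.const_mul 10).mul h1).add (h1.sub h2)).const_mul ‖f‖
    simp only [mul_zero, zero_mul, sub_self, add_zero] at this
    exact this.eventually_lt_const (by positivity)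
  have e3 : ∀ᶠ k in atTop, (gaussArea (T k)).toReal < W + 1 := h1.eventually_lt_const (by linarith)
  filter_upwards [e1, e2, e3] with k k1 k2 k3
  have h := (hY k).abs_integral_gaussVarifold_image_sub_le (hN k) (hT k) (hF k) f.continuous hC
    (κ := κ) fun p q hpq => by
      rw [← Real.dist_eq]
      exact (hfδ (hpq.trans_lt k1)).le
  have h4 : κ * (gaussArea (T k)).toReal ≤ κ * (W + 1) := mul_le_mul_of_nonneg_left k3.le hκ0.le
  have h5 : κ * (W + 1) = ε / 4 := by rw [hκ]; field_simp
  rw [Real.dist_eq, sub_zero]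
  linarith

/-- A sequence of fields controlled by `1` whose first variations detect stationarity and the
absence of mass at infinity. -/
theorem exists_testFields : ∃ (X : ℕ → E3 → E3) (D : ℕ → C(GrS3, ℝ)),
    (∀ i, IsControlled (X i) 1) ∧ (∀ i, ∀ q : GrR3, D i (grLift q) = gaussDivAt (X i) q.1.1 q.1.2) ∧
    ∀ V : Measure GrS3, IsFiniteMeasure V → (∀ i, ∫ q, D i q ∂V = 0) →
      IsFStationary V ∧ mass V {northPole} = 0 := by
  have : Nonempty testFunctions := testFunctions_nonempty.to_subtype
  let d := TopologicalSpace.denseSeq testFunctions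
  choose X hX hXD using fun i => (d i).2
  refine ⟨X, fun i => (d i).1, hX, hXD, fun V hV h => isFStationary_of_testFunctions fun D hD => ?_⟩
  have hc : Continuous fun D : testFunctions => ∫ q, D.1 q ∂V := by
    refine continuous_iff_continuousAt.2 fun D₀ => ?_
    refine tendsto_iff_norm_sub_tendsto_zero.2 (squeeze_zero (fun _ => norm_nonneg _)
      (g := fun D : testFunctions => ‖D.1 - D₀.1‖ * V.real univ) (fun D => ?_) ?_)
    · have hi (E : C(GrS3, ℝ)) : Integrable E V :=
        (BoundedContinuousFunction.mkOfCompact E).integrable V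
      rw [← integral_sub (hi D.1) (hi D₀.1)]
      exact norm_integral_le_of_norm_le_const
        (Eventually.of_forall fun q => (D.1 - D₀.1).norm_coe_le_norm q)
    · have h1 : Continuous fun D : testFunctions => ‖D.1 - D₀.1‖ * V.real univ := by fun_prop
      simpa using h1.tendsto D₀
  have h1 : (fun D : testFunctions => ∫ q, D.1 q ∂V) = fun _ => 0 :=
    (TopologicalSpace.denseRange_denseSeq testFunctions).equalizer hc continuous_const
      (funext fun i => h i)
  exact congrFun h1 ⟨D, hD⟩

theorem areaVariation_eq_integral_gaussVarifold {S : Set E3} (hS : IsSurface S) {X : E3 → E3}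
    {D : C(GrS3, ℝ)} (hD : ∀ q : GrR3, D (grLift q) = gaussDivAt X q.1.1 q.1.2) :
    ∫ q, D q ∂gaussVarifold S = areaVariation S X := by
  rw [hS.integral_gaussVarifold D.continuous, areaVariation]
  refine integral_congr_ae ?_
  filter_upwards [ae_gaussMeasure hS] with x hx
  rw [hD, hS.tangentPoint_val hx]

instance : Nonempty GrS3 := ⟨grLift (tangentPoint ∅ 0)⟩

/-- If the first variations of the surfaces `T k` along the test fields tend to zero, and smaller
and smaller perturbations of them have the same limit area, then the perturbed surfaces
subconverge to a stationary varifold without mass at infinity. -/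
theorem exists_subseq_tendsto_stationary {X : ℕ → E3 → E3} {D : ℕ → C(GrS3, ℝ)}
    (hXD : ∀ i, ∀ q : GrR3, D i (grLift q) = gaussDivAt (X i) q.1.1 q.1.2)
    (hD : ∀ V : Measure GrS3, IsFiniteMeasure V → (∀ i, ∫ q, D i q ∂V = 0) →
      IsFStationary V ∧ mass V {northPole} = 0)
    {T : ℕ → Set E3} (hT : ∀ k, IsSurface (T k))
    (hF : ∀ k, gaussArea (T k) < ⊤) {Y : ℕ → E3 → E3} {N : ℕ → ℝ}
    (hY : ∀ k, IsControlled (Y k) (N k)) (hN : ∀ k, N k ≤ 1 / 2) (hN0 : Tendsto N atTop (𝓝 0))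
    {W : ℝ≥0∞} (hW : W ≠ ⊤)
    (h1 : Tendsto (fun k => gaussArea (T k)) atTop (𝓝 W))
    (h2 : Tendsto (fun k => gaussArea ((fun x => x + Y k x) '' T k)) atTop (𝓝 W))
    (hX0 : ∀ i, Tendsto (fun k => areaVariation (T k) (X i)) atTop (𝓝 0)) :
    ∃ b : ℕ → ℕ, StrictMono b ∧ ∃ V : Measure GrS3, IsFiniteMeasure V ∧ IsFStationary V ∧
      mass V {northPole}ᶜ = W ∧ mass V {northPole} = 0 ∧
      Tendsto (fun k => Fdist (gaussVarifold ((fun x => x + Y (b k) x) '' T (b k))) V)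
        atTop (𝓝 0) := by
  have hfin (k) : IsFiniteMeasure (gaussVarifold (T k)) :=
    (hT k).isFiniteMeasure_gaussVarifold (hF k)
  have hfin' (k) : IsFiniteMeasure (gaussVarifold ((fun x => x + Y k x) '' T k)) :=
    ((hT k).image ((hY k).isDiffeo (hN k))).isFiniteMeasure_gaussVarifold
      ((hY k).gaussArea_image_lt_top (hN k) (hT k) (hF k))
  obtain ⟨b, hb, V, hV, hVW, hlim⟩ := exists_subseq_tendsto_integral
    (μ := fun k => gaussVarifold (T k)) hW (h1.congr fun k => (hT k).gaussVarifold_univ.symm)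
  obtain ⟨hst, hnorth⟩ := hD V hV fun i => by
    refine tendsto_nhds_unique (hlim (D i)) (((hX0 i).comp hb.tendsto_atTop).congr fun k => ?_)
    exact (areaVariation_eq_integral_gaussVarifold (hT _) (hXD i)).symm
  refine ⟨b, hb, V, hV, hst, ?_, hnorth, ?_⟩
  · have hm : MeasurableSet {q : GrS3 | q.1.1 ∈ ({northPole} : Set E4)} :=
      (measurableSet_singleton northPole).preimage
        (continuous_fst.comp continuous_subtype_val).measurable
    have h3 := measure_add_measure_compl (μ := V) hm
    have h4 : V {q : GrS3 | q.1.1 ∈ ({northPole} : Set E4)} = 0 := hnorth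
    rw [h4, zero_add, hVW] at h3
    exact h3
  · refine tendsto_Fdist (μ := fun k => gaussVarifold ((fun x => x + Y (b k) x) '' T (b k)))
      fun f => ?_
    have h3 := tendsto_integral_gaussVarifold_image hT hF hY hN hN0
      ((ENNReal.tendsto_toReal hW).comp h1) ((ENNReal.tendsto_toReal hW).comp h2) f
    have h4 := (h3.comp hb.tendsto_atTop).add (hlim f)
    rw [zero_add] at h4
    exact h4.congr fun k => sub_add_cancel _ _

/-! ### Pulling tight -/

theorem mem_saturation_self {n g : ℕ} {S : Cube n → Set E3} (hS : IsContinuousFamily g S) :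
    S ∈ saturation g S := by
  have h0 : IsSmallFamily fun _ : (Fin n → ℝ) × E3 => (0 : E3) := ⟨contDiff_const, by simp⟩
  refine ⟨hS, fun q => q.2, contDiff_snd.contDiffOn, fun ν => ?_,
    ⟨∅, isCompact_empty, empty_subset _, fun _ _ _ => rfl⟩, fun ν => by simp⟩
  simpa using h0.isDiffZero (ν : Fin n → ℝ)

theorem eq_of_mem_saturation_of_mem_cubeBoundary {n g : ℕ} {S S' : Cube n → Set E3}
    (h : S' ∈ saturation g S) {ν : Cube n} (hν : ν ∈ cubeBoundary n) : S' ν = S ν := by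
  obtain ⟨-, ψ, -, -, ⟨K, -, hK, hψ⟩, h'⟩ := h
  rw [h' ν]
  simp [hψ ν fun h => hν (hK h)]

theorem proposition7p1 {n g : ℕ} (S : Cube n → Set E3) (hS : IsContinuousFamily g S)
    (hW : (⨆ ν ∈ cubeBoundary n, gaussArea (S ν)) < minMaxValue (saturation g S)) :
    ∃ Φ : ℕ → Cube n → Set E3, IsMinimizingSeq (saturation g S) Φ ∧
      ∀ ν : ℕ → Cube n, IsMinMaxSeq (saturation g S) Φ ν →
        ∀ a : ℕ → ℕ, StrictMono a → ∃ b : ℕ → ℕ, StrictMono b ∧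
          ∃ V : Measure GrS3, IsFiniteMeasure V ∧ IsFStationary V ∧
            mass V {northPole}ᶜ = minMaxValue (saturation g S) ∧
            mass V {northPole} = 0 ∧
            Tendsto (fun k => Fdist (gaussVarifold (Φ (a (b k)) (ν (a (b k))))) V)
              atTop (𝓝 0) := by
  set Λ := saturation g S with hΛ
  have hWtop : minMaxValue Λ ≠ ⊤ :=
    ((iInf₂_le S (mem_saturation_self hS)).trans_lt hS.bounded).ne
  set W : ℝ := (minMaxValue Λ).toReal with hWdef
  have hWof : ENNReal.ofReal W = minMaxValue Λ := ENNReal.ofReal_toReal hWtop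
  have hW0 : 0 ≤ W := ENNReal.toReal_nonneg
  obtain ⟨w₀, hw₀, hw₀W⟩ := ENNReal.lt_iff_exists_nnreal_btwn.1 hW
  have hw : (w₀ : ℝ) < W := (ENNReal.lt_ofReal_iff_toReal_lt ENNReal.coe_ne_top).1
    (by rwa [hWof])
  set η : ℕ → ℝ := fun k => 1 / ((k : ℝ) + 1) with hη
  have hη0 (k) : 0 < η k := by positivity
  have hη1 (k) : η k ≤ 1 := (div_le_one (by positivity)).2 (by simp)
  have hηlim : Tendsto η atTop (𝓝 0) := tendsto_one_div_add_atTop_nhds_zero_nat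
  -- An arbitrary minimizing sequence, to be improved by one step of descent.
  have hmin (k : ℕ) : ∃ R ∈ Λ, maxArea R < ENNReal.ofReal (W + η k) := by
    have h1 : minMaxValue Λ < ENNReal.ofReal (W + η k) := by
      rw [← hWof]
      exact (ENNReal.ofReal_lt_ofReal_iff (by linarith [hη0 k])).2 (by linarith [hη0 k])
    simpa only [minMaxValue, iInf_lt_iff, exists_prop] using h1
  choose R hRΛ hRmax using hmin
  have hRle (k ν) : (gaussArea (R k ν)).toReal ≤ W + η k :=
    ENNReal.toReal_le_of_le_ofReal (by linarith [hη0 k])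
      ((le_iSup (fun ν => gaussArea (R k ν)) ν).trans (hRmax k).le)
  obtain ⟨X, D, hX, hXD, hD⟩ := exists_testFields
  choose Y hY hYν using fun k => (hRΛ k).1.exists_descent (M := W + 1) (by linarith) hw
    (fun ν => (hRle k ν).trans (by linarith [hη1 k]))
    (fun ν hν => by
      rw [eq_of_mem_saturation_of_mem_cubeBoundary (hRΛ k) hν]
      have h1 := (le_iSup₂ (f := fun ν (_ : ν ∈ cubeBoundary n) => gaussArea (S ν)) ν hν).trans_lt
        hw₀
      exact ENNReal.toReal_lt_of_lt_ofReal (by rwa [ENNReal.ofReal_coe_nnreal]))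
    hX k (hη0 k) (hη1 k)
  choose N hN hNc hN2 hdesc using hYν
  set Φ : ℕ → Cube n → Set E3 := fun k ν => (fun x => x + Y k (ν, x)) '' R k ν with hΦ
  have hΦΛ (k) : Φ k ∈ Λ := (hY k).image_mem_saturation (hRΛ k)
  set E : ∀ k, Cube n → ℝ := fun k ν =>
    ramp w₀ W (gaussArea (R k ν)).toReal * gradientSq (R k ν) X k with hE
  have hE0 (k ν) : 0 ≤ E k ν := mul_nonneg (ramp_nonneg _ _ _) (gradientSq_nonneg _ _ _)
  set c : ℝ := 1 / (32 * (W + 1 + 1)) with hc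
  have hc0 : 0 < c := by positivity
  have hdesc' (k ν) : (gaussArea (Φ k ν)).toReal + c * E k ν ≤
      (gaussArea (R k ν)).toReal + 2 * η k := hdesc k ν
  refine ⟨Φ, ⟨hΦΛ, ?_⟩, fun ν hν a ha => ?_⟩
  · have h1 : Tendsto (fun k => ENNReal.ofReal (W + 3 * η k)) atTop (𝓝 (minMaxValue Λ)) := by
      rw [← hWof]
      refine ENNReal.tendsto_ofReal ?_
      simpa using (hηlim.const_mul 3).const_add W
    refine tendsto_of_tendsto_of_tendsto_of_le_of_le tendsto_const_nhds h1
      (fun k => iInf₂_le (Φ k) (hΦΛ k)) fun k => iSup_le fun ν => ?_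
    rw [← ENNReal.ofReal_toReal ((hΦΛ k).1.gaussArea_lt_top ν).ne]
    refine ENNReal.ofReal_le_ofReal ?_
    have h2 := hdesc' k ν
    have h3 := mul_nonneg hc0.le (hE0 k ν)
    linarith [hRle k ν]
  · have hν' : Tendsto (fun k => (gaussArea (Φ k (ν k))).toReal) atTop (𝓝 W) :=
      (ENNReal.tendsto_toReal hWtop).comp hν
    -- The areas before and after the descent have the same limit, so the gain tends to zero.
    have hElim : Tendsto (fun k => E k (ν k)) atTop (𝓝 0) := by
      have h1 : Tendsto (fun k => (W + 3 * η k - (gaussArea (Φ k (ν k))).toReal) / c) atTop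
          (𝓝 0) := by
        simpa using (((hηlim.const_mul 3).const_add W).sub hν').div_const c
      refine squeeze_zero (fun k => hE0 k _) (fun k => ?_) h1
      rw [le_div_iff₀ hc0]
      linarith [hdesc' k (ν k), hRle k (ν k)]
    have hRlim : Tendsto (fun k => (gaussArea (R k (ν k))).toReal) atTop (𝓝 W) := by
      refine tendsto_of_tendsto_of_tendsto_of_le_of_le
        (g := fun k => (gaussArea (Φ k (ν k))).toReal - 2 * η k) (h := fun k => W + η k) ?_ ?_
        (fun k => ?_) fun k => hRle k (ν k)
      · simpa using hν'.sub (hηlim.const_mul 2)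
      · simpa using hηlim.const_add W
      · have h2 := mul_nonneg hc0.le (hE0 k (ν k))
        change (gaussArea (Φ k (ν k))).toReal - 2 * η k ≤ (gaussArea (R k (ν k))).toReal
        linarith [hdesc' k (ν k)]
    have hNlim : Tendsto (fun k => N k (ν k)) atTop (𝓝 0) := by
      have h1 : Tendsto (fun k => √(2 * E k (ν k) + 2 * η k ^ 2)) atTop (𝓝 0) := by
        have := ((hElim.const_mul 2).add ((hηlim.pow 2).const_mul 2)).sqrt
        simpa using this
      exact squeeze_zero (fun k => (hNc k (ν k)).nonneg)
        (fun k => Real.le_sqrt_of_sq_le (hN2 k (ν k))) h1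
    have hramp : ∀ᶠ k in atTop, 1 / 2 ≤ ramp w₀ W (gaussArea (R k (ν k))).toReal := by
      have h1 := ((continuous_ramp w₀ W).tendsto W).comp hRlim
      rw [ramp_self hw] at h1
      exact (h1.eventually_const_lt (by norm_num)).mono fun k hk => hk.le
    have hvar (i : ℕ) : Tendsto (fun k => areaVariation (R k (ν k)) (X i)) atTop (𝓝 0) := by
      have hf := fieldWeight_pos i
      have h1 : Tendsto (fun k => √(2 * E k (ν k) / fieldWeight i)) atTop (𝓝 0) := by
        have := ((hElim.const_mul 2).div_const (fieldWeight i)).sqrt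
        simpa using this
      refine squeeze_zero_norm' ?_ h1
      filter_upwards [hramp, eventually_gt_atTop i] with k hk hik
      refine Real.le_sqrt_of_sq_le ?_
      rw [Real.norm_eq_abs, sq_abs, le_div_iff₀ hf]
      have h2 : fieldWeight i * areaVariation (R k (ν k)) (X i) ^ 2 ≤
          gradientSq (R k (ν k)) X k :=
        Finset.single_le_sum (f := fun i => fieldWeight i * areaVariation (R k (ν k)) (X i) ^ 2)
          (fun j _ => mul_nonneg (fieldWeight_pos j).le (sq_nonneg _)) (Finset.mem_range.2 hik)
      have h3 := mul_le_mul_of_nonneg_right hk (gradientSq_nonneg (R k (ν k)) X k)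
      simp only [hE]
      linarith
    have hT (k) : IsSurface (R k (ν k)) := (hRΛ k).1.smooth.isSurface _
    have hF (k) : gaussArea (R k (ν k)) < ⊤ := (hRΛ k).1.gaussArea_lt_top _
    have hRlim' : Tendsto (fun k => gaussArea (R k (ν k))) atTop (𝓝 (minMaxValue Λ)) := by
      rw [← hWof]
      exact (ENNReal.tendsto_ofReal hRlim).congr fun k => ENNReal.ofReal_toReal (hF k).ne
    have hat := ha.tendsto_atTop
    exact exists_subseq_tendsto_stationary hXD hD (T := fun k => R (a k) (ν (a k)))
      (Y := fun k x => Y (a k) (ν (a k), x)) (N := fun k => N (a k) (ν (a k)))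
      (fun k => hT _) (fun k => hF _) (fun k => hNc _ _) (fun k => hN _ _) (hNlim.comp hat) hWtop
      (hRlim'.comp hat) (hν.comp hat) fun i => (hvar i).comp hat
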